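/- Let $B\subset\mathbb C$ be a non-empty connected open set, let $q,r$ be holomorphic functions on $B$, and consider the Ince-XXXV system $$\frac{dx}{dt}=xy-3r,\qquad \frac{dy}{dt}=\tfrac23x^2-\tfrac13y^2-\tfrac23xy-\tfrac{10}3qx+\tfrac23qy+\tfrac83q^2+3r+4q' \qquad (q=q(t),\ r=r(t),\ '=d/dt).$$ For $t\in B$ let $\mathbb C^2\ni(x,y)\subset\mathbb P^2$ be the standard affine chart, $[z_0:z_1:z_2]$ with $(x,y)=(z_1/z_0,z_2/z_0)$, and blow up $\mathbb P^2$ successively at the following ten (infinitely near) points at infinity, each being the limit as $u\to0$ of the given arc of the affine plane in the surface obtained so far: * $(\tfrac1u,-\tfrac1u)$, $(\tfrac1u,-\tfrac1u+4q)$; * $(\tfrac1u,\tfrac1{2u})$, $(\tfrac1u,\tfrac1{2u}-2q)$, $(\tfrac1u,\tfrac1{2u}-2q+(\tfrac92r+6q')u)$, $(\tfrac1u,\tfrac1{2u}-2q+(\tfrac92r+6q')u-(9r'+12q'')u^2)$; * $(0,\tfrac1u)$, $(0,\tfrac1u)$, $(\tfrac92ru,\tfrac1u)$, $(\tfrac92ru-\tfrac12(18qr-27r')u^2,\tfrac1u)$.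 (1) The result is a compact rational surface $\mathcal X_t$ of type $E_7^{(1)}$: it contains eight $(-2)$-curves (smooth rational curves with self-intersection $-2$) $D_{0},\dots,D_{7}$ whose dual graph is the affine Dynkin diagram $E_7^{(1)}$ (two of them cross normally at exactly one point if they are joined in the diagram, and are disjoint otherwise). The complement $\mathcal X_t\setminus\bigcup_iD_i$ is obtained by gluing four copies of $\mathbb C^2\ni(x_j,y_j)$, $j=0,1,2,3$, via the birational transformations $$\begin{aligned} 0)\ &x_0=x,\quad y_0=y,\\ 1)\ &x_1=\tfrac1x,\quad y_1=(y+x-4q)x,\\ 2)\ &x_2=\tfrac1x,\quad y_2=-\left(\left(\left(y-\tfrac x2+2q\right)x-\tfrac{9r}2-6q'\right)x+9r'+12q''\right)x,\\ 3)\ &x_3=-\left(\left(xy-\tfrac{9r}2\right)y+\tfrac{18qr-27r'}2\right)y,\quad y_3=\tfrac1y, \end{aligned}$$ where the chart $j=0$ is the affine plane, it meets the charts $j=1,2$ in $x\ne0$ and the chart $j=3$ in $y\neq0$, and any two charts meet only inside the chart $j=0$. (2) Letting $t$ vary, the four copies $\mathbb C^2\times B\ni(x_j,y_j,t)$ glued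 by the same transformations form a Hausdorff complex threefold $\mathcal X$, whose fibre over $t$ is $\mathcal X_t\setminus\bigcup_iD_i$. (3) $\mathcal X$ is the phase space of the system under the following condition on $q,r$: there are constants $c_1,c_2\in\mathbb C$ with $$q''=-2qq'-3qr-\frac{3c_1+c_2}4,\qquad r'=2qr+c_1\qquad\text{on }B.\tag{$*$}$$ Namely, if the vector field $\partial_t+\frac{dx}{dt}\partial_x+\frac{dy}{dt}\partial_y$ of the system extends holomorphically to all four charts of $\mathcal X$, then $(*)$ holds. Conversely, if $(*)$ holds, then in each of the four charts the system is a system of differential equations whose right-hand sides are polynomials in $x_j,y_j$ with coefficients holomorphic in $t\in B$, and every solution $(x(t),y(t))$ that is meromorphic at a point $t_0\in B$ has, as $t\to t_0$, a limit in $\mathcal X$, which lies in the fibre over $t_0$. -/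

import Mathlib

open Filter Topology Set
open scoped Manifold ContDiff LinearAlgebra.Projectivization

noncomputable section

namespace Ince

/-- A (Hausdorff) complex manifold modelled on the finite dimensional complex vector space `E`;
`ω` is the holomorphic (complex analytic) smoothness class. -/
structure ComplexManifold (E : Type) [NormedAddCommGroup E] [NormedSpace ℂ E] where
  carrier : Type
  [topology : TopologicalSpace carrier]
  [charted : ChartedSpace E carrier]
  [isManifold : IsManifold 𝓘(ℂ, E) ω carrier]
  [t2 : T2Space carrier]

instance (E : Type) [NormedAddCommGroup E] [NormedSpace ℂ E] :
    CoeSort (ComplexManifold E) Type := ⟨ComplexManifold.carrier⟩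

attribute [instance] ComplexManifold.topology ComplexManifold.charted
  ComplexManifold.isManifold ComplexManifold.t2

/-- Complex surfaces. -/
abbrev Surface : Type 1 := ComplexManifold (ℂ × ℂ)

/-- Complex threefolds; a point of the model is written `((x, y), t)`. -/
abbrev Threefold : Type 1 := ComplexManifold ((ℂ × ℂ) × ℂ)

/-- `φ` is a holomorphic coordinate system on an open subset of `X`. -/
def IsHolChart {E : Type} [NormedAddCommGroup E] [NormedSpace ℂ E] (X : ComplexManifold E)
    (φ : OpenPartialHomeomorph X E) : Prop :=
  φ ∈ IsManifold.maximalAtlas 𝓘(ℂ, E) ω X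

/-! ### The projective plane -/

/-- Homogeneous coordinates `[z₀ : z₁ : z₂]` of the points of the three standard affine charts:
`(x, y) = (z₁/z₀, z₂/z₀)`, `(X₁, Y₁) = (1/x, y/x)`, `(X₂, Y₂) = (x/y, 1/y)`. -/
def homog (i : Fin 3) (z : ℂ × ℂ) : Fin 3 → ℂ :=
  match i with
  | 0 => ![1, z.1, z.2]
  | 1 => ![z.1, 1, z.2]
  | 2 => ![z.2, z.1, 1]

theorem homog_ne_zero (i : Fin 3) (z : ℂ × ℂ) : homog i z ≠ 0 := by
  intro h
  have h' := congrFun h i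
  fin_cases i <;> simp [homog] at h'

/-- The complex surface `X`, its points being identified through `h` with the points of the
projective plane, carries the standard complex structure of the projective plane. -/
def IsProjectivePlane (X : Surface) (h : X ≃ ℙ ℂ (Fin 3 → ℂ)) : Prop :=
  ∀ i : Fin 3, ∃ χ : OpenPartialHomeomorph X (ℂ × ℂ), IsHolChart X χ ∧ χ.target = univ ∧
    ∀ z, h (χ.symm z) = Projectivization.mk ℂ (homog i z) (homog_ne_zero i z)

/-! ### Blowing up a point of a complex surface -/

/-- `π : Y → X` is the blowing-up of the complex surface `X` at the point `p`: it is biholomorphic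
over the complement of `p`, and there are coordinates `(u, v)` of `X` centred at `p` over whose
domain `Y` is covered by two coordinate systems `(a, b)` and `(c, d)` with
`(u, v) = (a, a b) = (c d, d)`, glued along `b ≠ 0` by `(c, d) = (1 / b, a b)`. -/
structure IsBlowUp {X Y : Surface} (π : Y → X) (p : X) : Prop where
  holomorphic : ContMDiff 𝓘(ℂ, ℂ × ℂ) 𝓘(ℂ, ℂ × ℂ) ω π
  iso_off : ∃ g : X → Y, ContMDiffOn 𝓘(ℂ, ℂ × ℂ) 𝓘(ℂ, ℂ × ℂ) ω g {p}ᶜ ∧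
    (∀ x, x ≠ p → π (g x) = x) ∧ (∀ y, π y ≠ p → g (π y) = y)
  local_form : ∃ (φ : OpenPartialHomeomorph X (ℂ × ℂ)) (ψ₁ ψ₂ : OpenPartialHomeomorph Y (ℂ × ℂ)),
    IsHolChart X φ ∧ IsHolChart Y ψ₁ ∧ IsHolChart Y ψ₂ ∧
    p ∈ φ.source ∧ φ p = 0 ∧
    ψ₁.source ∪ ψ₂.source = π ⁻¹' φ.source ∧
    ψ₁.target = {w | (w.1, w.1 * w.2) ∈ φ.target} ∧
    ψ₂.target = {w | (w.1 * w.2, w.2) ∈ φ.target} ∧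
    (∀ y ∈ ψ₁.source, φ (π y) = ((ψ₁ y).1, (ψ₁ y).1 * (ψ₁ y).2)) ∧
    (∀ y ∈ ψ₂.source, φ (π y) = ((ψ₂ y).1 * (ψ₂ y).2, (ψ₂ y).2)) ∧
    (∀ y ∈ ψ₁.source, y ∈ ψ₂.source ↔ (ψ₁ y).2 ≠ 0) ∧
    (∀ y ∈ ψ₁.source ∩ ψ₂.source, ψ₂ y = ((ψ₁ y).2⁻¹, (ψ₁ y).1 * (ψ₁ y).2))

/-- A tower `S 10 → ⋯ → S 1 → S 0` of compact complex surfaces that starts from the projective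
plane, in which `S (k + 1)` is the blowing-up of `S k` at the point at infinity that is the limit,
as `u → 0`, of the arc `γ k u` of the affine plane. The affine plane `ℂ² ∋ (x, y)` is contained
in every `S k` through the map `affine k`. -/
structure BlowUpTower (γ : Fin 10 → ℂ → ℂ × ℂ) where
  S : Fin 11 → Surface
  compact : ∀ k, CompactSpace (S k)
  /-- the points of `S 0` are those of the projective plane -/
  plane : S 0 ≃ ℙ ℂ (Fin 3 → ℂ)
  isPlane : IsProjectivePlane (S 0) plane
  affine : ∀ k, ℂ × ℂ → S k
  affine_zero : ∀ z, plane (affine 0 z) = Projectivization.mk ℂ (homog 0 z) (homog_ne_zero 0 z)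
  /-- the blowing-down maps -/
  π : ∀ k : Fin 10, S k.succ → S k.castSucc
  affine_succ : ∀ (k : Fin 10) (z : ℂ × ℂ), π k (affine k.succ z) = affine k.castSucc z
  /-- the centres -/
  center : ∀ k : Fin 10, S k.castSucc
  center_spec : ∀ k : Fin 10,
    Tendsto (fun u => affine k.castSucc (γ k u)) (𝓝[≠] 0) (𝓝 (center k))
  isBlowUp : ∀ k : Fin 10, IsBlowUp (π k) (center k)

/-- The surface at the top of the tower. -/
abbrev BlowUpTower.top {γ : Fin 10 → ℂ → ℂ × ℂ} (𝒯 : BlowUpTower γ) : Surface :=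
  𝒯.S (Fin.last 10)

/-! ### Surfaces of type `E₇⁽¹⁾` -/

/-- `C` is a smooth rational curve in the surface `X` with self-intersection number `n`, that is,
`C` is a compact complex submanifold isomorphic to the projective line whose normal bundle is
`𝒪(n)`: there are coordinates `(u, v)` and `(u', v')` of `X` near `C` in which `C` is the line
`v = 0`, respectively `v' = 0`, and such that `u' = 1 / u` and `∂v' / ∂v = u ^ (-n)` along `C`. -/
def IsSmoothRationalCurve (X : Surface) (C : Set X) (n : ℤ) : Prop :=
  ∃ α β : OpenPartialHomeomorph X (ℂ × ℂ), IsHolChart X α ∧ IsHolChart X β ∧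
    C ⊆ α.source ∪ β.source ∧
    α '' (C ∩ α.source) = {w | w.2 = 0} ∧
    β '' (C ∩ β.source) = {w | w.2 = 0} ∧
    (∀ x ∈ C ∩ α.source, x ∈ β.source ↔ (α x).1 ≠ 0) ∧
    (∀ x ∈ C ∩ α.source ∩ β.source, (β x).1 = (α x).1⁻¹ ∧
      HasDerivAt (fun v : ℂ => (β (α.symm ((α x).1, v))).2) ((α x).1 ^ (-n)) 0)

/-- The curves `C` and `D` cross normally at `p`. -/
def CrossNormallyAt (X : Surface) (C D : Set X) (p : X) : Prop :=
  ∃ φ : OpenPartialHomeomorph X (ℂ × ℂ), IsHolChart X φ ∧ p ∈ φ.source ∧ φ p = 0 ∧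
    (∀ x ∈ φ.source, x ∈ C ↔ (φ x).1 = 0) ∧ (∀ x ∈ φ.source, x ∈ D ↔ (φ x).2 = 0)

/-- The affine Dynkin diagram `E₇⁽¹⁾`: the chain `0 - 1 - 2 - 3 - 4 - 5 - 6`, with `7` attached
to the middle node `3`. -/
def dynkinAffineE7 : SimpleGraph (Fin 8) :=
  SimpleGraph.fromEdgeSet {s(0, 1), s(1, 2), s(2, 3), s(3, 4), s(4, 5), s(5, 6), s(3, 7)}

/-- The curves `D 0, …, D 7` are `(-2)`-curves whose dual graph is the diagram `E₇⁽¹⁾`: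
two different ones cross normally at exactly one point if they are joined in the diagram, and are
disjoint otherwise. -/
structure IsTypeAffineE7 (X : Surface) (D : Fin 8 → Set X) : Prop where
  minus_two : ∀ i, IsSmoothRationalCurve X (D i) (-2)
  meet : ∀ i j, dynkinAffineE7.Adj i j → ∃ p, D i ∩ D j = {p} ∧ CrossNormallyAt X (D i) (D j) p
  disjoint : ∀ i j, i ≠ j → ¬ dynkinAffineE7.Adj i j → D i ∩ D j = ∅

/-! ### Gluing -/

/-- The open sets `(φ j).source`, with coordinates `φ j`, cover `U` and are glued by the
transformations `φ j = T j (φ 0)`, defined where the coordinates `φ 0` lie in `dom j`; different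
open sets meet only inside the one with index `0`. -/
structure IsGluedBy {M E : Type} [TopologicalSpace M] [TopologicalSpace E]
    (U : Set M) (φ : Fin 4 → OpenPartialHomeomorph M E)
    (dom : Fin 4 → Set E) (T : Fin 4 → E → E) : Prop where
  cover : ⋃ j, (φ j).source = U
  overlap : ∀ j, ∀ p ∈ (φ 0).source, p ∈ (φ j).source ↔ φ 0 p ∈ dom j
  transition : ∀ j, ∀ p ∈ (φ 0).source ∩ (φ j).source, φ j p = T j (φ 0 p)
  inter : ∀ i j, i ≠ j → (φ i).source ∩ (φ j).source ⊆ (φ 0).source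

/-! ### The Ince-XXXV system -/

section System

variable (q r : ℂ → ℂ)

/-- The right-hand side of the system at `((x, y), t)`. -/
def rhs (z : (ℂ × ℂ) × ℂ) : ℂ × ℂ :=
  let x := z.1.1
  let y := z.1.2
  let t := z.2
  (x * y - 3 * r t,
    2 / 3 * x ^ 2 - 1 / 3 * y ^ 2 - 2 / 3 * x * y - 10 / 3 * q t * x + 2 / 3 * q t * y
      + 8 / 3 * q t ^ 2 + 3 * r t + 4 * deriv q t)

/-- The four coordinate systems `(x_j, y_j)` as functions of `(x, y)`, for given `t`. -/
def coord (t : ℂ) (j : Fin 4) (z : ℂ × ℂ) : ℂ × ℂ :=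
  let x := z.1
  let y := z.2
  match j with
  | 0 => (x, y)
  | 1 => (1 / x, (y + x - 4 * q t) * x)
  | 2 => (1 / x, -(((y - x / 2 + 2 * q t) * x - 9 * r t / 2 - 6 * deriv q t) * x
            + 9 * deriv r t + 12 * iteratedDeriv 2 q t) * x)
  | 3 => (-((x * y - 9 * r t / 2) * y + (18 * q t * r t - 27 * deriv r t) / 2) * y, 1 / y)

/-- The domain of definition of `coord q r t j` in the `(x, y)`-plane. -/
def coordDom (j : Fin 4) : Set (ℂ × ℂ) :=
  match j with
  | 0 => univ
  | 1 => {z | z.1 ≠ 0}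
  | 2 => {z | z.1 ≠ 0}
  | 3 => {z | z.2 ≠ 0}

/-- The coordinate systems `(x_j, y_j, t)` as functions of `(x, y, t)`. -/
def coordT (j : Fin 4) (z : (ℂ × ℂ) × ℂ) : (ℂ × ℂ) × ℂ := (coord q r z.2 j z.1, z.2)

/-- The domain of definition of `coordT q r j` over the time domain `B`. -/
def coordTDom (B : Set ℂ) (j : Fin 4) : Set ((ℂ × ℂ) × ℂ) := coordDom j ×ˢ B

/-- The arcs whose limit points are the ten successive centres of the blowing-ups for the
parameter `t`: two, four and four infinitely near points over the points `(X₁, Y₁) = (0, -1)`,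
`(X₁, Y₁) = (0, 1/2)` and `(X₂, Y₂) = (0, 0)` of the line at infinity. In the coordinates that
result from the previous blowing-ups, the centres are the points
`y + x = 4 q`; `y - x/2 = -2 q`, `(y - x/2 + 2 q) x = 9 r/2 + 6 q'`,
`((y - x/2 + 2 q) x - 9 r/2 - 6 q') x = -(9 r' + 12 q'')`; `x = 0`, `x y = 9 r/2`,
`(x y - 9 r/2) y = -(18 q r - 27 r')/2` of the last exceptional curve. -/
def arc (t : ℂ) (k : Fin 10) (u : ℂ) : ℂ × ℂ :=
  match k with
  | 0 => (1 / u, -1 / u)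
  | 1 => (1 / u, -1 / u + 4 * q t)
  | 2 => (1 / u, 1 / (2 * u))
  | 3 => (1 / u, 1 / (2 * u) - 2 * q t)
  | 4 => (1 / u, 1 / (2 * u) - 2 * q t + (9 * r t / 2 + 6 * deriv q t) * u)
  | 5 => (1 / u, 1 / (2 * u) - 2 * q t + (9 * r t / 2 + 6 * deriv q t) * u
            - (9 * deriv r t + 12 * iteratedDeriv 2 q t) * u ^ 2)
  | 6 => (0, 1 / u)
  | 7 => (0, 1 / u)
  | 8 => (9 * r t / 2 * u, 1 / u)
  | 9 => (9 * r t / 2 * u - (18 * q t * r t - 27 * deriv r t) / 2 * u ^ 2, 1 / u)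

/-- The vector field `∂/∂t + x' ∂/∂x + y' ∂/∂y` of the system. -/
def field (z : (ℂ × ℂ) × ℂ) : (ℂ × ℂ) × ℂ := (rhs q r z, 1)

/-- The vector field of the system, written in the coordinates `(x_j, y_j, t)`, extends
holomorphically to the whole of `ℂ² × B`. -/
def HolomorphicInChart (B : Set ℂ) (j : Fin 4) : Prop :=
  ∃ F : (ℂ × ℂ) × ℂ → (ℂ × ℂ) × ℂ, DifferentiableOn ℂ F (univ ×ˢ B) ∧
    ∀ z ∈ coordTDom B j, fderiv ℂ (coordT q r j) z (field q r z) = F (coordT q r j z)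

/-- In the coordinates `(x_j, y_j, t)` the system takes the form `x_j' = P (x_j, y_j, t)`,
`y_j' = Q (x_j, y_j, t)`, where `P` and `Q` are polynomials in `x_j, y_j` whose coefficients are
holomorphic functions of `t ∈ B`. -/
def PolynomialInChart (B : Set ℂ) (j : Fin 4) : Prop :=
  ∃ P Q : MvPolynomial (Fin 2) (ℂ → ℂ),
    (∀ m, DifferentiableOn ℂ (P.coeff m) B) ∧ (∀ m, DifferentiableOn ℂ (Q.coeff m) B) ∧
    ∀ z ∈ coordTDom B j, ∀ w, w = coordT q r j z →
      fderiv ℂ (coordT q r j) z (field q r z) =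
        ((MvPolynomial.eval ![w.1.1, w.1.2] (P.map (Pi.evalRingHom (fun _ => ℂ) w.2)),
          MvPolynomial.eval ![w.1.1, w.1.2] (Q.map (Pi.evalRingHom (fun _ => ℂ) w.2))), 1)

/-- The three-dimensional system for `q, q', r`, with constant parameters `c₁, c₂`. -/
def Constraint (B : Set ℂ) : Prop :=
  ∃ c₁ c₂ : ℂ, ∀ t ∈ B,
    iteratedDeriv 2 q t = -2 * q t * deriv q t - 3 * q t * r t - (3 * c₁ + c₂) / 4 ∧
    deriv r t = 2 * q t * r t + c₁

/-- `(x, y)` is a solution of the system near `t₀` that is meromorphic at `t₀`. -/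
def IsMeromorphicSolutionAt (x y : ℂ → ℂ) (t₀ : ℂ) : Prop :=
  MeromorphicAt x t₀ ∧ MeromorphicAt y t₀ ∧
    ∀ᶠ t in 𝓝[≠] t₀, HasDerivAt x (rhs q r ((x t, y t), t)).1 t ∧
      HasDerivAt y (rhs q r ((x t, y t), t)).2 t

end System

end Ince

end

/-! The three arcs at infinity give three branches of the tower, with 2, 4 and 4 blowings-up. With X
= 1/x (or X = 1/y on the third branch), adding the polynomial `centrePoly` in X to y/x (or x/y)
moves all centres of a branch to the origin. After m blowings-up the branch therefore has the
coordinates (X, w) in which the sheared coordinate is X^m w, and for m = 2, 4, 4 these are the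
charts 1, 2, 3 up to sign and order.

The geometry rests on one invariant, `Configuration`, preserved by `Configuration.exists_blow`. Each
centre lies on the last curve of its branch and on no other curve, so that curve loses 1 in
self-intersection and crosses the new (-1)-curve once. The line at infinity starts with 1 and
carries the first centre of each of the three branches, so it ends with -2. Every exceptional curve
except the last of its branch ends with -2 as well. Without the three last curves, chains of 1, 3
and 3 curves remain attached to the line: this is the diagram E₇⁽¹⁾. The last curves, apart from
their crossings with the previous ones, are the lines X = 0 of the charts 1, 2, 3, which explains
the gluing. The blowing-up of a surface is built by hand from the points other than the centre and
the directions at the centre. The transition maps are difference quotients, holomorphic by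
Hadamard's lemma (`contDiffAt_slopeAt`). The degree of a strict transform is computed in
`isSmoothRationalCurve_strict`.

The threefold is Hausdorff because it maps continuously to the product of the projective plane and
the time axis, and two points with the same image lie in a common chart.

The chain rule gives polynomial right-hand sides in all charts, except for one simple pole each in
the charts 2 and 3, with coefficients `obstruction₂` and `obstruction₃`. A holomorphic extension
forces both to vanish. They are combinations of derivatives of r' - 2qr and q'' + 2qq' + 3qr, so on
the connected set B their vanishing is equivalent to the condition (*).

For limits of solutions, residues of logarithmic derivatives show that a pole of x is simple, that y
then has residue -1 and that x has residue 1 or -2. If only y has a pole, then it has residue 3 and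
x tends to 0. These three cases belong to the charts 1, 2, 3. In each of them the nonlinear terms of
the equation for the remaining coordinate contain a product already known to have a limit, so the
equation becomes linear with convergent coefficients. A meromorphic solution of such an equation has
no pole (`exists_tendsto_of_linear`). -/

noncomputable section

namespace Ince

/-! ### Complex manifolds from holomorphically compatible partial charts -/

section HolAtlas

variable {E : Type} [NormedAddCommGroup E] [NormedSpace ℂ E]

/-- A family of partial charts of a bare type, covering it, with holomorphic transition maps
between open sets. -/
structure HolAtlas (M E : Type) [NormedAddCommGroup E] [NormedSpace ℂ E] where
  ι : Type
  e : ι → PartialEquiv M E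
  cover : ∀ x, ∃ i, x ∈ (e i).source
  isOpen : ∀ i j, IsOpen ((e i).symm.trans (e j)).source
  contDiffOn : ∀ i j, ContDiffOn ℂ ω ((e i).symm.trans (e j)) ((e i).symm.trans (e j)).source

namespace HolAtlas

variable {M : Type} (A : HolAtlas M E)

/-- The charted space core of a holomorphic atlas. -/
def core : ChartedSpaceCore E M where
  atlas := range A.e
  chartAt x := A.e (A.cover x).choose
  mem_chart_source x := (A.cover x).choose_spec
  chart_mem_atlas x := mem_range_self _
  open_source := by
    rintro _ _ ⟨i, rfl⟩ ⟨j, rfl⟩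
    exact A.isOpen i j
  continuousOn_toFun := by
    rintro _ _ ⟨i, rfl⟩ ⟨j, rfl⟩
    exact (A.contDiffOn i j).continuousOn

/-- The topology in which all charts are homeomorphisms. -/
@[reducible] def top : TopologicalSpace M := A.core.toTopologicalSpace

/-- The charts as homeomorphisms. -/
def homeo (i : A.ι) : @OpenPartialHomeomorph M E A.top _ :=
  A.core.openPartialHomeomorph (A.e i) (mem_range_self i)

theorem isManifold : @IsManifold ℂ _ E _ _ E _ 𝓘(ℂ, E) ω M A.top A.core.toChartedSpace := by
  let := A.top
  let := A.core.toChartedSpace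
  refine isManifold_of_contDiffOn _ _ _ ?_
  intro e e' he he'
  have key : ∀ f : OpenPartialHomeomorph M E, f ∈ atlas E M →
      ∃ i, f.toPartialEquiv = A.e i := by
    intro f hf
    change f ∈ ⋃ (e : PartialEquiv M E) (he : e ∈ A.core.atlas),
      {A.core.openPartialHomeomorph e he} at hf
    simp only [mem_iUnion, mem_singleton_iff] at hf
    obtain ⟨_, ⟨i, rfl⟩, rfl⟩ := hf
    exact ⟨i, rfl⟩
  obtain ⟨i, hi⟩ := key e he
  obtain ⟨j, hj⟩ := key e' he'
  have h := A.contDiffOn i j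
  rw [← hi, ← hj] at h
  simpa using h

/-- A criterion for the Hausdorff property: points with different images under a continuous map
are separated, and points with the same image lie in a common chart. -/
theorem t2Space_of_map {Z : Type} [TopologicalSpace Z] [T2Space Z] (f : M → Z)
    (hf : ∀ i, ContinuousOn (f ∘ (A.e i).symm) (A.e i).target)
    (h : ∀ x y, f x = f y → ∃ i, x ∈ (A.e i).source ∧ y ∈ (A.e i).source) :
    @T2Space M A.top := by
  let := A.top
  have hc : Continuous f := by
    rw [continuous_iff_continuousAt]
    intro x
    obtain ⟨i, hi⟩ := A.cover x
    refine ((A.homeo i).symm.continuousAt_iff_continuousAt_comp_right (f := f) hi).2 ?_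
    exact (hf i).continuousAt ((A.homeo i).open_target.mem_nhds ((A.homeo i).map_source hi))
  refine ⟨fun x y hxy => ?_⟩
  by_cases hfxy : f x = f y
  · obtain ⟨i, hx, hy⟩ := h x y hfxy
    have hne : A.homeo i x ≠ A.homeo i y := fun h' => hxy ((A.homeo i).injOn hx hy h')
    obtain ⟨U, V, hU, hV, hxU, hyV, hd⟩ := t2_separation hne
    refine ⟨(A.homeo i).source ∩ A.homeo i ⁻¹' U, (A.homeo i).source ∩ A.homeo i ⁻¹' V,
      (A.homeo i).isOpen_inter_preimage hU, (A.homeo i).isOpen_inter_preimage hV,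
      ⟨hx, hxU⟩, ⟨hy, hyV⟩, ?_⟩
    exact (hd.preimage (A.homeo i)).mono inter_subset_right inter_subset_right
  · obtain ⟨U, V, hU, hV, hxU, hyV, hd⟩ := t2_separation hfxy
    exact ⟨f ⁻¹' U, f ⁻¹' V, hU.preimage hc, hV.preimage hc, hxU, hyV, hd.preimage f⟩

/-- The complex manifold defined by a holomorphic atlas. -/
def toManifold (h : @T2Space M A.top) : ComplexManifold E :=
  @ComplexManifold.mk E _ _ M A.top A.core.toChartedSpace A.isManifold h

/-- The charts of the complex manifold defined by a holomorphic atlas. -/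
def chart (h : @T2Space M A.top) (i : A.ι) : OpenPartialHomeomorph (A.toManifold h) E :=
  A.homeo i

theorem isHolChart (h : @T2Space M A.top) (i : A.ι) :
    IsHolChart (A.toManifold h) (A.chart h i) := by
  refine IsManifold.subset_maximalAtlas ?_
  change A.homeo i ∈ ⋃ (e : PartialEquiv M E) (he : e ∈ A.core.atlas),
      {A.core.openPartialHomeomorph e he}
  simp only [mem_iUnion, mem_singleton_iff]
  exact ⟨A.e i, mem_range_self i, rfl⟩

end HolAtlas

end HolAtlas

/-! ### Holomorphic charts -/

section IsHolChart

variable {E : Type} [NormedAddCommGroup E] [NormedSpace ℂ E] {X : ComplexManifold E}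

theorem isHolChart_iff {φ : OpenPartialHomeomorph X E} :
    IsHolChart X φ ↔ ContMDiffOn 𝓘(ℂ, E) 𝓘(ℂ, E) ω φ φ.source ∧
      ContMDiffOn 𝓘(ℂ, E) 𝓘(ℂ, E) ω φ.symm φ.target :=
  IsManifold.mem_maximalAtlas_iff_contMDiffOn φ

theorem IsHolChart.contDiffOn_transition {φ ψ : OpenPartialHomeomorph X E}
    (hφ : IsHolChart X φ) (hψ : IsHolChart X ψ) :
    ContDiffOn ℂ ω (ψ ∘ φ.symm) (φ.target ∩ φ.symm ⁻¹' ψ.source) := by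
  rw [← contMDiffOn_iff_contDiffOn]
  exact (isHolChart_iff.1 hψ).1.comp ((isHolChart_iff.1 hφ).2.mono inter_subset_left)
    (fun x hx => hx.2)

theorem IsHolChart.contDiffAt_transition {φ ψ : OpenPartialHomeomorph X E}
    (hφ : IsHolChart X φ) (hψ : IsHolChart X ψ) {w : E} (hw : w ∈ φ.target)
    (hw' : φ.symm w ∈ ψ.source) : ContDiffAt ℂ ω (ψ ∘ φ.symm) w :=
  (hφ.contDiffOn_transition hψ).contDiffAt
    ((φ.isOpen_inter_preimage_symm ψ.open_source).mem_nhds ⟨hw, hw'⟩)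

theorem IsHolChart.restr {φ : OpenPartialHomeomorph X E} (hφ : IsHolChart X φ) {s : Set X}
    (hs : IsOpen s) : IsHolChart X (φ.restr s) :=
  restr_mem_maximalAtlas _ hφ hs

/-- Composition of a holomorphic chart with a biholomorphic map of the model space. -/
theorem IsHolChart.trans {φ : OpenPartialHomeomorph X E} (hφ : IsHolChart X φ)
    {e : OpenPartialHomeomorph E E} (he : ContDiffOn ℂ ω e e.source)
    (he' : ContDiffOn ℂ ω e.symm e.target) : IsHolChart X (φ.trans e) := by
  rw [isHolChart_iff] at hφ ⊢
  rw [← contMDiffOn_iff_contDiffOn] at he he'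
  constructor
  · refine he.comp (hφ.1.mono ?_) ?_ <;> intro x hx <;> simp_all
  · refine hφ.2.comp (he'.mono ?_) ?_ <;> intro x hx <;> simp_all

end IsHolChart

/-! ### Difference quotients of holomorphic maps -/

/-- Hadamard's lemma for analytic maps. -/
theorem exists_analyticAt_eq_add_apply_sub {E F : Type*} [NormedAddCommGroup E] [NormedSpace ℂ E]
    [NormedAddCommGroup F] [NormedSpace ℂ F] [CompleteSpace F] {G : E → F} {z₀ : E}
    (hG : AnalyticAt ℂ G z₀) :
    ∃ A : E → E →L[ℂ] F, AnalyticAt ℂ A z₀ ∧ A z₀ = fderiv ℂ G z₀ ∧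
      ∀ᶠ z in 𝓝 z₀, G z = G z₀ + A z (z - z₀) := by
  obtain ⟨p, r, hp⟩ := hG
  -- The operator A is the sum of the shifted series: every term of degree n + 1 of the expansion of
  -- G is a term of degree n with values in linear maps, applied to z - z₀.
  have hr : 0 < p.shift.radius := by
    rw [FormalMultilinearSeries.radius_shift]
    exact hp.r_pos.trans_le hp.r_le
  have hA := p.shift.hasFPowerSeriesOnBall hr
  have hA' : AnalyticAt ℂ (fun z => p.shift.sum (z - z₀)) z₀ := by
    have := hA.comp_sub z₀
    simpa using this.analyticAt
  have key : ∀ᶠ z in 𝓝 z₀, G z = G z₀ + p.shift.sum (z - z₀) (z - z₀) := by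
    filter_upwards [Metric.eball_mem_nhds z₀ hp.r_pos] with z hz
    have hz' : z - z₀ ∈ Metric.eball (0 : E) r := by
      simpa [edist_eq_enorm_sub] using hz
    have hs := hp.hasSum hz'
    have hz'' : z - z₀ ∈ Metric.eball (0 : E) p.shift.radius := by
      rw [FormalMultilinearSeries.radius_shift]
      exact Metric.eball_subset_eball hp.r_le hz'
    have hs2 := (ContinuousLinearMap.apply ℂ F (z - z₀)).hasSum (hA.hasSum hz'')
    simp only [zero_add] at hs2
    rw [add_sub_cancel] at hs
    have h0 : p 0 (fun _ => z - z₀) = G z₀ := by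
      rw [← hp.coeff_zero (fun _ => z - z₀)]
    have hs3 : HasSum (fun n => p (n + 1) (fun _ => z - z₀))
        (p.shift.sum (z - z₀) (z - z₀)) := by
      convert hs2 using 2 with n
      swap
      · rfl
      simp only [FormalMultilinearSeries.shift, ContinuousLinearMap.apply_apply,
        ContinuousMultilinearMap.curryRight_apply]
      congr 1
      ext i
      refine Fin.lastCases ?_ (fun j => ?_) i <;> simp
    have := HasSum.zero_add (f := fun n => p n (fun _ => z - z₀)) hs3
    rw [h0] at this
    exact hs.unique this
  refine ⟨_, hA', ?_, key⟩
  -- In the product rule the derivative of A is applied to z₀ - z₀ = 0, so only A z₀ survives.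
  have h1 : HasFDerivAt (fun z => G z₀ + p.shift.sum (z - z₀) (z - z₀))
      (p.shift.sum (z₀ - z₀)) z₀ := by
    have := (hA'.differentiableAt.hasFDerivAt.clm_apply
      ((hasFDerivAt_id z₀).sub_const z₀)).const_add (G z₀)
    refine this.congr_fderiv ?_
    ext v
    simp
  exact ((h1.congr_of_eventuallyEq key).fderiv).symm

/-- The map `(a, b) ↦ (a, a b)`. -/
def blowDown (w : ℂ × ℂ) : ℂ × ℂ := (w.1, w.1 * w.2)

theorem contDiff_blowDown : ContDiff ℂ ω blowDown := by
  unfold blowDown; fun_prop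

/-- The difference quotient `(G (z₀ + (a, a b)) - G z₀) / a`, extended to `a = 0`. -/
def slopeAt (G : ℂ × ℂ → ℂ × ℂ) (z₀ w : ℂ × ℂ) : ℂ × ℂ :=
  open Classical in
  if w.1 = 0 then fderiv ℂ G z₀ (1, w.2) else w.1⁻¹ • (G (z₀ + blowDown w) - G z₀)

theorem smul_slopeAt (G : ℂ × ℂ → ℂ × ℂ) (z₀ w : ℂ × ℂ) :
    w.1 • slopeAt G z₀ w = G (z₀ + blowDown w) - G z₀ := by
  by_cases h : w.1 = 0
  · have : blowDown w = 0 := by simp [blowDown, h]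
    simp [h, this]
  · simp [slopeAt, h]

/-- By Hadamard's lemma the increment of G along (a, a b) = a (1, b) is a times an analytic operator
applied to (1, b). Cancelling a leaves an expression that is analytic across a = 0, where the
operator is the differential of G. -/
theorem contDiffAt_slopeAt {G : ℂ × ℂ → ℂ × ℂ} {z₀ w : ℂ × ℂ}
    (hG : ContDiffAt ℂ ω G (z₀ + blowDown w)) : ContDiffAt ℂ ω (slopeAt G z₀) w := by
  by_cases h : w.1 = 0
  · have hb : blowDown w = 0 := by simp [blowDown, h]
    rw [hb, add_zero] at hG
    obtain ⟨A, hA, hA0, hev⟩ := exists_analyticAt_eq_add_apply_sub hG.analyticAt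
    have hA1 : AnalyticAt ℂ (fun v : ℂ × ℂ => A (z₀ + blowDown v)) w := by
      refine AnalyticAt.fun_comp (g := A) (f := fun v => z₀ + blowDown v) ?_ ?_
      · simpa [hb] using hA
      · exact ((contDiff_const.add contDiff_blowDown).contDiffAt).analyticAt
    have hA2 : ContDiffAt ℂ ω (fun v : ℂ × ℂ => A (z₀ + blowDown v) (1, v.2)) w := by
      have h2 : ContDiffAt ℂ ω (fun v : ℂ × ℂ => ((1 : ℂ), v.2)) w := by fun_prop
      exact (hA1.contDiffAt (n := ω)).clm_apply h2
    refine hA2.congr_of_eventuallyEq ?_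
    have hcont : Tendsto (fun v : ℂ × ℂ => z₀ + blowDown v) (𝓝 w) (𝓝 z₀) := by
      have : ContinuousAt (fun v : ℂ × ℂ => z₀ + blowDown v) w :=
        (continuous_const.add contDiff_blowDown.continuous).continuousAt
      simpa [ContinuousAt, hb] using this
    filter_upwards [hcont.eventually hev] with v hv
    by_cases hv0 : v.1 = 0
    · have hbv : blowDown v = 0 := by simp [blowDown, hv0]
      simp [slopeAt, hv0, hbv, hA0]
    · have : blowDown v = v.1 • ((1 : ℂ), v.2) := by simp [blowDown]
      rw [slopeAt, if_neg hv0, hv, add_sub_cancel_left, add_sub_cancel_left, this, map_smul,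
        inv_smul_smul₀ hv0]
  · have hev : slopeAt G z₀ =ᶠ[𝓝 w] fun v => v.1⁻¹ • (G (z₀ + blowDown v) - G z₀) := by
      have : ∀ᶠ v : ℂ × ℂ in 𝓝 w, v.1 ≠ 0 := continuousAt_fst.eventually_ne h
      filter_upwards [this] with v hv
      rw [slopeAt, if_neg hv]
    refine ContDiffAt.congr_of_eventuallyEq ?_ hev
    refine (contDiffAt_fst.inv h).smul (ContDiffAt.sub ?_ contDiffAt_const)
    exact ContDiffAt.comp w hG ((contDiff_const.add contDiff_blowDown).contDiffAt)

theorem slopeAt_of_fst_eq_zero (G : ℂ × ℂ → ℂ × ℂ) (z₀ : ℂ × ℂ) {w : ℂ × ℂ} (h : w.1 = 0) :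
    slopeAt G z₀ w = fderiv ℂ G z₀ (1, w.2) := if_pos h

/-! ### Directions in the plane -/

/-- The direction of a non-zero vector of the plane, `none` being the direction of `(0, 1)`. -/
def dir (v : ℂ × ℂ) : Option ℂ :=
  open Classical in if v.1 = 0 then none else some (v.2 / v.1)

/-- A vector with given direction. -/
def vec : Option ℂ → ℂ × ℂ
  | some b => (1, b)
  | none => (0, 1)

theorem vec_ne_zero (o : Option ℂ) : vec o ≠ 0 := by
  cases o <;> simp [vec]

theorem dir_vec (o : Option ℂ) : dir (vec o) = o := by
  cases o <;> simp [vec, dir]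

theorem exists_smul_vec_dir {v : ℂ × ℂ} (hv : v ≠ 0) : ∃ c : ℂ, c ≠ 0 ∧ v = c • vec (dir v) := by
  by_cases h : v.1 = 0
  · refine ⟨v.2, fun h2 => hv (Prod.ext h h2), ?_⟩
    ext <;> simp [dir, vec, h]
  · refine ⟨v.1, h, ?_⟩
    ext <;> simp [dir, vec, h, mul_div_cancel₀]

theorem dir_smul {c : ℂ} (hc : c ≠ 0) (v : ℂ × ℂ) : dir (c • v) = dir v := by
  by_cases h : v.1 = 0 <;> simp [dir, h, hc, mul_div_mul_left]

/-! ### The blowing-up of a point -/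

namespace BlowUp

variable {X : Surface}

/-- The derivative at `p` of the transition map from the chart `χ` to the chart `χ'`. -/
def trans (p : X) (χ χ' : OpenPartialHomeomorph X (ℂ × ℂ)) : ℂ × ℂ →L[ℂ] ℂ × ℂ :=
  fderiv ℂ (χ' ∘ χ.symm) (χ p)

/-- This is the chain rule at p. The cocycle relation makes tangent directions at p independent of
the chart in which they are written. -/
theorem trans_trans {p : X} {χ χ' χ'' : OpenPartialHomeomorph X (ℂ × ℂ)} (h : IsHolChart X χ)
    (h' : IsHolChart X χ') (h'' : IsHolChart X χ'') (hp : p ∈ χ.source) (hp' : p ∈ χ'.source)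
    (hp'' : p ∈ χ''.source) (v : ℂ × ℂ) :
    trans p χ' χ'' (trans p χ χ' v) = trans p χ χ'' v := by
  have hd : ∀ {α β : OpenPartialHomeomorph X (ℂ × ℂ)}, IsHolChart X α → IsHolChart X β →
      p ∈ α.source → p ∈ β.source → DifferentiableAt ℂ (β ∘ α.symm) (α p) := by
    intro α β hα hβ hpα hpβ
    exact (hα.contDiffAt_transition hβ (α.map_source hpα)
      (by rwa [α.left_inv hpα])).differentiableAt (by simp)
  have h1 : (χ' ∘ χ.symm) (χ p) = χ' p := by simp [hp]
  have hcomp := fderiv_comp (χ p) (g := χ'' ∘ χ'.symm) (f := χ' ∘ χ.symm)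
    (by rw [h1]; exact hd h' h'' hp' hp'') (hd h h' hp hp')
  have hev : (χ'' ∘ χ'.symm) ∘ (χ' ∘ χ.symm) =ᶠ[𝓝 (χ p)] χ'' ∘ χ.symm := by
    have hmem : χ.target ∩ χ.symm ⁻¹' χ'.source ∈ 𝓝 (χ p) :=
      (χ.isOpen_inter_preimage_symm χ'.open_source).mem_nhds
        ⟨χ.map_source hp, by simpa [hp] using hp'⟩
    filter_upwards [hmem] with w hw
    simp [χ'.left_inv hw.2]
  rw [hev.fderiv_eq, h1] at hcomp
  simp only [trans, hcomp, ContinuousLinearMap.comp_apply]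

theorem trans_self {p : X} {χ : OpenPartialHomeomorph X (ℂ × ℂ)} (hp : p ∈ χ.source)
    (v : ℂ × ℂ) : trans p χ χ v = v := by
  have hev : χ ∘ χ.symm =ᶠ[𝓝 (χ p)] id := by
    filter_upwards [χ.open_target.mem_nhds (χ.map_source hp)] with w hw
    simp [χ.right_inv hw]
  rw [trans, hev.fderiv_eq, fderiv_id, ContinuousLinearMap.id_apply]

theorem trans_ne_zero {p : X} {χ χ' : OpenPartialHomeomorph X (ℂ × ℂ)} (h : IsHolChart X χ)
    (h' : IsHolChart X χ') (hp : p ∈ χ.source) (hp' : p ∈ χ'.source) {v : ℂ × ℂ} (hv : v ≠ 0) :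
    trans p χ χ' v ≠ 0 := by
  intro h0
  have := trans_trans h h' h hp hp' hp v
  rw [h0, map_zero, trans_self hp] at this
  exact hv this.symm

variable (p : X)

/-- The preferred chart at the centre. -/
abbrev base : OpenPartialHomeomorph X (ℂ × ℂ) := chartAt (ℂ × ℂ) p

theorem base_hol : IsHolChart X (base p) := IsManifold.chart_mem_maximalAtlas p

theorem mem_base : p ∈ (base p).source := mem_chart_source _ p

/-- The points of the blowing-up: the points different from the centre, and the directions at
the centre. -/
abbrev Points : Type := {x : X // x ≠ p} ⊕ Option ℂ

/-- The blowing-down map. -/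
def proj : Points p → X := Sum.elim (fun x => x.1) (fun _ => p)

variable {p}

/-- Points over the centre are stored as directions in the preferred chart. Normalizing a vector
there costs only a scalar factor, which slopes do not see. -/
theorem dir_trans_vec_dir {χ χ' : OpenPartialHomeomorph X (ℂ × ℂ)} (h : IsHolChart X χ)
    (h' : IsHolChart X χ') (hp : p ∈ χ.source) (hp' : p ∈ χ'.source) {v : ℂ × ℂ} (hv : v ≠ 0) :
    ∃ c : ℂ, c ≠ 0 ∧
      trans p (base p) χ' (vec (dir (trans p χ (base p) v))) = c • trans p χ χ' v := by
  obtain ⟨c, hc, hcv⟩ := exists_smul_vec_dir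
    (trans_ne_zero h (base_hol p) hp (mem_base p) hv)
  refine ⟨c⁻¹, inv_ne_zero hc, ?_⟩
  rw [← trans_trans h (base_hol p) h' hp (mem_base p) hp' v]
  conv_rhs => rw [hcv, map_smul, inv_smul_smul₀ hc]

theorem symm_add_blowDown_eq_iff {χ : OpenPartialHomeomorph X (ℂ × ℂ)} (hp : p ∈ χ.source)
    {w : ℂ × ℂ} (hw : χ p + blowDown w ∈ χ.target) :
    χ.symm (χ p + blowDown w) = p ↔ w.1 = 0 := by
  constructor
  · intro h
    have := congrArg χ h
    rw [χ.right_inv hw] at this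
    have h2 : blowDown w = 0 := by simpa using this
    exact congrArg Prod.fst h2
  · intro h
    have : blowDown w = 0 := by simp [blowDown, h]
    rw [this, add_zero, χ.left_inv hp]

theorem blowDown_div {z : ℂ × ℂ} (hz : z.1 ≠ 0) : blowDown (z.1, z.2 / z.1) = z :=
  Prod.ext rfl (mul_div_cancel₀ _ hz)

theorem blowDown_zero_fst (b : ℂ) : blowDown (0, b) = 0 := by simp [blowDown]

variable (p) in
/-- The point of the blowing-up with coordinates `(a, b)`, where `(u, v) = (a, a b)` is a chart
at the centre. -/
def slopeInv (χ : OpenPartialHomeomorph X (ℂ × ℂ)) (w : ℂ × ℂ) : Points p :=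
  open Classical in
  if h : χ.symm (χ p + blowDown w) = p then .inr (dir (trans p χ (base p) (1, w.2)))
  else .inl ⟨_, h⟩

theorem slopeInv_of_eq {χ : OpenPartialHomeomorph X (ℂ × ℂ)} {w : ℂ × ℂ}
    (h : χ.symm (χ p + blowDown w) = p) :
    slopeInv p χ w = .inr (dir (trans p χ (base p) (1, w.2))) := dif_pos h

theorem slopeInv_of_ne {χ : OpenPartialHomeomorph X (ℂ × ℂ)} {w : ℂ × ℂ}
    (h : χ.symm (χ p + blowDown w) ≠ p) : slopeInv p χ w = .inl ⟨_, h⟩ := dif_neg h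

theorem proj_slopeInv (χ : OpenPartialHomeomorph X (ℂ × ℂ)) (w : ℂ × ℂ) :
    proj p (slopeInv p χ w) = χ.symm (χ p + blowDown w) := by
  by_cases h : χ.symm (χ p + blowDown w) = p
  · rw [slopeInv_of_eq h, h]; rfl
  · rw [slopeInv_of_ne h]; rfl

/-- The coordinates `(a, b)` of the blowing-up, with `(u, v) = (a, a b)`, which come from a chart
`(u, v)` at the centre. -/
def slopeChart (χ : OpenPartialHomeomorph X (ℂ × ℂ)) (hχ : IsHolChart X χ) (hp : p ∈ χ.source) :
    PartialEquiv (Points p) (ℂ × ℂ) where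
  toFun := Sum.elim (fun x => ((χ x - χ p).1, (χ x - χ p).2 / (χ x - χ p).1))
    (fun o => (0, (trans p (base p) χ (vec o)).2 / (trans p (base p) χ (vec o)).1))
  invFun := slopeInv p χ
  source := {y | Sum.elim (fun x : {x : X // x ≠ p} => x.1 ∈ χ.source ∧ (χ x - χ p).1 ≠ 0)
    (fun o => (trans p (base p) χ (vec o)).1 ≠ 0) y}
  target := {w | χ p + blowDown w ∈ χ.target}
  map_source' := by
    rintro (x | o) hy
    · obtain ⟨hx, hne⟩ := hy
      change χ p + blowDown ((χ x - χ p).1, (χ x - χ p).2 / (χ x - χ p).1) ∈ χ.target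
      rw [blowDown_div hne, add_sub_cancel]
      exact χ.map_source hx
    · change χ p + blowDown (0, _) ∈ χ.target
      rw [blowDown_zero_fst, add_zero]
      exact χ.map_source hp
  map_target' := by
    intro w hw
    by_cases h : χ.symm (χ p + blowDown w) = p
    · rw [slopeInv_of_eq h]
      obtain ⟨c, hc, h2⟩ := dir_trans_vec_dir hχ hχ hp hp (v := (1, w.2)) (by simp)
      change (trans p (base p) χ (vec _)).1 ≠ 0
      simp [h2, trans_self hp, hc]
    · rw [slopeInv_of_ne h]
      refine ⟨χ.map_target hw, ?_⟩
      simp only [χ.right_inv hw, add_sub_cancel_left]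
      exact fun h0 => h ((symm_add_blowDown_eq_iff hp hw).2 h0)
  left_inv' := by
    rintro (x | o) hy
    · obtain ⟨hx, hne⟩ := hy
      have h1 : χ.symm (χ p + blowDown ((χ x - χ p).1, (χ x - χ p).2 / (χ x - χ p).1)) = x := by
        rw [blowDown_div hne, add_sub_cancel, χ.left_inv hx]
      change slopeInv p χ ((χ x - χ p).1, (χ x - χ p).2 / (χ x - χ p).1) = _
      rw [slopeInv_of_ne (by rw [h1]; exact x.2)]
      exact congrArg Sum.inl (Subtype.ext h1)
    · change (trans p (base p) χ (vec o)).1 ≠ 0 at hy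
      change slopeInv p χ (0, _) = _
      rw [slopeInv_of_eq (by rw [blowDown_zero_fst, add_zero, χ.left_inv hp])]
      have h1 : ((1 : ℂ), (trans p (base p) χ (vec o)).2 / (trans p (base p) χ (vec o)).1) =
          (trans p (base p) χ (vec o)).1⁻¹ • trans p (base p) χ (vec o) := by
        ext
        · simp [hy]
        · simp [div_eq_inv_mul]
      rw [h1, map_smul, dir_smul (inv_ne_zero hy),
        trans_trans (base_hol p) hχ (base_hol p) (mem_base p) hp (mem_base p),
        trans_self (mem_base p), dir_vec]
  right_inv' := by
    intro w hw
    by_cases h : χ.symm (χ p + blowDown w) = p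
    · have h0 := (symm_add_blowDown_eq_iff hp hw).1 h
      obtain ⟨c, hc, h2⟩ := dir_trans_vec_dir hχ hχ hp hp (v := (1, w.2)) (by simp)
      rw [slopeInv_of_eq h]
      simp only [Sum.elim_inr, h2, trans_self hp]
      ext <;> simp [h0, hc]
    · have h0 : w.1 ≠ 0 := fun h0 => h ((symm_add_blowDown_eq_iff hp hw).2 h0)
      rw [slopeInv_of_ne h]
      simp only [Sum.elim_inl, χ.right_inv hw, add_sub_cancel_left]
      ext <;> simp [blowDown, h0]

variable (p) in
/-- A point `x`, different from the centre, as a point of the blowing-up. -/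
def inclusion (x : X) : Points p :=
  open Classical in if h : x = p then .inr none else .inl ⟨x, h⟩

theorem inclusion_of_ne {x : X} (h : x ≠ p) : inclusion p x = .inl ⟨x, h⟩ := dif_neg h

theorem proj_inclusion {x : X} (h : x ≠ p) : proj p (inclusion p x) = x := by
  rw [inclusion_of_ne h]; rfl

theorem inclusion_proj {y : Points p} (h : proj p y ≠ p) : inclusion p (proj p y) = y := by
  rcases y with x | o
  · exact inclusion_of_ne x.2
  · exact (h rfl).elim

/-- The chart of the blowing-up over a chart that avoids the centre. -/
def liftChart (χ : OpenPartialHomeomorph X (ℂ × ℂ)) (hp : p ∉ χ.source) :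
    PartialEquiv (Points p) (ℂ × ℂ) where
  toFun y := χ (proj p y)
  invFun w := inclusion p (χ.symm w)
  source := proj p ⁻¹' χ.source
  target := χ.target
  map_source' y hy := χ.map_source hy
  map_target' w hw := by
    have h : χ.symm w ≠ p := fun h => hp (h ▸ χ.map_target hw)
    rw [mem_preimage, proj_inclusion h]
    exact χ.map_target hw
  left_inv' y hy := by
    have h : proj p y ≠ p := fun h => hp (h ▸ hy)
    rw [χ.left_inv hy, inclusion_proj h]
  right_inv' w hw := by
    have h : χ.symm w ≠ p := fun h => hp (h ▸ χ.map_target hw)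
    rw [proj_inclusion h, χ.right_inv hw]

variable (p) in
/-- The charts of a surface which contain, respectively avoid, the centre. -/
abbrev ChartIndex : Type :=
  {χ : OpenPartialHomeomorph X (ℂ × ℂ) // IsHolChart X χ ∧ p ∈ χ.source} ⊕
    {χ : OpenPartialHomeomorph X (ℂ × ℂ) // IsHolChart X χ ∧ p ∉ χ.source}

variable (p) in
/-- The charts of the blowing-up. -/
def charts : ChartIndex p → PartialEquiv (Points p) (ℂ × ℂ) :=
  Sum.elim (fun χ => slopeChart χ.1 χ.2.1 χ.2.2) (fun χ => liftChart χ.1 χ.2.2)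

section transitions

variable {χ χ' : OpenPartialHomeomorph X (ℂ × ℂ)}

/-- If (s₁, s₂) is the difference quotient of the change of charts, the new displacement is a (s₁,
s₂), with first coordinate a s₁ and slope s₂ / s₁. At a = 0 the quotient is the differential applied
to (1, b), so one formula serves the points over the centre and the others. -/
theorem slopeChart_slopeChart (hχ : IsHolChart X χ) (hχ' : IsHolChart X χ') (hp : p ∈ χ.source)
    (hp' : p ∈ χ'.source) : 
    ((slopeChart χ hχ hp).symm.trans (slopeChart χ' hχ' hp')).source =
      {w | w ∈ (fun w => χ p + blowDown w) ⁻¹' (χ.target ∩ χ.symm ⁻¹' χ'.source) ∧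
        (slopeAt (χ' ∘ χ.symm) (χ p) w).1 ≠ 0} ∧
    EqOn ((slopeChart χ hχ hp).symm.trans (slopeChart χ' hχ' hp'))
      (fun w => (w.1 * (slopeAt (χ' ∘ χ.symm) (χ p) w).1,
        (slopeAt (χ' ∘ χ.symm) (χ p) w).2 / (slopeAt (χ' ∘ χ.symm) (χ p) w).1))
      ((slopeChart χ hχ hp).symm.trans (slopeChart χ' hχ' hp')).source := by
  have key : ∀ w, χ p + blowDown w ∈ χ.target →
      ((slopeChart χ hχ hp).symm w ∈ (slopeChart χ' hχ' hp').source ↔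
        χ.symm (χ p + blowDown w) ∈ χ'.source ∧ (slopeAt (χ' ∘ χ.symm) (χ p) w).1 ≠ 0) ∧
      ((slopeChart χ hχ hp).symm w ∈ (slopeChart χ' hχ' hp').source →
        slopeChart χ' hχ' hp' ((slopeChart χ hχ hp).symm w) =
        (w.1 * (slopeAt (χ' ∘ χ.symm) (χ p) w).1,
        (slopeAt (χ' ∘ χ.symm) (χ p) w).2 / (slopeAt (χ' ∘ χ.symm) (χ p) w).1)) := by
    intro w hw
    by_cases h0 : w.1 = 0
    · have hsymm : (slopeChart χ hχ hp).symm w = .inr (dir (trans p χ (base p) (1, w.2))) :=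
        slopeInv_of_eq ((symm_add_blowDown_eq_iff hp hw).2 h0)
      have hs : slopeAt (χ' ∘ χ.symm) (χ p) w = trans p χ χ' (1, w.2) :=
        slopeAt_of_fst_eq_zero _ _ h0
      obtain ⟨c, hc, h2⟩ := dir_trans_vec_dir hχ hχ' hp hp' (v := (1, w.2)) (by simp)
      rw [hsymm, hs, (symm_add_blowDown_eq_iff hp hw).2 h0]
      constructor
      · change (trans p (base p) χ' (vec _)).1 ≠ 0 ↔ _
        rw [h2]
        simp [hc, hp']
      · intro _
        change (0, (trans p (base p) χ' (vec _)).2 / (trans p (base p) χ' (vec _)).1) = _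
        rw [h2, h0]
        simp [hc, mul_div_mul_left]
    · have h1 : χ.symm (χ p + blowDown w) ≠ p :=
        fun h => h0 ((symm_add_blowDown_eq_iff hp hw).1 h)
      have hsymm : (slopeChart χ hχ hp).symm w = .inl ⟨_, h1⟩ := slopeInv_of_ne h1
      have hs := smul_slopeAt (χ' ∘ χ.symm) (χ p) w
      simp only [Function.comp_apply, χ.left_inv hp] at hs
      rw [hsymm]
      constructor
      · change _ ∧ (χ' (χ.symm (χ p + blowDown w)) - χ' p).1 ≠ 0 ↔ _
        rw [← hs]
        simp [h0]
      · intro _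
        change ((χ' (χ.symm (χ p + blowDown w)) - χ' p).1,
          (χ' (χ.symm (χ p + blowDown w)) - χ' p).2 /
          (χ' (χ.symm (χ p + blowDown w)) - χ' p).1) = _
        rw [← hs]
        simp [h0, mul_div_mul_left]
  constructor
  · ext w
    rw [PartialEquiv.trans_source]
    constructor
    · rintro ⟨hw, hw'⟩
      obtain ⟨h1, h2⟩ := (key w hw).1.1 hw'
      exact ⟨⟨hw, h1⟩, h2⟩
    · rintro ⟨⟨hw, h1⟩, h2⟩
      exact ⟨hw, (key w hw).1.2 ⟨h1, h2⟩⟩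
  · rintro w ⟨hw, hw'⟩
    exact (key w hw).2 hw'

theorem slopeChart_liftChart (hχ : IsHolChart X χ) (hp : p ∈ χ.source) (hp' : p ∉ χ'.source) :
    ((slopeChart χ hχ hp).symm.trans (liftChart χ' hp')).source =
      (fun w => χ p + blowDown w) ⁻¹' (χ.target ∩ χ.symm ⁻¹' χ'.source) ∧
    EqOn ((slopeChart χ hχ hp).symm.trans (liftChart χ' hp'))
      ((χ' ∘ χ.symm) ∘ (fun w => χ p + blowDown w))
      ((slopeChart χ hχ hp).symm.trans (liftChart χ' hp')).source := by
  constructor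
  · ext w
    change χ p + blowDown w ∈ χ.target ∧ proj p (slopeInv p χ w) ∈ χ'.source ↔ _
    rw [proj_slopeInv]
    rfl
  · intro w hw
    change χ' (proj p (slopeInv p χ w)) = _
    rw [proj_slopeInv]
    rfl

theorem liftChart_slopeChart (hp : p ∉ χ.source) (hχ' : IsHolChart X χ') (hp' : p ∈ χ'.source) :
    ((liftChart χ hp).symm.trans (slopeChart χ' hχ' hp')).source =
      {w | w ∈ χ.target ∩ χ.symm ⁻¹' χ'.source ∧ ((χ' ∘ χ.symm) w - χ' p).1 ≠ 0} ∧
    EqOn ((liftChart χ hp).symm.trans (slopeChart χ' hχ' hp'))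
      (fun w => (((χ' ∘ χ.symm) w - χ' p).1,
        ((χ' ∘ χ.symm) w - χ' p).2 / ((χ' ∘ χ.symm) w - χ' p).1))
      ((liftChart χ hp).symm.trans (slopeChart χ' hχ' hp')).source := by
  have key : ∀ w ∈ χ.target, ∃ h, (liftChart χ hp).symm w = .inl ⟨χ.symm w, h⟩ := fun w hw =>
    have h : χ.symm w ≠ p := fun h => hp (h ▸ χ.map_target hw)
    ⟨h, inclusion_of_ne h⟩
  constructor
  · ext w
    rw [PartialEquiv.trans_source]
    constructor
    · rintro ⟨hw, hw'⟩
      obtain ⟨h, h1⟩ := key w hw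
      rw [mem_preimage, h1] at hw'
      exact ⟨⟨hw, hw'.1⟩, hw'.2⟩
    · rintro ⟨⟨hw, h1⟩, h2⟩
      obtain ⟨h, h3⟩ := key w hw
      refine ⟨hw, ?_⟩
      rw [mem_preimage, h3]
      exact ⟨h1, h2⟩
  · rintro w ⟨hw, -⟩
    obtain ⟨h, h3⟩ := key w hw
    change slopeChart χ' hχ' hp' ((liftChart χ hp).symm w) = _
    rw [h3]
    rfl

theorem liftChart_liftChart (hp : p ∉ χ.source) (hp' : p ∉ χ'.source) :
    ((liftChart χ hp).symm.trans (liftChart χ' hp')).source = χ.target ∩ χ.symm ⁻¹' χ'.source ∧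
    EqOn ((liftChart χ hp).symm.trans (liftChart χ' hp')) (χ' ∘ χ.symm)
      ((liftChart χ hp).symm.trans (liftChart χ' hp')).source := by
  have key : ∀ w ∈ χ.target, proj p ((liftChart χ hp).symm w) = χ.symm w := fun w hw =>
    proj_inclusion fun h => hp (h ▸ χ.map_target hw)
  constructor
  · ext w
    refine and_congr_right fun hw => ?_
    change proj p ((liftChart χ hp).symm w) ∈ χ'.source ↔ _
    rw [key w hw]
    rfl
  · rintro w ⟨hw, -⟩
    change χ' (proj p ((liftChart χ hp).symm w)) = _
    rw [key w hw]
    rfl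

/-- Each chart of the blowing-up comes either from a chart through the centre or from one that
avoids it. Among the four combinations only slope against slope is delicate, and it is settled by
`contDiffAt_slopeAt`. -/
theorem isOpen_and_contDiffOn (i j : ChartIndex p) :
    IsOpen ((charts p i).symm.trans (charts p j)).source ∧
      ContDiffOn ℂ ω ((charts p i).symm.trans (charts p j))
        ((charts p i).symm.trans (charts p j)).source := by
  have hcont : Continuous fun w : ℂ × ℂ => blowDown w := contDiff_blowDown.continuous
  have hadd : ∀ χ : OpenPartialHomeomorph X (ℂ × ℂ),
      ContDiff ℂ ω fun w : ℂ × ℂ => χ p + blowDown w := fun χ =>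
    contDiff_const.add contDiff_blowDown
  rcases i with ⟨χ, hχ, hp⟩ | ⟨χ, hχ, hp⟩ <;> rcases j with ⟨χ', hχ', hp'⟩ | ⟨χ', hχ', hp'⟩ <;>
    have hG := hχ.contDiffOn_transition hχ' <;>
    have hO : IsOpen (χ.target ∩ χ.symm ⁻¹' χ'.source) :=
      χ.isOpen_inter_preimage_symm χ'.open_source
  · obtain ⟨h1, h2⟩ := slopeChart_slopeChart hχ hχ' hp hp'
    have hO' := hO.preimage (hadd χ).continuous
    have hs : ContDiffOn ℂ ω (slopeAt (χ' ∘ χ.symm) (χ p))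
        ((fun w => χ p + blowDown w) ⁻¹' (χ.target ∩ χ.symm ⁻¹' χ'.source)) := fun w hw =>
      (contDiffAt_slopeAt (hG.contDiffAt (hO.mem_nhds hw))).contDiffWithinAt
    constructor
    · change IsOpen ((slopeChart χ hχ hp).symm.trans (slopeChart χ' hχ' hp')).source
      rw [h1]
      exact (hs.fst.continuousOn).isOpen_inter_preimage hO' isOpen_compl_singleton
    · change ContDiffOn ℂ ω _ ((slopeChart χ hχ hp).symm.trans (slopeChart χ' hχ' hp')).source
      refine ContDiffOn.congr ?_ h2
      rw [h1]
      have hs' := hs.mono (t := {w | w ∈ (fun w => χ p + blowDown w) ⁻¹'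
        (χ.target ∩ χ.symm ⁻¹' χ'.source) ∧ (slopeAt (χ' ∘ χ.symm) (χ p) w).1 ≠ 0}) fun w hw => hw.1
      exact (contDiffOn_fst.mul hs'.fst).prodMk (hs'.snd.div hs'.fst fun w hw => hw.2)
  · obtain ⟨h1, h2⟩ := slopeChart_liftChart hχ hp hp'
    constructor
    · change IsOpen ((slopeChart χ hχ hp).symm.trans (liftChart χ' hp')).source
      rw [h1]
      exact hO.preimage (hadd χ).continuous
    · change ContDiffOn ℂ ω _ ((slopeChart χ hχ hp).symm.trans (liftChart χ' hp')).source
      refine ContDiffOn.congr ?_ h2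
      rw [h1]
      exact hG.comp (hadd χ).contDiffOn fun w hw => hw
  · obtain ⟨h1, h2⟩ := liftChart_slopeChart hp hχ' hp'
    have hs : ContDiffOn ℂ ω (fun w => (χ' ∘ χ.symm) w - χ' p)
        (χ.target ∩ χ.symm ⁻¹' χ'.source) := hG.sub contDiffOn_const
    constructor
    · change IsOpen ((liftChart χ hp).symm.trans (slopeChart χ' hχ' hp')).source
      rw [h1]
      exact (hs.fst.continuousOn).isOpen_inter_preimage hO isOpen_compl_singleton
    · change ContDiffOn ℂ ω _ ((liftChart χ hp).symm.trans (slopeChart χ' hχ' hp')).source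
      refine ContDiffOn.congr ?_ h2
      rw [h1]
      have hs' := hs.mono (t := {w | w ∈ χ.target ∩ χ.symm ⁻¹' χ'.source ∧
        ((χ' ∘ χ.symm) w - χ' p).1 ≠ 0}) fun w hw => hw.1
      exact hs'.fst.prodMk (hs'.snd.div hs'.fst fun w hw => hw.2)
  · obtain ⟨h1, h2⟩ := liftChart_liftChart hp hp'
    constructor
    · change IsOpen ((liftChart χ hp).symm.trans (liftChart χ' hp')).source
      rw [h1]
      exact hO
    · change ContDiffOn ℂ ω _ ((liftChart χ hp).symm.trans (liftChart χ' hp')).source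
      refine ContDiffOn.congr ?_ h2
      rw [h1]
      exact hG

end transitions

end BlowUp

/-! ### Changes of charts by homeomorphisms of the model plane -/

theorem IsHolChart.transHomeomorph {E : Type} [NormedAddCommGroup E] [NormedSpace ℂ E]
    {X : ComplexManifold E} {φ : OpenPartialHomeomorph X E} (hφ : IsHolChart X φ)
    {h : E ≃ₜ E} (h₁ : ContDiff ℂ ω h) (h₂ : ContDiff ℂ ω h.symm) :
    IsHolChart X (φ.transHomeomorph h) := by
  rw [OpenPartialHomeomorph.transHomeomorph_eq_trans]
  exact hφ.trans h₁.contDiffOn h₂.contDiffOn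

/-- The chart `(v, u)` for a chart `(u, v)`. -/
def swapChart {X : Surface} (χ : OpenPartialHomeomorph X (ℂ × ℂ)) :
    OpenPartialHomeomorph X (ℂ × ℂ) :=
  χ.transHomeomorph (Homeomorph.prodComm ℂ ℂ)

theorem IsHolChart.swap {X : Surface} {χ : OpenPartialHomeomorph X (ℂ × ℂ)}
    (hχ : IsHolChart X χ) : IsHolChart X (swapChart χ) :=
  hχ.transHomeomorph (contDiff_snd.prodMk contDiff_fst) (contDiff_snd.prodMk contDiff_fst)

/-- The linear change of coordinates `(u, v) ↦ (c u + v, u)`. -/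
def shearSwap (c : ℂ) : (ℂ × ℂ) ≃L[ℂ] (ℂ × ℂ) :=
  ContinuousLinearEquiv.equivOfInverse
    ((c • ContinuousLinearMap.fst ℂ ℂ ℂ + ContinuousLinearMap.snd ℂ ℂ ℂ).prod
      (ContinuousLinearMap.fst ℂ ℂ ℂ))
    ((ContinuousLinearMap.snd ℂ ℂ ℂ).prod
      (ContinuousLinearMap.fst ℂ ℂ ℂ - c • ContinuousLinearMap.snd ℂ ℂ ℂ))
    (fun x => by ext <;> simp) (fun x => by ext <;> simp)

theorem shearSwap_apply (c : ℂ) (v : ℂ × ℂ) : shearSwap c v = (c * v.1 + v.2, v.1) := rfl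

/-! ### The blowing-up as a Hausdorff complex surface -/

namespace BlowUp

variable {X : Surface} {p : X}

theorem trans_linear {χ : OpenPartialHomeomorph X (ℂ × ℂ)} (hp : p ∈ χ.source)
    (L : (ℂ × ℂ) ≃L[ℂ] (ℂ × ℂ)) (v : ℂ × ℂ) :
    trans p χ (χ.transHomeomorph L.toHomeomorph) v = L v := by
  have hev : (χ.transHomeomorph L.toHomeomorph) ∘ χ.symm =ᶠ[𝓝 (χ p)] L := by
    filter_upwards [χ.open_target.mem_nhds (χ.map_source hp)] with w hw
    simp [χ.right_inv hw]
  rw [trans, hev.fderiv_eq, L.fderiv]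
  rfl

/-- The slope chart of a sheared chart misses a single direction. A direction of finite slope b
excludes only c = -b and the vertical direction excludes nothing, so some shear is good for two
given directions at once. This separates the points over the centre. -/
theorem exists_slopeChart (o o' : Option ℂ) :
    ∃ (χ : OpenPartialHomeomorph X (ℂ × ℂ)) (hχ : IsHolChart X χ) (hp : p ∈ χ.source),
      Sum.inr o ∈ (slopeChart χ hχ hp).source ∧ Sum.inr o' ∈ (slopeChart χ hχ hp).source := by
  obtain ⟨c, hc⟩ : ∃ c : ℂ, (c * (vec o).1 + (vec o).2) * (c * (vec o').1 + (vec o').2) ≠ 0 := by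
    have hf := ((Set.finite_singleton (-(vec o).2)).insert (-(vec o').2)).exists_notMem
    obtain ⟨c, hc⟩ := hf
    simp only [mem_insert_iff, mem_singleton_iff, not_or] at hc
    refine ⟨c, ?_⟩
    rcases o with _ | b <;> rcases o' with _ | b' <;>
      simp_all [vec, add_eq_zero_iff_eq_neg]
  have hχ : IsHolChart X ((base p).transHomeomorph (shearSwap c).toHomeomorph) :=
    (base_hol p).transHomeomorph (shearSwap c).contDiff (shearSwap c).symm.contDiff
  refine ⟨_, hχ, mem_base p, ?_, ?_⟩
  · change (trans p (base p) _ (vec o)).1 ≠ 0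
    rw [trans_linear (mem_base p), shearSwap_apply]
    exact left_ne_zero_of_mul hc
  · change (trans p (base p) _ (vec o')).1 ≠ 0
    rw [trans_linear (mem_base p), shearSwap_apply]
    exact right_ne_zero_of_mul hc

theorem exists_chart_avoiding {x : X} (h : x ≠ p) :
    ∃ χ : OpenPartialHomeomorph X (ℂ × ℂ), IsHolChart X χ ∧ p ∉ χ.source ∧ x ∈ χ.source := by
  refine ⟨(base x).restr {p}ᶜ, (base_hol x).restr isOpen_compl_singleton, ?_, ?_⟩
  · rw [OpenPartialHomeomorph.restr_source' _ _ isOpen_compl_singleton]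
    simp
  · rw [OpenPartialHomeomorph.restr_source' _ _ isOpen_compl_singleton]
    exact ⟨mem_base x, h⟩

variable (p) in
/-- The holomorphic atlas of the blowing-up. -/
def atlas : HolAtlas (Points p) (ℂ × ℂ) where
  ι := ChartIndex p
  e := charts p
  cover := by
    rintro (⟨x, h⟩ | o)
    · obtain ⟨χ, hχ, hp, hx⟩ := exists_chart_avoiding h
      exact ⟨.inr ⟨χ, hχ, hp⟩, hx⟩
    · obtain ⟨χ, hχ, hp, h, -⟩ := exists_slopeChart o o
      exact ⟨.inl ⟨χ, hχ, hp⟩, h⟩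
  isOpen i j := (isOpen_and_contDiffOn i j).1
  contDiffOn i j := (isOpen_and_contDiffOn i j).2

/-- Points with different images are separated downstairs. Two points over the centre lie in a
common slope chart by `exists_slopeChart`. -/
theorem t2 : @T2Space (Points p) (atlas p).top := by
  refine (atlas p).t2Space_of_map (proj p) ?_ ?_
  · rintro (⟨χ, hχ, hp⟩ | ⟨χ, hχ, hp⟩)
    · have h : ContinuousOn (χ.symm ∘ fun w => χ p + blowDown w)
          {w | χ p + blowDown w ∈ χ.target} :=
        χ.continuousOn_symm.comp
          (continuous_const.add contDiff_blowDown.continuous).continuousOn fun w hw => hw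
      exact h.congr fun w _ => proj_slopeInv χ w
    · exact χ.continuousOn_symm.congr fun w hw =>
        proj_inclusion fun h => hp (h ▸ χ.map_target hw)
  · rintro (⟨x, h⟩ | o) (⟨x', h'⟩ | o') hxx
    · obtain rfl : x = x' := hxx
      obtain ⟨i, hi⟩ := (atlas p).cover (.inl ⟨x, h⟩)
      exact ⟨i, hi, hi⟩
    · exact (h hxx).elim
    · exact (h' hxx.symm).elim
    · obtain ⟨χ, hχ, hp, h, h'⟩ := exists_slopeChart (p := p) o o'
      exact ⟨.inl ⟨χ, hχ, hp⟩, h, h'⟩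

end BlowUp

/-- The blowing-up of a complex surface at a point. -/
def blowUp (X : Surface) (p : X) : Surface := (BlowUp.atlas p).toManifold BlowUp.t2

/-! ### Charts, local model and compactness of the blowing-up -/

namespace BlowUp

section API

variable {X : Surface} {p : X}

variable (p) in
/-- The blowing-down map. -/
def down : blowUp X p → X := proj p

variable (p) in
/-- The inverse of the blowing-down map off the centre. -/
def up : X → blowUp X p := inclusion p

theorem down_up {x : X} (h : x ≠ p) : down p (up p x) = x := proj_inclusion h

theorem up_down {y : blowUp X p} (h : down p y ≠ p) : up p (down p y) = y := inclusion_proj h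

/-- The chart of the blowing-up over a chart that avoids the centre. -/
def lift (χ : OpenPartialHomeomorph X (ℂ × ℂ)) (hχ : IsHolChart X χ) (hp : p ∉ χ.source) :
    OpenPartialHomeomorph (blowUp X p) (ℂ × ℂ) :=
  (atlas p).chart t2 (.inr ⟨χ, hχ, hp⟩)

/-- The chart `(u, v / u)` of the blowing-up for a chart `(u, v)` centred at the centre. -/
def slope (χ : OpenPartialHomeomorph X (ℂ × ℂ)) (hχ : IsHolChart X χ) (hp : p ∈ χ.source) :
    OpenPartialHomeomorph (blowUp X p) (ℂ × ℂ) :=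
  (atlas p).chart t2 (.inl ⟨χ, hχ, hp⟩)

variable {χ : OpenPartialHomeomorph X (ℂ × ℂ)}

theorem isHolChart_lift (hχ : IsHolChart X χ) (hp : p ∉ χ.source) :
    IsHolChart (blowUp X p) (lift χ hχ hp) := (atlas p).isHolChart t2 _

theorem isHolChart_slope (hχ : IsHolChart X χ) (hp : p ∈ χ.source) :
    IsHolChart (blowUp X p) (slope χ hχ hp) := (atlas p).isHolChart t2 _

theorem slope_target (hχ : IsHolChart X χ) (hp : p ∈ χ.source) :
    (slope χ hχ hp).target = {w | χ p + blowDown w ∈ χ.target} := rfl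

theorem down_slope_symm (hχ : IsHolChart X χ) (hp : p ∈ χ.source) (w : ℂ × ℂ) :
    down p ((slope χ hχ hp).symm w) = χ.symm (χ p + blowDown w) := proj_slopeInv χ w

theorem down_mem_source (hχ : IsHolChart X χ) (hp : p ∈ χ.source) {y : blowUp X p}
    (hy : y ∈ (slope χ hχ hp).source) : down p y ∈ χ.source := by
  have h := (slope χ hχ hp).map_source hy
  rw [← (slope χ hχ hp).left_inv hy, down_slope_symm]
  exact χ.map_target h

theorem apply_down (hχ : IsHolChart X χ) (hp : p ∈ χ.source) {y : blowUp X p}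
    (hy : y ∈ (slope χ hχ hp).source) :
    χ (down p y) = χ p + blowDown (slope χ hχ hp y) := by
  have h := (slope χ hχ hp).map_source hy
  conv_lhs => rw [← (slope χ hχ hp).left_inv hy, down_slope_symm]
  exact χ.right_inv h

theorem down_eq_iff (hχ : IsHolChart X χ) (hp : p ∈ χ.source) {y : blowUp X p}
    (hy : y ∈ (slope χ hχ hp).source) : down p y = p ↔ (slope χ hχ hp y).1 = 0 := by
  have h := (slope χ hχ hp).map_source hy
  conv_lhs => rw [← (slope χ hχ hp).left_inv hy, down_slope_symm]
  exact symm_add_blowDown_eq_iff hp h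

theorem mem_slope_source_iff (hχ : IsHolChart X χ) (hp : p ∈ χ.source) {y : blowUp X p}
    (hy : down p y ≠ p) :
    y ∈ (slope χ hχ hp).source ↔ down p y ∈ χ.source ∧ (χ (down p y)).1 ≠ (χ p).1 := by
  rcases y with x | o
  · change x.1 ∈ χ.source ∧ (χ x.1 - χ p).1 ≠ 0 ↔ _
    rw [Prod.fst_sub, sub_ne_zero]
    rfl
  · exact (hy rfl).elim

theorem mem_swap {x : X} (hx : x ∈ χ.source) : x ∈ (swapChart χ).source := hx

theorem trans_swap (hχ : IsHolChart X χ) (hp : p ∈ χ.source) (v : ℂ × ℂ) :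
    trans p (base p) (swapChart χ) v = (trans p (base p) χ v).swap := by
  rw [← trans_trans (base_hol p) hχ hχ.swap (mem_base p) hp hp]
  have := trans_linear (p := p) hp (ContinuousLinearEquiv.prodComm ℂ ℂ ℂ)
    (trans p (base p) χ v)
  exact this

/-- Neither a non-zero tangent vector at the centre nor the displacement of another point can have
both coordinates zero, so one of the slopes v / u and u / v is defined. -/
theorem mem_slope_or (hχ : IsHolChart X χ) (hp : p ∈ χ.source) {y : blowUp X p}
    (hy : down p y ∈ χ.source) :
    y ∈ (slope χ hχ hp).source ∨ y ∈ (slope (swapChart χ) hχ.swap (mem_swap hp)).source := by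
  by_cases h : down p y = p
  · rcases y with x | o
    · exact (x.2 h).elim
    · have hv := trans_ne_zero (base_hol p) hχ (mem_base p) hp (vec_ne_zero o)
      by_contra! hcon
      obtain ⟨h1, h2⟩ := hcon
      change ¬ (trans p (base p) χ (vec o)).1 ≠ 0 at h1
      change ¬ (trans p (base p) (swapChart χ) (vec o)).1 ≠ 0 at h2
      rw [trans_swap hχ hp] at h2
      simp only [ne_eq, not_not] at h1 h2
      exact hv (Prod.ext h1 h2)
  · rw [mem_slope_source_iff hχ hp h, mem_slope_source_iff hχ.swap (mem_swap hp) h]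
    by_contra! hcon
    have h1 := hcon.1 hy
    have h2 := hcon.2 hy
    exact h (χ.injOn hy hp (Prod.ext h1 h2))

theorem mem_slope_swap_iff (hχ : IsHolChart X χ) (hp : p ∈ χ.source) {y : blowUp X p}
    (hy : y ∈ (slope χ hχ hp).source) :
    y ∈ (slope (swapChart χ) hχ.swap (mem_swap hp)).source ↔ (slope χ hχ hp y).2 ≠ 0 := by
  by_cases h : down p y = p
  · rcases y with x | o
    · exact (x.2 h).elim
    · change (trans p (base p) (swapChart χ) (vec o)).1 ≠ 0 ↔
        (trans p (base p) χ (vec o)).2 / (trans p (base p) χ (vec o)).1 ≠ 0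
      change (trans p (base p) χ (vec o)).1 ≠ 0 at hy
      rw [trans_swap hχ hp]
      simp [hy]
  · have h1 := apply_down hχ hp hy
    have h2 := (mem_slope_source_iff hχ hp h).1 hy
    have h3 : (slope χ hχ hp y).1 ≠ 0 := fun h3 => h ((down_eq_iff hχ hp hy).2 h3)
    rw [mem_slope_source_iff hχ.swap (mem_swap hp) h]
    change down p y ∈ χ.source ∧ (χ (down p y)).2 ≠ (χ p).2 ↔ _
    rw [h1]
    simp [blowDown, h3, h2.1]

theorem slope_swap_apply (hχ : IsHolChart X χ) (hp : p ∈ χ.source) {y : blowUp X p}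
    (hy : y ∈ (slope χ hχ hp).source) (hy' : y ∈ (slope (swapChart χ) hχ.swap (mem_swap hp)).source) :
    slope (swapChart χ) hχ.swap (mem_swap hp) y =
      ((slope χ hχ hp y).1 * (slope χ hχ hp y).2, (slope χ hχ hp y).2⁻¹) := by
  have h0 := (mem_slope_swap_iff hχ hp hy).1 hy'
  have h1 := apply_down hχ hp hy
  have h2 := apply_down hχ.swap (mem_swap hp) hy'
  have h3 : swapChart χ (down p y) = (χ (down p y)).swap := rfl
  have h4 : swapChart χ p = (χ p).swap := rfl
  by_cases h : down p y = p
  · rcases y with x | o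
    · exact (x.2 h).elim
    · change (0, (trans p (base p) (swapChart χ) (vec o)).2 /
        (trans p (base p) (swapChart χ) (vec o)).1) =
        (0 * _, ((trans p (base p) χ (vec o)).2 / (trans p (base p) χ (vec o)).1)⁻¹)
      rw [trans_swap hχ hp]
      simp
  · have h5 : (slope χ hχ hp y).1 ≠ 0 := fun h3 => h ((down_eq_iff hχ hp hy).2 h3)
    rw [h3, h4, h1] at h2
    simp only [blowDown, Prod.swap, Prod.ext_iff, Prod.fst_add, Prod.snd_add,
      add_right_inj] at h2
    ext
    · exact h2.1.symm
    · have := h2.2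
      rw [← h2.1] at this
      have h6 : (slope χ hχ hp y).1 * ((slope χ hχ hp y).2 *
          (slope (swapChart χ) hχ.swap (mem_swap hp) y).2) = (slope χ hχ hp y).1 * 1 := by
        rw [mul_one, ← mul_assoc]; exact this.symm
      exact eq_inv_of_mul_eq_one_right (mul_left_cancel₀ h5 h6)

theorem contMDiff_down : ContMDiff 𝓘(ℂ, ℂ × ℂ) 𝓘(ℂ, ℂ × ℂ) ω (down p) := by
  intro y
  by_cases h : down p y = p
  · obtain ⟨χ, hχ, hp, hy⟩ : ∃ (χ : OpenPartialHomeomorph X (ℂ × ℂ)) (hχ : IsHolChart X χ)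
        (hp : p ∈ χ.source), y ∈ (slope χ hχ hp).source := by
      rcases mem_slope_or (y := y) (base_hol p) (mem_base p) (by rw [h]; exact mem_base p) with h | h
      · exact ⟨_, _, _, h⟩
      · exact ⟨_, _, _, h⟩
    have h1 : ContMDiffOn 𝓘(ℂ, ℂ × ℂ) 𝓘(ℂ, ℂ × ℂ) ω
        (χ.symm ∘ (fun w => χ p + blowDown w) ∘ slope χ hχ hp) (slope χ hχ hp).source := by
      refine (isHolChart_iff.1 hχ).2.comp (ContMDiffOn.comp (t := univ) ?_
        (isHolChart_iff.1 (isHolChart_slope hχ hp)).1 (subset_univ _)) ?_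
      · exact (contDiff_const.add contDiff_blowDown).contMDiff.contMDiffOn
      · exact fun y hy => (slope χ hχ hp).map_source hy
    refine (h1.congr fun y hy => ?_).contMDiffAt ((slope χ hχ hp).open_source.mem_nhds hy)
    simp only [Function.comp]
    rw [← apply_down hχ hp hy, χ.left_inv (down_mem_source hχ hp hy)]
  · obtain ⟨χ, hχ, hp, hy⟩ := exists_chart_avoiding h
    have h1 : ContMDiffOn 𝓘(ℂ, ℂ × ℂ) 𝓘(ℂ, ℂ × ℂ) ω
        (χ.symm ∘ lift χ hχ hp) (lift χ hχ hp).source :=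
      (isHolChart_iff.1 hχ).2.comp (isHolChart_iff.1 (isHolChart_lift hχ hp)).1
        fun y hy => (lift χ hχ hp).map_source hy
    refine (h1.congr fun y hy => ?_).contMDiffAt ((lift χ hχ hp).open_source.mem_nhds hy)
    exact (χ.left_inv hy).symm

theorem contMDiffOn_up : ContMDiffOn 𝓘(ℂ, ℂ × ℂ) 𝓘(ℂ, ℂ × ℂ) ω (up p) {p}ᶜ := by
  intro x hx
  obtain ⟨χ, hχ, hp, hy⟩ := exists_chart_avoiding hx
  have h1 : ContMDiffOn 𝓘(ℂ, ℂ × ℂ) 𝓘(ℂ, ℂ × ℂ) ω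
      ((lift χ hχ hp).symm ∘ χ) χ.source :=
    (isHolChart_iff.1 (isHolChart_lift hχ hp)).2.comp (isHolChart_iff.1 hχ).1
      fun y hy => χ.map_source hy
  refine ((h1.congr fun y hy => ?_).contMDiffAt (χ.open_source.mem_nhds hy)).contMDiffWithinAt
  change up p y = up p (χ.symm (χ y))
  rw [χ.left_inv hy]

/-- A chart centred at the given point. -/
def centred (χ : OpenPartialHomeomorph X (ℂ × ℂ)) (z : ℂ × ℂ) :
    OpenPartialHomeomorph X (ℂ × ℂ) :=
  χ.transHomeomorph (Homeomorph.subRight z)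

theorem isHolChart_centred (hχ : IsHolChart X χ) (z : ℂ × ℂ) : IsHolChart X (centred χ z) :=
  hχ.transHomeomorph (contDiff_id.sub contDiff_const) (contDiff_id.add contDiff_const)

/-- The local model is the preferred chart translated so that the centre becomes the origin. Its
second coordinate system is the slope chart of the swapped chart, swapped once more so that it reads
(c, d) = (u / v, v). -/
theorem isBlowUp : IsBlowUp (down p) p where
  holomorphic := contMDiff_down
  iso_off := ⟨up p, contMDiffOn_up, fun _ h => down_up h, fun _ h => up_down h⟩
  local_form := by
    set χ := centred (base p) (base p p) with hχdef
    have hχ : IsHolChart X χ := isHolChart_centred (base_hol p) _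
    have hp : p ∈ χ.source := mem_base p
    have h0 : χ p = 0 := sub_self (base p p)
    have h0' : swapChart χ p = 0 := by
      change (χ p).swap = 0
      rw [h0]; rfl
    refine ⟨χ, slope χ hχ hp, swapChart (slope (swapChart χ) hχ.swap (mem_swap hp)), hχ,
      isHolChart_slope hχ hp, (isHolChart_slope hχ.swap (mem_swap hp)).swap, hp, h0, ?_, ?_, ?_, ?_, ?_, ?_, ?_⟩
    · ext y
      constructor
      · rintro (hy | hy)
        · exact down_mem_source hχ hp hy
        · exact down_mem_source hχ.swap (mem_swap hp) hy
      · exact fun hy => mem_slope_or hχ hp hy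
    · rw [slope_target, h0]
      simp [blowDown]
    · change Homeomorph.prodComm ℂ ℂ ⁻¹' {w | swapChart χ p + blowDown w ∈
        Homeomorph.prodComm ℂ ℂ ⁻¹' χ.target} = _
      rw [h0']
      ext w
      simp [blowDown, mul_comm]
    · intro y hy
      rw [apply_down hχ hp hy, h0, zero_add]
      rfl
    · intro y hy
      have h1 := apply_down hχ.swap (mem_swap hp) hy
      have h2 : swapChart χ (down p y) = (χ (down p y)).swap := rfl
      rw [h0', zero_add, h2] at h1
      have h3 := congrArg Prod.swap h1
      rw [Prod.swap_swap] at h3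
      rw [h3, mul_comm]
      rfl
    · exact fun y hy => mem_slope_swap_iff hχ hp hy
    · rintro y ⟨hy, hy'⟩
      change (slope (swapChart χ) hχ.swap (mem_swap hp) y).swap = _
      rw [slope_swap_apply hχ hp hy hy']
      rfl

theorem isCompact_slope_symm_image (hχ : IsHolChart X χ) (hp : p ∈ χ.source) {ε : ℝ}
    (hε : Metric.closedBall (χ p) ε ⊆ χ.target) :
    IsCompact ((slope χ hχ hp).symm '' Metric.closedBall 0 ε ×ˢ Metric.closedBall 0 1) := by
  refine ((isCompact_closedBall _ _).prod (isCompact_closedBall _ _)).image_of_continuousOn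
    ((slope χ hχ hp).continuousOn_symm.mono ?_)
  rintro w ⟨h1, h2⟩
  rw [mem_closedBall_zero_iff] at h1 h2
  refine hε ?_
  rw [mem_closedBall_iff_norm, add_sub_cancel_left, Prod.norm_def]
  refine max_le h1 ?_
  change ‖w.1 * w.2‖ ≤ ε
  rw [norm_mul]
  exact (mul_le_of_le_one_right (norm_nonneg _) h2).trans h1

/-- Of the two mutually inverse slopes one has modulus at most 1. Hence two compact bidiscs suffice
over a closed ball around the centre. -/
theorem mem_slope_symm_image_or (hχ : IsHolChart X χ) (hp : p ∈ χ.source) {ε : ℝ}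
    {y : blowUp X p} (hy : y ∈ (slope χ hχ hp).source)
    (hyε : χ (down p y) ∈ Metric.closedBall (χ p) ε) :
    y ∈ (slope χ hχ hp).symm '' Metric.closedBall 0 ε ×ˢ Metric.closedBall 0 1 ∨
    y ∈ (slope (swapChart χ) hχ.swap (mem_swap hp)).symm ''
      Metric.closedBall 0 ε ×ˢ Metric.closedBall 0 1 := by
  rw [apply_down hχ hp hy, mem_closedBall_iff_norm, add_sub_cancel_left, Prod.norm_def] at hyε
  have h1 := (le_max_left _ _).trans hyε
  have h2 := (le_max_right _ _).trans hyε
  simp only [blowDown] at h1 h2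
  by_cases hb : ‖(slope χ hχ hp y).2‖ ≤ 1
  · refine .inl ⟨_, ⟨?_, ?_⟩, (slope χ hχ hp).left_inv hy⟩
    · rwa [mem_closedBall_zero_iff]
    · rwa [mem_closedBall_zero_iff]
  · have h0 : (slope χ hχ hp y).2 ≠ 0 := by
      intro h0
      rw [h0] at hb
      simp at hb
    have hy' := (mem_slope_swap_iff hχ hp hy).2 h0
    refine .inr ⟨_, ⟨?_, ?_⟩, (slope (swapChart χ) hχ.swap (mem_swap hp)).left_inv hy'⟩
    · rwa [slope_swap_apply hχ hp hy hy', mem_closedBall_zero_iff]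
    · rw [slope_swap_apply hχ hp hy hy', mem_closedBall_zero_iff, norm_inv]
      exact inv_le_one_of_one_le₀ (not_le.1 hb).le

theorem closedBall_swap_subset {ε : ℝ} (hε : Metric.closedBall (χ p) ε ⊆ χ.target) :
    Metric.closedBall (swapChart χ p) ε ⊆ (swapChart χ).target := by
  intro w hw
  refine hε (a := w.swap) ?_
  rw [mem_closedBall_iff_norm] at hw ⊢
  rw [Prod.norm_def] at hw ⊢
  rw [max_comm]
  exact hw

/-- The complement of a small open ball lifts to a compact set, and what lies over the ball is
contained in finitely many images of closed bidiscs. -/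
instance compactSpace [CompactSpace X] : CompactSpace (blowUp X p) := by
  set χ := base p
  have hχ : IsHolChart X χ := base_hol p
  have hp : p ∈ χ.source := mem_base p
  obtain ⟨ε, hε0, hε⟩ := Metric.nhds_basis_closedBall.mem_iff.1
    (χ.open_target.mem_nhds (χ.map_source hp))
  have hopen : IsOpen (χ.source ∩ χ ⁻¹' Metric.ball (χ p) ε) :=
    χ.isOpen_inter_preimage Metric.isOpen_ball
  have hK : IsCompact (up p '' (χ.source ∩ χ ⁻¹' Metric.ball (χ p) ε)ᶜ) := by
    refine hopen.isClosed_compl.isCompact.image_of_continuousOn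
      (contMDiffOn_up.continuousOn.mono ?_)
    intro x hx hxp
    rw [mem_singleton_iff] at hxp
    subst hxp
    exact hx ⟨hp, Metric.mem_ball_self hε0⟩
  have hε' := closedBall_swap_subset hε
  -- The twice swapped chart enters because `mem_slope_symm_image_or`, applied to the swapped chart,
  -- refers to its swap.
  have hε'' := closedBall_swap_subset hε'
  have hall := ((hK.union (isCompact_slope_symm_image hχ hp hε)).union
    (isCompact_slope_symm_image hχ.swap (mem_swap hp) hε')).union
    (isCompact_slope_symm_image hχ.swap.swap (mem_swap (mem_swap hp)) hε'')
  refine ⟨hall.of_isClosed_subset isClosed_univ fun y _ => ?_⟩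
  by_cases hy : down p y ∈ χ.source ∩ χ ⁻¹' Metric.ball (χ p) ε
  · rcases mem_slope_or hχ hp hy.1 with h | h
    · rcases mem_slope_symm_image_or hχ hp h (Metric.ball_subset_closedBall hy.2) with h | h
      · exact .inl (.inl (.inr h))
      · exact .inl (.inr h)
    · have h2 : swapChart χ (down p y) ∈ Metric.closedBall (swapChart χ p) ε := by
        have := Metric.ball_subset_closedBall hy.2
        rw [mem_closedBall_iff_norm] at this ⊢
        rw [Prod.norm_def] at this ⊢
        rw [max_comm]
        exact this
      rcases mem_slope_symm_image_or hχ.swap (mem_swap hp) h h2 with h | h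
      · exact .inl (.inr h)
      · exact .inr h
  · have hne : down p y ≠ p := by
      intro h
      rw [h] at hy
      exact hy ⟨hp, Metric.mem_ball_self hε0⟩
    exact .inl (.inl (.inl ⟨_, hy, up_down hne⟩))

end API

end BlowUp

namespace BlowUp

variable {X : Surface} {p : X}

/-! ### Charts over the complement of the centre -/

theorem notMem_restr (χ : OpenPartialHomeomorph X (ℂ × ℂ)) : p ∉ (χ.restr {p}ᶜ).source := by
  rw [OpenPartialHomeomorph.restr_source' _ _ isOpen_compl_singleton]
  simp

/-- The chart of the blowing-up over the complement of the centre in a chart. -/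
def offLift (p : X) (χ : OpenPartialHomeomorph X (ℂ × ℂ)) (hχ : IsHolChart X χ) :
    OpenPartialHomeomorph (blowUp X p) (ℂ × ℂ) :=
  lift (χ.restr {p}ᶜ) (hχ.restr isOpen_compl_singleton) (notMem_restr χ)

variable {χ : OpenPartialHomeomorph X (ℂ × ℂ)}

theorem isHolChart_offLift (hχ : IsHolChart X χ) : IsHolChart (blowUp X p) (offLift p χ hχ) :=
  isHolChart_lift _ _

theorem offLift_apply (hχ : IsHolChart X χ) (y : blowUp X p) :
    offLift p χ hχ y = χ (down p y) := rfl

theorem mem_offLift_source (hχ : IsHolChart X χ) {y : blowUp X p} :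
    y ∈ (offLift p χ hχ).source ↔ down p y ∈ χ.source ∧ down p y ≠ p := by
  change down p y ∈ (χ.restr {p}ᶜ).source ↔ _
  rw [OpenPartialHomeomorph.restr_source' _ _ isOpen_compl_singleton]
  rfl

theorem offLift_symm_apply (hχ : IsHolChart X χ) (w : ℂ × ℂ) :
    (offLift p χ hχ).symm w = up p (χ.symm w) := rfl

theorem mem_offLift_target (hχ : IsHolChart X χ) {w : ℂ × ℂ} :
    w ∈ (offLift p χ hχ).target ↔ w ∈ χ.target ∧ χ.symm w ≠ p := by
  change w ∈ (χ.restr {p}ᶜ).target ↔ _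
  rw [OpenPartialHomeomorph.restr_target, isOpen_compl_singleton.interior_eq]
  rfl

theorem continuous_down : Continuous (down p) := contMDiff_down.continuous

/-! ### Strict transforms -/

/-- The strict transform of a set. -/
def strict (p : X) (C : Set X) : Set (blowUp X p) := closure (down p ⁻¹' (C \ {p}))

theorem isClosed_strict (C : Set X) : IsClosed (strict p C) := isClosed_closure

theorem strict_subset {C : Set X} (hC : IsClosed C) : strict p C ⊆ down p ⁻¹' C :=
  closure_minimal (preimage_mono sdiff_subset) (hC.preimage continuous_down)

theorem mem_strict_iff {C : Set X} (hC : IsClosed C) {y : blowUp X p} (hy : down p y ≠ p) :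
    y ∈ strict p C ↔ down p y ∈ C :=
  ⟨fun h => strict_subset hC h, fun h => subset_closure ⟨h, hy⟩⟩

/-- Over the points other than p the equation of C reads a b = 0 with a ≠ 0, hence b = 0. The
closure neither leaves the closed set b = 0 nor misses its point with a = 0. -/
theorem mem_strict_iff_snd {C : Set X} (hχ : IsHolChart X χ) (hp : p ∈ χ.source)
    (hC : ∀ x ∈ χ.source, x ∈ C ↔ (χ x).2 = (χ p).2) {y : blowUp X p}
    (hy : y ∈ (slope χ hχ hp).source) : y ∈ strict p C ↔ (slope χ hχ hp y).2 = 0 := by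
  have key : ∀ z ∈ (slope χ hχ hp).source, down p z ≠ p →
      (down p z ∈ C ↔ (slope χ hχ hp z).2 = 0) := by
    intro z hz hzp
    rw [hC _ (down_mem_source hχ hp hz), apply_down hχ hp hz]
    have : (slope χ hχ hp z).1 ≠ 0 := fun h => hzp ((down_eq_iff hχ hp hz).2 h)
    simp [blowDown, this]
  constructor
  · intro h
    by_contra hne
    have hopen := (slope χ hχ hp).isOpen_inter_preimage
      (isOpen_compl_singleton.preimage continuous_snd : IsOpen {w : ℂ × ℂ | w.2 ≠ 0})
    obtain ⟨z, ⟨hz1, hz2⟩, hz3, hz4⟩ := mem_closure_iff.1 h _ hopen ⟨hy, hne⟩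
    exact hz2 ((key z hz1 hz4).1 hz3)
  · intro h
    set w := slope χ hχ hp y with hw
    have hwt : w ∈ (slope χ hχ hp).target := (slope χ hχ hp).map_source hy
    -- The point is approached along the line b = 0 through parameters a ≠ 0.
    have hcont : Tendsto (fun a : ℂ => (slope χ hχ hp).symm (a, 0)) (𝓝[≠] w.1) (𝓝 y) := by
      have h1 : Tendsto (fun a : ℂ => (a, (0 : ℂ))) (𝓝[≠] w.1) (𝓝 w) := by
        have : ContinuousAt (fun a : ℂ => (a, (0 : ℂ))) w.1 := by fun_prop
        have h2 : (w.1, (0 : ℂ)) = w := Prod.ext rfl h.symm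
        simpa [ContinuousAt, h2] using this.tendsto.mono_left nhdsWithin_le_nhds
      have h3 := ((slope χ hχ hp).continuousAt_symm hwt).tendsto.comp h1
      rwa [(slope χ hχ hp).left_inv hy] at h3
    refine mem_closure_of_tendsto hcont ?_
    have hev : ∀ᶠ a : ℂ in 𝓝[≠] w.1, (a, (0 : ℂ)) ∈ (slope χ hχ hp).target := by
      have : ContinuousAt (fun a : ℂ => (a, (0 : ℂ))) w.1 := by fun_prop
      refine (this.eventually_mem ((slope χ hχ hp).open_target.mem_nhds ?_)).filter_mono
        nhdsWithin_le_nhds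
      have h2 : (w.1, (0 : ℂ)) = w := Prod.ext rfl h.symm
      rwa [h2]
    have hne : ∀ᶠ a : ℂ in 𝓝[≠] w.1, a ≠ 0 := by
      by_cases h0 : w.1 = 0
      · rw [h0]; exact eventually_mem_nhdsWithin
      · exact (continuousAt_id.eventually_ne h0).filter_mono nhdsWithin_le_nhds
    filter_upwards [hev, hne] with a ha ha0
    have hz := (slope χ hχ hp).map_target ha
    have hzp : down p ((slope χ hχ hp).symm (a, 0)) ≠ p := by
      intro h
      rw [down_eq_iff hχ hp hz, (slope χ hχ hp).right_inv ha] at h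
      exact ha0 h
    exact ⟨(key _ hz hzp).2 (by rw [(slope χ hχ hp).right_inv ha]), hzp⟩

/-- When C is given by the first coordinate, its tangent direction at the centre is the one that the
slope chart omits. The chart is open and contains no point over C \ {p}, so it misses the closure
too. -/
theorem notMem_strict_of_fst {C : Set X} (hχ : IsHolChart X χ) (hp : p ∈ χ.source)
    (hC : ∀ x ∈ χ.source, x ∈ C ↔ (χ x).1 = (χ p).1) {y : blowUp X p}
    (hy : y ∈ (slope χ hχ hp).source) : y ∉ strict p C := by
  intro h
  obtain ⟨z, hz1, hz3, hz4⟩ := mem_closure_iff.1 h _ (slope χ hχ hp).open_source hy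
  have hz5 := (hC _ (down_mem_source hχ hp hz1)).1 hz3
  exact ((mem_slope_source_iff hχ hp hz4).1 hz1).2 hz5

/-! ### The exceptional curve -/

/-- Along the exceptional curve the adapted coordinates are (b, a) and (1 / b, a b). The normal
coordinate is multiplied by b = b ^ (-(-1)), which is the degree -1. -/
theorem isSmoothRationalCurve_exceptional :
    IsSmoothRationalCurve (blowUp X p) (down p ⁻¹' {p}) (-1) := by
  set χ := base p
  have hχ : IsHolChart X χ := base_hol p
  have hp : p ∈ χ.source := mem_base p
  have himage : ∀ (χ : OpenPartialHomeomorph X (ℂ × ℂ)) (hχ : IsHolChart X χ) (hp : p ∈ χ.source),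
      swapChart (slope χ hχ hp) '' (down p ⁻¹' {p} ∩ (swapChart (slope χ hχ hp)).source) =
        {w | w.2 = 0} := by
    intro χ hχ hp
    ext w
    constructor
    · rintro ⟨y, ⟨hy1, hy2⟩, rfl⟩
      exact (down_eq_iff hχ hp hy2).1 hy1
    · intro hw
      change w.2 = 0 at hw
      have ht : w.swap ∈ (slope χ hχ hp).target := by
        rw [slope_target]
        change χ p + blowDown w.swap ∈ χ.target
        have : blowDown w.swap = 0 := by simp [blowDown, hw]
        rw [this, add_zero]
        exact χ.map_source hp
      have hz := (slope χ hχ hp).map_target ht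
      refine ⟨_, ⟨?_, hz⟩, ?_⟩
      · rw [mem_preimage, mem_singleton_iff, down_eq_iff hχ hp hz, (slope χ hχ hp).right_inv ht]
        exact hw
      · change ((slope χ hχ hp) ((slope χ hχ hp).symm w.swap)).swap = w
        rw [(slope χ hχ hp).right_inv ht, Prod.swap_swap]
  refine ⟨swapChart (slope χ hχ hp), swapChart (slope (swapChart χ) hχ.swap (mem_swap hp)),
    (isHolChart_slope hχ hp).swap, (isHolChart_slope hχ.swap (mem_swap hp)).swap, ?_,
    himage _ _ _, himage _ _ _, ?_, ?_⟩
  · intro y hy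
    exact mem_slope_or hχ hp (by rw [show down p y = p from hy]; exact hp)
  · rintro y ⟨-, hy⟩
    exact mem_slope_swap_iff hχ hp hy
  · rintro y ⟨⟨hy0, hy⟩, hy'⟩
    change y ∈ (slope χ hχ hp).source at hy
    change y ∈ (slope (swapChart χ) hχ.swap (mem_swap hp)).source at hy'
    have h1 := slope_swap_apply hχ hp hy hy'
    refine ⟨congrArg Prod.snd h1, ?_⟩
    set b := (slope χ hχ hp y).2 with hb
    change HasDerivAt (fun v : ℂ => (slope (swapChart χ) hχ.swap (mem_swap hp)
      ((slope χ hχ hp).symm (v, b))).1) (b ^ (- -1 : ℤ)) 0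
    have hb0 : b ≠ 0 := (mem_slope_swap_iff hχ hp hy).1 hy'
    have hev : (fun v : ℂ => (slope (swapChart χ) hχ.swap (mem_swap hp)
      ((slope χ hχ hp).symm (v, b))).1) =ᶠ[𝓝 0] fun v => v * b := by
      have hcont : ContinuousAt (fun v : ℂ => (v, b)) 0 := by fun_prop
      have h0 : ((0 : ℂ), b) ∈ (slope χ hχ hp).target := by
        simp [slope_target, blowDown_zero_fst, χ.map_source hp]
      filter_upwards [hcont.eventually_mem ((slope χ hχ hp).open_target.mem_nhds h0)] with v hv
      have hz := (slope χ hχ hp).map_target hv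
      have hz' := (mem_slope_swap_iff hχ hp hz).2
        (by rw [(slope χ hχ hp).right_inv hv]; exact hb0)
      rw [slope_swap_apply hχ hp hz hz', (slope χ hχ hp).right_inv hv]
    refine HasDerivAt.congr_of_eventuallyEq ?_ hev
    simpa using (hasDerivAt_id (0 : ℂ)).mul_const b

/-! ### Crossings -/

theorem crossNormallyAt_up {C D : Set X} {C' D' : Set (blowUp X p)} {x : X} (hx : x ≠ p)
    (hC : ∀ y, down p y ≠ p → (y ∈ C' ↔ down p y ∈ C))
    (hD : ∀ y, down p y ≠ p → (y ∈ D' ↔ down p y ∈ D)) (h : CrossNormallyAt X C D x) :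
    CrossNormallyAt (blowUp X p) C' D' (up p x) := by
  obtain ⟨φ, hφ, hxφ, h0, h1, h2⟩ := h
  refine ⟨offLift p φ hφ, isHolChart_offLift hφ, ?_, ?_, ?_, ?_⟩
  · rw [mem_offLift_source, down_up hx]
    exact ⟨hxφ, hx⟩
  · rw [offLift_apply, down_up hx, h0]
  · intro y hy
    rw [mem_offLift_source] at hy
    rw [hC y hy.2, h1 _ hy.1]
    rfl
  · intro y hy
    rw [mem_offLift_source] at hy
    rw [hD y hy.2, h2 _ hy.1]
    rfl

theorem _root_.Ince.CrossNormallyAt.symm {X : Surface} {C D : Set X} {x : X}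
    (h : CrossNormallyAt X C D x) : CrossNormallyAt X D C x := by
  obtain ⟨φ, hφ, hxφ, h0, h1, h2⟩ := h
  refine ⟨swapChart φ, hφ.swap, hxφ, ?_, h2, h1⟩
  change (φ x).swap = 0
  rw [h0]; rfl

/-- In the slope chart of the swapped coordinates the exceptional curve and the strict transform are
the two axes. The other slope chart does not meet the strict transform, so the origin is the only
common point. -/
theorem crossNormally_strict_exceptional {C : Set X} (hχ : IsHolChart X χ) (hp : p ∈ χ.source)
    (hC : ∀ x ∈ χ.source, x ∈ C ↔ (χ x).1 = (χ p).1) :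
    ∃ y, strict p C ∩ down p ⁻¹' {p} = {y} ∧
      CrossNormallyAt (blowUp X p) (strict p C) (down p ⁻¹' {p}) y := by
  set s := slope (swapChart χ) hχ.swap (mem_swap hp) with hs
  have ht : (0 : ℂ × ℂ) ∈ s.target := by
    rw [hs, slope_target]
    change swapChart χ p + blowDown (0, 0) ∈ (swapChart χ).target
    rw [blowDown_zero_fst, add_zero]
    exact (swapChart χ).map_source hp
  have h1 : ∀ y ∈ s.source, (y ∈ strict p C ↔ (s y).2 = 0) := fun y hy =>
    mem_strict_iff_snd hχ.swap (mem_swap hp) (fun x hx => hC x hx) hy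
  have h2 : ∀ y ∈ s.source, (y ∈ down p ⁻¹' {p} ↔ (s y).1 = 0) := fun y hy =>
    down_eq_iff hχ.swap (mem_swap hp) hy
  refine ⟨s.symm 0, ?_, swapChart s, (isHolChart_slope _ _).swap, s.map_target ht, ?_, h1, h2⟩
  · ext y
    rw [mem_singleton_iff]
    constructor
    · rintro ⟨hy, hyp⟩
      have hys : y ∈ s.source := by
        rcases mem_slope_or (y := y) hχ hp (by rw [show down p y = p from hyp]; exact hp) with h | h
        · exact (notMem_strict_of_fst hχ hp hC h hy).elim
        · exact h
      rw [← s.left_inv hys]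
      congr 1
      exact Prod.ext ((h2 y hys).1 hyp) ((h1 y hys).1 hy)
    · rintro rfl
      have := s.map_target ht
      exact ⟨(h1 _ this).2 (by rw [s.right_inv ht]; rfl), (h2 _ this).2 (by rw [s.right_inv ht]; rfl)⟩
  · change (s (s.symm 0)).swap = 0
    rw [s.right_inv ht]; rfl

end BlowUp

namespace BlowUp

variable {X : Surface} {p : X}

/-! ### Smooth rational curves under blowing-up -/

theorem _root_.Ince.mem_iff_snd_eq_zero {X : Surface} {C : Set X}
    {α : OpenPartialHomeomorph X (ℂ × ℂ)}
    (h : α '' (C ∩ α.source) = {w | w.2 = 0}) {x : X} (hx : x ∈ α.source) :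
    x ∈ C ↔ (α x).2 = 0 := by
  constructor
  · intro hC
    exact h.subset ⟨x, ⟨hC, hx⟩, rfl⟩
  · intro h0
    obtain ⟨y, ⟨hyC, hy⟩, hxy⟩ := h.superset h0
    rwa [← α.injOn hy hx hxy]

theorem _root_.Ince.mem_target_of_image {X : Surface} {C : Set X}
    {α : OpenPartialHomeomorph X (ℂ × ℂ)}
    (h : α '' (C ∩ α.source) = {w | w.2 = 0}) (u : ℂ) : (u, (0 : ℂ)) ∈ α.target := by
  obtain ⟨y, ⟨-, hy⟩, hxy⟩ := h.superset (show ((u, (0 : ℂ)) : ℂ × ℂ).2 = 0 from rfl)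
  rw [← hxy]
  exact α.map_source hy

theorem _root_.Ince.image_eq_of_adapted {X : Surface} {C : Set X}
    {α : OpenPartialHomeomorph X (ℂ × ℂ)}
    (h : ∀ x ∈ α.source, x ∈ C ↔ (α x).2 = 0) (ht : ∀ u : ℂ, (u, (0 : ℂ)) ∈ α.target) :
    α '' (C ∩ α.source) = {w | w.2 = 0} := by
  ext w
  constructor
  · rintro ⟨x, ⟨hC, hx⟩, rfl⟩
    exact (h x hx).1 hC
  · intro hw
    have hw' : w ∈ α.target := by
      have := ht w.1
      rwa [show (w.1, (0 : ℂ)) = w from Prod.ext rfl (Eq.symm hw)] at this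
    have hs := α.map_target hw'
    exact ⟨_, ⟨(h _ hs).2 (by rw [α.right_inv hw']; exact hw), hs⟩, α.right_inv hw'⟩

theorem isSmoothRationalCurve_preimage {C : Set X} {n : ℤ} (h : IsSmoothRationalCurve X C n)
    (hp : p ∉ C) : IsSmoothRationalCurve (blowUp X p) (down p ⁻¹' C) n := by
  obtain ⟨α, β, hα, hβ, hcov, hαC, hβC, hov, htr⟩ := h
  have himage : ∀ (α : OpenPartialHomeomorph X (ℂ × ℂ)) (hα : IsHolChart X α),
      α '' (C ∩ α.source) = {w | w.2 = 0} →
      offLift p α hα '' (down p ⁻¹' C ∩ (offLift p α hα).source) = {w | w.2 = 0} := by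
    intro α hα hαC
    refine image_eq_of_adapted ?_ ?_
    · intro y hy
      exact mem_iff_snd_eq_zero hαC ((mem_offLift_source hα).1 hy).1
    · intro u
      have ht := mem_target_of_image hαC u
      refine (mem_offLift_target hα).2 ⟨ht, fun h => hp ?_⟩
      rw [← h, mem_iff_snd_eq_zero hαC (α.map_target ht), α.right_inv ht]
  refine ⟨offLift p α hα, offLift p β hβ, isHolChart_offLift hα, isHolChart_offLift hβ, ?_,
    himage α hα hαC, himage β hβ hβC, ?_, ?_⟩
  · intro y hy
    have hne : down p y ≠ p := fun h => hp (h ▸ hy)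
    rcases hcov hy with h | h
    · exact .inl ((mem_offLift_source hα).2 ⟨h, hne⟩)
    · exact .inr ((mem_offLift_source hβ).2 ⟨h, hne⟩)
  · rintro y ⟨hyC, hy⟩
    rw [mem_offLift_source] at hy
    rw [mem_offLift_source, offLift_apply, ← hov _ ⟨hyC, hy.1⟩]
    simp [hy.2]
  · rintro y ⟨⟨hyC, hy⟩, hy'⟩
    have hy1 := (mem_offLift_source hα).1 hy
    have hy2 := (mem_offLift_source hβ).1 hy'
    obtain ⟨h1, h2⟩ := htr _ ⟨⟨hyC, hy1.1⟩, hy2.1⟩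
    refine ⟨h1, h2.congr_of_eventuallyEq ?_⟩
    have hcont : ContinuousAt (fun v : ℂ => ((α (down p y)).1, v)) 0 := by fun_prop
    have h0 : ((α (down p y)).1, (0 : ℂ)) ∈ (offLift p α hα).target := by
      have := (offLift p α hα).map_source hy
      have h3 := (mem_iff_snd_eq_zero hαC hy1.1).1 hyC
      rwa [offLift_apply, show α (down p y) = ((α (down p y)).1, (0 : ℂ)) from
        Prod.ext rfl h3] at this
    filter_upwards [hcont.eventually_mem ((offLift p α hα).open_target.mem_nhds h0)] with v hv
    rw [mem_offLift_target] at hv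
    simp only [offLift_apply, offLift_symm_apply, down_up hv.2]

/-- The factor by which the normal coordinate is divided. -/
def strictFactor (p : X) (α : OpenPartialHomeomorph X (ℂ × ℂ)) (u : ℂ) : ℂ :=
  open Classical in if p ∈ α.source then u - (α p).1 else 1

/-- The change of coordinates `(a, b) ↦ (a + u₀, c b)`. -/
def shiftScale (u₀ c : ℂ) (hc : c ≠ 0) : (ℂ × ℂ) ≃ₜ (ℂ × ℂ) where
  toFun w := (w.1 + u₀, c * w.2)
  invFun w := (w.1 - u₀, c⁻¹ * w.2)
  left_inv w := by simp [hc]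
  right_inv w := by simp [hc]
  continuous_toFun := by fun_prop
  continuous_invFun := by fun_prop

/-- A chart through the centre is replaced by its slope chart, which divides the normal coordinate
by u - u(p); a chart that avoids the centre is kept. The scaling constant c is left free in order to
normalize the transition between two such charts. -/
theorem exists_strict_chart {C : Set X} (hC : IsClosed C) (hpC : p ∈ C)
    {α : OpenPartialHomeomorph X (ℂ × ℂ)} (hα : IsHolChart X α)
    (hαC : ∀ x ∈ α.source, x ∈ C ↔ (α x).2 = 0) (ht : ∀ u : ℂ, (u, (0 : ℂ)) ∈ α.target)
    {c : ℂ} (hc : c ≠ 0) :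
    ∃ α' : OpenPartialHomeomorph (blowUp X p) (ℂ × ℂ), IsHolChart (blowUp X p) α' ∧
      (∀ y ∈ strict p C, y ∈ α'.source ↔ down p y ∈ α.source) ∧
      (∀ y ∈ α'.source, down p y ∈ α.source) ∧
      (∀ y ∈ α'.source, y ∈ strict p C ↔ (α' y).2 = 0) ∧
      (∀ u : ℂ, (u, (0 : ℂ)) ∈ α'.target) ∧
      (∀ y ∈ α'.source, (α' y).1 = (α (down p y)).1) ∧
      (∀ y ∈ α'.source, c * (α (down p y)).2 = (α' y).2 * strictFactor p α (α' y).1) := by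
  by_cases hp : p ∈ α.source
  · have h0 : (α p).2 = 0 := (hαC p hp).1 hpC
    set h := shiftScale (α p).1 c hc
    set s := slope α hα hp
    have hs : ∀ y ∈ s.source, y ∈ strict p C ↔ (s y).2 = 0 := fun y hy =>
      mem_strict_iff_snd hα hp (fun x hx => by rw [hαC x hx, h0]) hy
    refine ⟨s.transHomeomorph h, (isHolChart_slope hα hp).transHomeomorph
      ((contDiff_fst.add contDiff_const).prodMk (contDiff_const.mul contDiff_snd))
      ((contDiff_fst.sub contDiff_const).prodMk (contDiff_const.mul contDiff_snd)),
      ?_, ?_, ?_, ?_, ?_, ?_⟩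
    · intro y hy
      refine ⟨fun h => down_mem_source hα hp h, fun h => ?_⟩
      rcases mem_slope_or hα hp h with h | h
      · exact h
      · exact (notMem_strict_of_fst hα.swap (mem_swap hp)
          (fun x hx => (hαC x hx).trans (by rw [← h0]; rfl)) h hy).elim
    · exact fun y hy => down_mem_source hα hp hy
    · intro y hy
      rw [hs y hy]
      change _ ↔ c * (s y).2 = 0
      simp [hc]
    · intro u
      change h.symm (u, 0) ∈ s.target
      change α p + blowDown (u - (α p).1, c⁻¹ * 0) ∈ α.target
      have : α p + blowDown (u - (α p).1, c⁻¹ * 0) = (u, 0) := by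
        ext <;> simp [blowDown, h0]
      rw [this]
      exact ht u
    · intro y hy
      change (s y).1 + (α p).1 = _
      rw [apply_down hα hp hy]
      simp [blowDown, add_comm, s]
    · intro y hy
      change _ = c * (s y).2 * strictFactor p α ((s y).1 + (α p).1)
      rw [apply_down hα hp hy, strictFactor, if_pos hp]
      simp only [blowDown, Prod.snd_add, h0, s]
      ring
  · set h := shiftScale 0 c hc
    set s := lift α hα hp
    have hs : ∀ y ∈ s.source, down p y ≠ p := fun y hy h => hp (h ▸ hy)
    refine ⟨s.transHomeomorph h, (isHolChart_lift hα hp).transHomeomorph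
      ((contDiff_fst.add contDiff_const).prodMk (contDiff_const.mul contDiff_snd))
      ((contDiff_fst.sub contDiff_const).prodMk (contDiff_const.mul contDiff_snd)),
      ?_, ?_, ?_, ?_, ?_, ?_⟩
    · exact fun y hy => Iff.rfl
    · exact fun y hy => hy
    · intro y hy
      refine (mem_strict_iff hC (hs y hy)).trans ((hαC _ hy).trans ?_)
      change (α (down p y)).2 = 0 ↔ c * (α (down p y)).2 = 0
      simp [hc]
    · intro u
      change (u - 0, c⁻¹ * 0) ∈ α.target
      simpa using ht u
    · intro y hy
      exact add_zero _
    · intro y hy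
      rw [strictFactor, if_neg hp, mul_one]
      rfl

theorem hasDerivAt_snd_slice {Φ : ℂ × ℂ → ℂ × ℂ} {u : ℂ} (h : DifferentiableAt ℂ Φ (u, 0)) :
    HasDerivAt (fun v : ℂ => (Φ (u, v)).2) (fderiv ℂ Φ (u, 0) (0, 1)).2 0 := by
  have h1 : HasDerivAt (fun v : ℂ => (u, v)) ((0 : ℂ), (1 : ℂ)) 0 :=
    (hasDerivAt_const (0 : ℂ) u).prodMk (hasDerivAt_id (0 : ℂ))
  have h2 := h.hasFDerivAt.comp_hasDerivAt (0 : ℂ) h1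
  exact (hasFDerivAt_snd (𝕜 := ℂ) (E := ℂ) (F := ℂ)).comp_hasDerivAt (0 : ℂ) h2

/-- The two normal coordinates are divided by u - u₀ and 1/u - 1/u₀, whose quotient is -u₀ u. The
transition factor thus gains one power of u, up to a constant absorbed by rescaling, and the degree
drops by 1. -/
theorem isSmoothRationalCurve_strict {C : Set X} {n : ℤ} (h : IsSmoothRationalCurve X C n)
    (hC : IsClosed C) (hpC : p ∈ C) :
    IsSmoothRationalCurve (blowUp X p) (strict p C) (n - 1) := by
  obtain ⟨α, β, hα, hβ, hcov, hαC', hβC', hov, htr⟩ := h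
  have hαC := fun x hx => mem_iff_snd_eq_zero (x := x) hαC' hx
  have hβC := fun x hx => mem_iff_snd_eq_zero (x := x) hβC' hx
  have hαt := mem_target_of_image hαC'
  have hβt := mem_target_of_image hβC'
  -- If the centre lies in both charts, then c = -1/u₀. If it lies in only one, it is the zero of
  -- the coordinate there, the quotient of the factors is u itself, and c = 1.
  obtain ⟨c, hc0, hc⟩ : ∃ c : ℂ, c ≠ 0 ∧ ∀ u, u ≠ 0 → strictFactor p β u⁻¹ ≠ 0 →
      c * strictFactor p α u / strictFactor p β u⁻¹ = u := by
    by_cases h1 : p ∈ α.source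
    · by_cases h2 : p ∈ β.source
      · have hu : (α p).1 ≠ 0 := (hov p ⟨hpC, h1⟩).1 h2
        have hu' := (htr p ⟨⟨hpC, h1⟩, h2⟩).1
        refine ⟨-(α p).1⁻¹, by simpa using hu, fun u hu0 hne => ?_⟩
        simp only [strictFactor, if_pos h1, if_pos h2, hu'] at hne ⊢
        field_simp
        have : (α p).1 - u ≠ 0 := by
          intro h3
          rw [sub_eq_zero] at h3
          exact hne (by rw [h3, sub_self])
        field_simp
        ring
      · have hu : (α p).1 = 0 := by
          by_contra h3
          exact h2 ((hov p ⟨hpC, h1⟩).2 h3)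
        refine ⟨1, one_ne_zero, fun u _ _ => ?_⟩
        simp [strictFactor, h1, h2, hu]
    · have h2 : p ∈ β.source := (hcov hpC).resolve_left h1
      have hu : (β p).1 = 0 := by
        by_contra h3
        have ht := hαt (β p).1⁻¹
        have hx := α.map_target ht
        have hxC : α.symm ((β p).1⁻¹, 0) ∈ C := (hαC _ hx).2 (by rw [α.right_inv ht])
        have hxβ := (hov _ ⟨hxC, hx⟩).2 (by rw [α.right_inv ht]; exact inv_ne_zero h3)
        have h4 := (htr _ ⟨⟨hxC, hx⟩, hxβ⟩).1
        rw [α.right_inv ht, inv_inv] at h4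
        have h5 := β.injOn hxβ h2 (Prod.ext h4 (by rw [(hβC _ hxβ).1 hxC, (hβC _ h2).1 hpC]))
        exact h1 (h5 ▸ hx)
      refine ⟨1, one_ne_zero, fun u _ _ => ?_⟩
      simp [strictFactor, h1, h2, hu]
  obtain ⟨α', hα', a1, a2, a3, a4, a5, a6⟩ := exists_strict_chart hC hpC hα hαC hαt one_ne_zero
  obtain ⟨β', hβ', b1, b2, b3, b4, b5, b6⟩ := exists_strict_chart hC hpC hβ hβC hβt hc0
  have hsub := strict_subset (p := p) hC
  have hov' : ∀ y ∈ strict p C ∩ α'.source, y ∈ β'.source ↔ (α' y).1 ≠ 0 := by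
    rintro y ⟨hyC, hy⟩
    rw [b1 y hyC, a5 y hy]
    exact hov _ ⟨hsub hyC, a2 y hy⟩
  have hslice : ∀ u : ℂ, α'.symm (u, 0) ∈ strict p C := fun u =>
    (a3 _ (α'.map_target (a4 u))).2 (by rw [α'.right_inv (a4 u)])
  have hmem : ∀ u : ℂ, u ≠ 0 → α'.symm (u, 0) ∈ β'.source := fun u hu =>
    (hov' _ ⟨hslice u, α'.map_target (a4 u)⟩).2 (by rwa [α'.right_inv (a4 u)])
  have hsmooth : ∀ u : ℂ, u ≠ 0 → ContDiffAt ℂ ω (β' ∘ α'.symm) (u, 0) := fun u hu =>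
    hα'.contDiffAt_transition hβ' (a4 u) (hmem u hu)
  have hoff : ∀ u : ℂ, u ≠ 0 → down p (α'.symm (u, 0)) ≠ p →
      HasDerivAt (fun v : ℂ => ((β' ∘ α'.symm) (u, v)).2) (u ^ (-(n - 1))) 0 := by
    intro u hu hne
    set y := α'.symm (u, 0) with hy
    have hyα' : y ∈ α'.source := α'.map_target (a4 u)
    have hyα := a2 y hyα'
    have hyβ := b2 y (hmem u hu)
    have hyC : down p y ∈ C := hsub (hslice u)
    have hαy : α (down p y) = (u, 0) := by
      refine Prod.ext ?_ ((hαC _ hyα).1 hyC)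
      rw [← a5 y hyα', hy, α'.right_inv (a4 u)]
    obtain ⟨h1, h2⟩ := htr _ ⟨⟨hyC, hyα⟩, hyβ⟩
    rw [hαy] at h1 h2
    simp only at h1 h2
    set k := strictFactor p α u with hk
    have hk0 : strictFactor p β u⁻¹ ≠ 0 := by
      rw [strictFactor]
      split_ifs with h3
      · intro h4
        rw [sub_eq_zero] at h4
        refine hne (β.injOn hyβ h3 (Prod.ext (h1.trans h4) ?_))
        rw [(hβC _ hyβ).1 hyC, (hβC _ h3).1 hpC]
      · exact one_ne_zero
    have hΦ : ContDiffAt ℂ ω (β ∘ α.symm) (u, 0) := by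
      have ht := hαt u
      refine hα.contDiffAt_transition hβ ht ?_
      rwa [← hαy, α.left_inv hyα]
    have hcurve : HasDerivAt (fun v : ℂ => v * k) k 0 := by
      simpa using (hasDerivAt_id (0 : ℂ)).mul_const k
    have hN : HasDerivAt (fun v : ℂ => c * (β (α.symm (u, v * k))).2) (c * (u ^ (-n) * k)) 0 := by
      refine HasDerivAt.const_mul c ?_
      refine HasDerivAt.comp (0 : ℂ) (h₂ := fun v : ℂ => (β (α.symm (u, v))).2) ?_ hcurve
      simpa using h2
    have hpair : HasDerivAt (fun v : ℂ => (u, v * k)) ((0 : ℂ), k) 0 :=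
      (hasDerivAt_const (0 : ℂ) u).prodMk hcurve
    have hβ0 : β (α.symm (u, 0)) = β (down p y) := by rw [← hαy, α.left_inv hyα]
    have hD1 : DifferentiableAt ℂ (fun v : ℂ => (β (α.symm (u, v * k))).1) 0 := by
      have h3 : DifferentiableAt ℂ (β ∘ α.symm) ((fun v : ℂ => (u, v * k)) 0) := by
        simpa using hΦ.differentiableAt (by simp)
      exact (h3.comp (0 : ℂ) hpair.differentiableAt).fst
    have hD : DifferentiableAt ℂ
        (fun v : ℂ => strictFactor p β (β (α.symm (u, v * k))).1) 0 := by
      unfold strictFactor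
      split_ifs
      · exact hD1.sub_const _
      · exact differentiableAt_const _
    have hD0 : strictFactor p β (β (α.symm (u, 0 * k))).1 = strictFactor p β u⁻¹ := by
      rw [zero_mul, hβ0, h1]
    have hN0 : (β (α.symm (u, 0 * k))).2 = 0 := by
      rw [zero_mul, hβ0]
      exact (hβC _ hyβ).1 hyC
    -- The numerator vanishes at v = 0, so the derivative of the denominator drops out of the
    -- quotient rule.
    have hquot := hN.div hD.hasDerivAt (by rw [hD0]; exact hk0)
    have hval : (c * (u ^ (-n) * k) * strictFactor p β (β (α.symm (u, 0 * k))).1 -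
        c * (β (α.symm (u, 0 * k))).2 *
          deriv (fun v : ℂ => strictFactor p β (β (α.symm (u, v * k))).1) 0) /
        strictFactor p β (β (α.symm (u, 0 * k))).1 ^ 2 = u ^ (-(n - 1)) := by
      rw [hD0, hN0]
      have h3 := hc u hu hk0
      have h4 : u ^ (-(n - 1)) = u ^ (-n) * u := by
        rw [← zpow_add_one₀ hu]; congr 1; ring
      rw [h4]
      rw [h4, ← hk] at *
      generalize strictFactor p β u⁻¹ = F at h3 hk0 ⊢
      calc _ = u ^ (-n) * (c * k / F) := by field_simp; ring
        _ = _ := by rw [h3]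
    rw [hval] at hquot
    refine hquot.congr_of_eventuallyEq ?_
    have hc1 : ContinuousAt (fun v : ℂ => (u, v)) 0 := by fun_prop
    have hc2 : ContinuousAt (fun v : ℂ => α'.symm (u, v)) 0 :=
      ContinuousAt.comp (g := α'.symm) (α'.continuousAt_symm (a4 u)) hc1
    have hc3 : ContinuousAt (fun v : ℂ => (u, v * k)) 0 := hpair.continuousAt
    have hc4 : ContinuousAt (fun v : ℂ => strictFactor p β (β (α.symm (u, v * k))).1) 0 :=
      hD.continuousAt
    have hα0 : (u, 0 * k) ∈ α.target := by rw [zero_mul]; exact hαt u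
    filter_upwards [hc1.eventually_mem (α'.open_target.mem_nhds (a4 u)),
      hc2.eventually_mem (β'.open_source.mem_nhds (hmem u hu)),
      hc4.eventually_ne (by rw [hD0]; exact hk0)] with v hv1 hv2 hv4
    have hz := α'.map_target hv1
    have h5 := a5 _ hz
    have h6 := a6 _ hz
    rw [α'.right_inv hv1] at h5 h6
    simp only [one_mul] at h5 h6
    have h7 : down p (α'.symm (u, v)) = α.symm (u, v * k) := by
      rw [← α.left_inv (a2 _ hz)]
      congr 1
      exact Prod.ext h5.symm h6
    have h8 := b6 _ hv2
    rw [b5 _ hv2, h7] at h8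
    change (β' (α'.symm (u, v))).2 =
      c * (β (α.symm (u, v * k))).2 / strictFactor p β (β (α.symm (u, v * k))).1
    rw [eq_div_iff hv4]
    exact h8.symm
  have hall : ∀ u : ℂ, u ≠ 0 →
      HasDerivAt (fun v : ℂ => ((β' ∘ α'.symm) (u, v)).2) (u ^ (-(n - 1))) 0 := by
    intro u hu
    -- Over the centre the old transition gives no direct information. The formula extends there
    -- because both sides are continuous in u and agree on a punctured neighbourhood.
    by_cases hne : down p (α'.symm (u, 0)) = p
    · have h1 := hasDerivAt_snd_slice ((hsmooth u hu).differentiableAt (by simp))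
      have h2 : ContinuousAt (fun t : ℂ => (fderiv ℂ (β' ∘ α'.symm) (t, 0) (0, 1)).2) u := by
        have h3 : ContinuousAt (fderiv ℂ (β' ∘ α'.symm)) ((fun t : ℂ => (t, (0 : ℂ))) u) :=
          ((hsmooth u hu).fderiv_right (m := 0) (by simp)).continuousAt
        have h4 : ContinuousAt (fun t : ℂ => (t, (0 : ℂ))) u := by fun_prop
        exact ((ContinuousAt.comp (f := fun t : ℂ => (t, (0 : ℂ))) h3 h4).clm_apply continuousAt_const).snd
      have h3 : Tendsto (fun t : ℂ => t ^ (-(n - 1))) (𝓝[≠] u) (𝓝 (u ^ (-(n - 1)))) :=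
        (continuousAt_zpow₀ u _ (.inl hu)).tendsto.mono_left nhdsWithin_le_nhds
      have h4 : (fun t : ℂ => (fderiv ℂ (β' ∘ α'.symm) (t, 0) (0, 1)).2) =ᶠ[𝓝[≠] u]
          fun t : ℂ => t ^ (-(n - 1)) := by
        filter_upwards [eventually_mem_nhdsWithin,
          (continuousAt_id.eventually_ne hu).filter_mono nhdsWithin_le_nhds] with t ht ht0
        have h5 : down p (α'.symm (t, 0)) ≠ p := by
          intro h6
          have h7 := a5 _ (α'.map_target (a4 t))
          have h8 := a5 _ (α'.map_target (a4 u))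
          have h9 : (α (down p (α'.symm (t, 0)))).1 = (α (down p (α'.symm (u, 0)))).1 := by
            rw [h6, hne]
          rw [← h7, ← h8, α'.right_inv (a4 t), α'.right_inv (a4 u)] at h9
          exact ht h9
        exact (hasDerivAt_snd_slice ((hsmooth t ht0).differentiableAt (by simp))).unique
          (hoff t ht0 h5)
      have h5 := tendsto_nhds_unique ((h2.tendsto.mono_left nhdsWithin_le_nhds).congr' h4) h3
      rw [← h5]
      exact h1
    · exact hoff u hu hne
  refine ⟨α', β', hα', hβ', ?_, image_eq_of_adapted a3 a4, image_eq_of_adapted b3 b4, hov', ?_⟩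
  · intro y hy
    rcases hcov (hsub hy) with h | h
    · exact .inl ((a1 y hy).2 h)
    · exact .inr ((b1 y hy).2 h)
  · rintro y ⟨⟨hyC, hy⟩, hy'⟩
    refine ⟨?_, hall _ ((hov' y ⟨hyC, hy⟩).1 hy')⟩
    rw [b5 y hy', a5 y hy]
    exact (htr _ ⟨⟨hsub hyC, a2 y hy⟩, b2 y hy'⟩).1

end BlowUp

/-! ### The projective plane as a complex surface -/

namespace Plane

/-- The inhomogeneous coordinates in the `i`-th standard affine chart. -/
def dehom (i : Fin 3) (v : Fin 3 → ℂ) : ℂ × ℂ :=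
  match i with
  | 0 => (v 1 / v 0, v 2 / v 0)
  | 1 => (v 0 / v 1, v 2 / v 1)
  | 2 => (v 1 / v 2, v 0 / v 2)

theorem dehom_homog (i : Fin 3) (z : ℂ × ℂ) : dehom i (homog i z) = z := by
  fin_cases i <;> simp [dehom, homog]

theorem homog_self (i : Fin 3) (z : ℂ × ℂ) : homog i z i = 1 := by
  fin_cases i <;> simp [homog]

theorem smul_homog_dehom (i : Fin 3) {v : Fin 3 → ℂ} (h : v i ≠ 0) :
    v i • homog i (dehom i v) = v := by
  ext j
  fin_cases i <;> fin_cases j <;> simp_all [dehom, homog, mul_div_cancel₀]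

theorem dehom_smul (i : Fin 3) {c : ℂ} (hc : c ≠ 0) (v : Fin 3 → ℂ) :
    dehom i (c • v) = dehom i v := by
  fin_cases i <;> simp [dehom, mul_div_mul_left, hc]

theorem contDiff_homog (i : Fin 3) : ContDiff ℂ ω (homog i) := by
  rw [contDiff_pi]
  intro j
  fin_cases i <;> fin_cases j <;> simp only [homog] <;>
    first | exact contDiff_const | exact contDiff_fst | exact contDiff_snd

theorem contDiffOn_dehom (i : Fin 3) : ContDiffOn ℂ ω (dehom i) {v | v i ≠ 0} := by
  have h : ∀ j : Fin 3, ContDiffOn ℂ ω (fun v : Fin 3 → ℂ => v j) {v | v i ≠ 0} := fun j =>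
    (contDiff_apply ℂ ℂ j).contDiffOn
  fin_cases i <;>
    exact ((h _).div (h _) fun v hv => hv).prodMk ((h _).div (h _) fun v hv => hv)

theorem exists_rep_mk (v : Fin 3 → ℂ) (hv : v ≠ 0) :
    ∃ c : ℂ, c ≠ 0 ∧ (Projectivization.mk ℂ v hv).rep = c • v := by
  obtain ⟨a, ha⟩ := Projectivization.exists_smul_eq_mk_rep ℂ v hv
  exact ⟨a, a.ne_zero, ha.symm⟩

/-- The standard affine charts of the projective plane. -/
def chart (i : Fin 3) : PartialEquiv (ℙ ℂ (Fin 3 → ℂ)) (ℂ × ℂ) where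
  toFun x := dehom i x.rep
  invFun z := Projectivization.mk ℂ (homog i z) (homog_ne_zero i z)
  source := {x | x.rep i ≠ 0}
  target := univ
  map_source' _ _ := mem_univ _
  map_target' z _ := by
    obtain ⟨c, hc, h⟩ := exists_rep_mk (homog i z) (homog_ne_zero i z)
    change (Projectivization.mk ℂ (homog i z) (homog_ne_zero i z)).rep i ≠ 0
    rw [h, Pi.smul_apply, homog_self]
    simpa using hc
  left_inv' x hx := by
    change x.rep i ≠ 0 at hx
    conv_rhs => rw [← x.mk_rep]
    rw [Projectivization.mk_eq_mk_iff']
    exact ⟨(x.rep i)⁻¹, by rw [inv_smul_eq_iff₀ hx, smul_homog_dehom i hx]⟩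
  right_inv' z _ := by
    obtain ⟨c, hc, h⟩ := exists_rep_mk (homog i z) (homog_ne_zero i z)
    rw [h, dehom_smul i hc, dehom_homog]

theorem mk_mem_source {i : Fin 3} {v : Fin 3 → ℂ} (hv : v ≠ 0) :
    Projectivization.mk ℂ v hv ∈ (chart i).source ↔ v i ≠ 0 := by
  obtain ⟨c, hc, h⟩ := exists_rep_mk v hv
  change (Projectivization.mk ℂ v hv).rep i ≠ 0 ↔ _
  rw [h]
  simp [hc]

theorem chart_mk (i : Fin 3) {v : Fin 3 → ℂ} (hv : v ≠ 0) :
    chart i (Projectivization.mk ℂ v hv) = dehom i v := by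
  obtain ⟨c, hc, h⟩ := exists_rep_mk v hv
  change dehom i (Projectivization.mk ℂ v hv).rep = _
  rw [h, dehom_smul i hc]

theorem transition_source (i j : Fin 3) :
    ((chart i).symm.trans (chart j)).source = {z | homog i z j ≠ 0} := by
  ext z
  change z ∈ univ ∧ (chart i).symm z ∈ (chart j).source ↔ _
  change z ∈ univ ∧ Projectivization.mk ℂ (homog i z) (homog_ne_zero i z) ∈ (chart j).source ↔ _
  rw [mk_mem_source]
  simp

/-- The holomorphic atlas of the projective plane. -/
def atlas : HolAtlas (ℙ ℂ (Fin 3 → ℂ)) (ℂ × ℂ) where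
  ι := Fin 3
  e := chart
  cover x := by
    by_contra! h
    refine x.rep_nonzero (funext fun i => ?_)
    exact not_not.1 (h i)
  isOpen i j := by
    rw [transition_source]
    exact isOpen_ne.preimage ((continuous_apply j).comp (contDiff_homog i).continuous)
  contDiffOn i j := by
    rw [transition_source]
    refine ((contDiffOn_dehom j).comp (contDiff_homog i).contDiffOn fun z hz => hz).congr ?_
    intro z _
    exact chart_mk j _

/-- The orthogonal projector on the line spanned by a vector. -/
def projector (v : Fin 3 → ℂ) (i j : Fin 3) : ℂ :=
  v i * star (v j) / ∑ k, v k * star (v k)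

theorem sum_mul_star_ne_zero {v : Fin 3 → ℂ} (hv : v ≠ 0) : ∑ k, v k * star (v k) ≠ 0 := by
  have h : ∑ k, v k * star (v k) = ((∑ k, ‖v k‖ ^ 2 : ℝ) : ℂ) := by
    push_cast
    exact Finset.sum_congr rfl fun k _ => Complex.mul_conj' (v k)
  rw [h, Complex.ofReal_ne_zero]
  intro h0
  rw [Finset.sum_eq_zero_iff_of_nonneg fun _ _ => by positivity] at h0
  exact hv (funext fun k => by simpa using h0 k (Finset.mem_univ k))

theorem projector_smul {c : ℂ} (hc : c ≠ 0) (v : Fin 3 → ℂ) : projector (c • v) = projector v := by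
  ext i j
  have hc' : star c ≠ 0 := star_ne_zero.2 hc
  have h : ∑ k, (c • v) k * star ((c • v) k) = c * star c * ∑ k, v k * star (v k) := by
    rw [Finset.mul_sum]
    refine Finset.sum_congr rfl fun k _ => ?_
    simp only [Pi.smul_apply, smul_eq_mul, star_mul']
    ring
  simp only [projector, h]
  simp only [Pi.smul_apply, smul_eq_mul, star_mul']
  rw [← mul_div_mul_left (v i * star (v j)) _ (mul_ne_zero hc hc')]
  ring

/-- The projector of w fixes w, whereas the image of the projector of v is the line of v. -/
theorem exists_smul_of_projector_eq {v w : Fin 3 → ℂ} (hw : w ≠ 0)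
    (h : projector v = projector w) : ∃ c : ℂ, c • v = w := by
  refine ⟨(∑ j, star (v j) * w j) / ∑ k, v k * star (v k), funext fun i => ?_⟩
  have h1 : ∑ j, projector w i j * w j = w i := by
    have : ∑ j, projector w i j * w j = w i * (∑ k, w k * star (w k)) / ∑ k, w k * star (w k) := by
      rw [Finset.mul_sum, Finset.sum_div]
      exact Finset.sum_congr rfl fun j _ => by simp only [projector]; ring
    rw [this, mul_div_cancel_right₀ _ (sum_mul_star_ne_zero hw)]
  rw [← h1, ← h, Pi.smul_apply, smul_eq_mul, Finset.sum_div, Finset.sum_mul]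
  exact Finset.sum_congr rfl fun j _ => by simp only [projector]; ring

/-- The orthogonal projector is a continuous invariant that determines the line, with values in a
Hausdorff space of matrices. -/
theorem t2 : @T2Space (ℙ ℂ (Fin 3 → ℂ)) atlas.top := by
  refine atlas.t2Space_of_map (fun x => projector x.rep) ?_ ?_
  · intro i
    have h : Continuous fun z => projector (homog i z) := by
      have hh := (contDiff_homog i).continuous
      refine continuous_pi fun a => continuous_pi fun b => ?_
      refine Continuous.div ?_ ?_ fun z => sum_mul_star_ne_zero (homog_ne_zero i z)
      · exact ((continuous_apply a).comp hh).mul (((continuous_apply b).comp hh).star)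
      · exact continuous_finsetSum _ fun k _ =>
          ((continuous_apply k).comp hh).mul (((continuous_apply k).comp hh).star)
    refine h.continuousOn.congr fun z _ => ?_
    obtain ⟨c, hc, h⟩ := exists_rep_mk (homog i z) (homog_ne_zero i z)
    change projector (Projectivization.mk ℂ (homog i z) (homog_ne_zero i z)).rep = _
    rw [h, projector_smul hc]
  · intro x y hxy
    obtain ⟨c, hc⟩ := exists_smul_of_projector_eq y.rep_nonzero hxy
    obtain rfl : x = y := by
      rw [← x.mk_rep, ← y.mk_rep, Eq.comm, Projectivization.mk_eq_mk_iff']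
      exact ⟨c, hc⟩
    obtain ⟨i, hi⟩ := atlas.cover x
    exact ⟨i, hi, hi⟩

/-- The projective plane. -/
def surface : Surface := atlas.toManifold t2

/-- The standard charts. -/
def std (i : Fin 3) : OpenPartialHomeomorph surface (ℂ × ℂ) := atlas.chart t2 i

theorem isHolChart_std (i : Fin 3) : IsHolChart surface (std i) := atlas.isHolChart t2 i

theorem std_target (i : Fin 3) : (std i).target = univ := rfl

theorem mk_mem_std_source {i : Fin 3} {v : Fin 3 → ℂ} (hv : v ≠ 0) :
    (Projectivization.mk ℂ v hv : surface) ∈ (std i).source ↔ v i ≠ 0 := mk_mem_source hv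

theorem std_mk (i : Fin 3) {v : Fin 3 → ℂ} (hv : v ≠ 0) :
    std i (Projectivization.mk ℂ v hv : surface) = dehom i v := chart_mk i hv

theorem isProjectivePlane : IsProjectivePlane surface (Equiv.refl (ℙ ℂ (Fin 3 → ℂ))) := fun i =>
  ⟨std i, isHolChart_std i, rfl, fun _ => rfl⟩

/-- Dividing by the homogeneous coordinate of largest modulus places a point in the closed unit
bidisc of one of the three charts. -/
instance : CompactSpace surface := by
  have h : IsCompact (⋃ i, (std i).symm '' Metric.closedBall 0 1) :=
    isCompact_iUnion fun i => (isCompact_closedBall _ _).image_of_continuousOn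
      ((std i).continuousOn_symm.mono (subset_univ _))
  refine ⟨h.of_isClosed_subset isClosed_univ fun x _ => ?_⟩
  obtain ⟨v, hv, rfl⟩ : ∃ (v : Fin 3 → ℂ) (hv : v ≠ 0), Projectivization.mk ℂ v hv = x :=
    ⟨_, Projectivization.rep_nonzero x, Projectivization.mk_rep x⟩
  obtain ⟨i, hi⟩ := Finite.exists_max fun i => ‖v i‖
  have hvi : v i ≠ 0 := by
    intro h0
    refine hv (funext fun j => ?_)
    have := hi j
    simpa [h0] using this
  have hle : ∀ j, ‖v j / v i‖ ≤ 1 := fun j => by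
    rw [norm_div]
    exact div_le_one_of_le₀ (hi j) (norm_nonneg _)
  have hs := (mk_mem_std_source hv).2 hvi
  refine mem_iUnion.2 ⟨i, _, ?_, (std i).left_inv hs⟩
  rw [std_mk, mem_closedBall_zero_iff, Prod.norm_def]
  fin_cases i <;> exact max_le (hle _) (hle _)

/-- The line at infinity. -/
def lineAtInfinity : Set surface := {x | Projectivization.rep x 0 = 0}

theorem mk_mem_lineAtInfinity {v : Fin 3 → ℂ} (hv : v ≠ 0) :
    (Projectivization.mk ℂ v hv : surface) ∈ lineAtInfinity ↔ v 0 = 0 := by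
  have := (mk_mem_std_source (i := 0) hv).not
  exact not_not.symm.trans (this.trans not_not)

theorem lineAtInfinity_eq : lineAtInfinity = (std 0).sourceᶜ := by
  ext x
  exact not_not.symm

theorem isClosed_lineAtInfinity : IsClosed lineAtInfinity := by
  rw [lineAtInfinity_eq]
  exact (std 0).open_source.isClosed_compl

theorem std_symm_mem_lineAtInfinity (i : Fin 3) (z : ℂ × ℂ) :
    (std i).symm z ∈ lineAtInfinity ↔ homog i z 0 = 0 :=
  mk_mem_lineAtInfinity _

/-- With u = y/x the normal coordinates are 1/x and 1/y = (1/x) u⁻¹, which gives the degree 1. -/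
theorem isSmoothRationalCurve_lineAtInfinity :
    IsSmoothRationalCurve surface lineAtInfinity 1 := by
  have h1 : ∀ x ∈ (swapChart (std 1)).source, x ∈ lineAtInfinity ↔ (swapChart (std 1) x).2 = 0 := by
    intro x hx
    rw [← (std 1).left_inv hx, std_symm_mem_lineAtInfinity]
    rw [(std 1).left_inv hx]
    rfl
  have h2 : ∀ x ∈ (std 2).source, x ∈ lineAtInfinity ↔ (std 2 x).2 = 0 := by
    intro x hx
    rw [← (std 2).left_inv hx, std_symm_mem_lineAtInfinity]
    rw [(std 2).left_inv hx]
    rfl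
  have key : ∀ z : ℂ × ℂ, ((std 1).symm z ∈ (std 2).source ↔ z.2 ≠ 0) ∧
      std 2 ((std 1).symm z) = (1 / z.2, z.1 / z.2) := fun z =>
    ⟨mk_mem_std_source (homog_ne_zero 1 z), std_mk 2 (homog_ne_zero 1 z)⟩
  refine ⟨swapChart (std 1), std 2, (isHolChart_std 1).swap, isHolChart_std 2, ?_,
    image_eq_of_adapted h1 fun u => mem_univ _, image_eq_of_adapted h2 fun u => mem_univ _, ?_, ?_⟩
  · intro x hx
    by_contra h
    simp only [mem_union, not_or] at h
    refine Projectivization.rep_nonzero x (funext fun i => ?_)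
    fin_cases i
    · exact hx
    · exact not_not.1 h.1
    · exact not_not.1 h.2
  · rintro x ⟨-, hx⟩
    have := (key (std 1 x)).1
    rwa [(std 1).left_inv hx] at this
  · rintro x ⟨⟨-, hx⟩, hx'⟩
    obtain ⟨h3, h4⟩ := key (std 1 x)
    rw [(std 1).left_inv hx] at h3 h4
    set u := (std 1 x).2 with hu
    have hu0 : u ≠ 0 := h3.1 hx'
    constructor
    · rw [h4]
      exact one_div u
    · change HasDerivAt (fun v : ℂ => (std 2 ((std 1).symm (v, u))).2) (u ^ (-1 : ℤ)) 0
      have : (fun v : ℂ => (std 2 ((std 1).symm (v, u))).2) = fun v => v / u := by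
        funext v
        rw [(key (v, u)).2]
      rw [this]
      simpa [div_eq_mul_inv] using (hasDerivAt_id (0 : ℂ)).div_const u

end Plane

/-! ### Chains of blowing-ups along three arcs -/

namespace BlowUp

variable {X : Surface} {p : X} {χ : OpenPartialHomeomorph X (ℂ × ℂ)}

theorem swapChart_swapChart (χ : OpenPartialHomeomorph X (ℂ × ℂ)) :
    swapChart (swapChart χ) = χ :=
  OpenPartialHomeomorph.ext _ _ (fun _ => rfl) (fun _ => rfl) rfl

theorem mem_slope_of_mem_swap (hχ : IsHolChart X χ) (hp : p ∈ χ.source) {y : blowUp X p}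
    (hy : y ∈ (slope (swapChart χ) hχ.swap (mem_swap hp)).source)
    (h0 : (slope (swapChart χ) hχ.swap (mem_swap hp) y).2 ≠ 0) : y ∈ (slope χ hχ hp).source := by
  have h := (mem_slope_swap_iff hχ.swap (mem_swap hp) hy).2 h0
  have key : ∀ (χ' : OpenPartialHomeomorph X (ℂ × ℂ)) (_ : χ' = χ) (hχ' : IsHolChart X χ')
      (hp' : p ∈ χ'.source), y ∈ (slope χ' hχ' hp').source → y ∈ (slope χ hχ hp).source := by
    rintro _ rfl _ _ h
    exact h
  exact key _ (swapChart_swapChart χ) _ _ h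

/-- The slope chart omits one point of the exceptional curve, and the strict transform of C passes
through it. This allows one chart per branch to suffice, since the strict transform is to be removed
in the end. -/
theorem mem_slope_or_mem_strict (hχ : IsHolChart X χ) (hp : p ∈ χ.source) {C : Set X}
    (hC : ∀ x ∈ χ.source, x ∈ C ↔ (χ x).1 = (χ p).1) {y : blowUp X p} (hy : down p y ∈ χ.source) :
    y ∈ (slope χ hχ hp).source ∨ y ∈ strict p C := by
  rcases mem_slope_or hχ hp hy with h | h
  · exact .inl h
  · by_cases h0 : (slope (swapChart χ) hχ.swap (mem_swap hp) y).2 = 0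
    · exact .inr ((mem_strict_iff_snd hχ.swap (mem_swap hp) (fun x hx => hC x hx) h).2 h0)
    · exact .inl (mem_slope_of_mem_swap hχ hp h h0)

end BlowUp

open BlowUp

/-- A surface with a map of the affine plane into it. -/
structure Stage where
  X : Surface
  aff : ℂ × ℂ → X

/-- The blowing-up of a stage. -/
def Stage.blow (s : Stage) (p : s.X) : Stage := ⟨blowUp s.X p, fun z => up p (s.aff z)⟩

/-- The graph on the natural numbers in which `j ≠ 0` is joined to `par j`. -/
def parentAdj (par : ℕ → ℕ) (i j : ℕ) : Prop := (i ≠ 0 ∧ par i = j) ∨ (j ≠ 0 ∧ par j = i)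

/-- A configuration of smooth rational curves `D 0, …, D k` in a surface which contains the affine
plane, together with three charts `τ i` along their tips `D (t i)`, which are parametrized by
`(X, w) ↦ σ i (X, X ^ m i * w)`. -/
structure Configuration (σ : Fin 3 → ℂ × ℂ → ℂ × ℂ) (par : ℕ → ℕ) (s : Stage) (k : ℕ)
    (m t : Fin 3 → ℕ) (n : ℕ → ℤ) (D : ℕ → Set s.X)
    (A : OpenPartialHomeomorph s.X (ℂ × ℂ))
    (τ : Fin 3 → OpenPartialHomeomorph s.X (ℂ × ℂ)) : Prop where
  closed : ∀ j ≤ k, IsClosed (D j)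
  rational : ∀ j ≤ k, IsSmoothRationalCurve s.X (D j) (n j)
  meet : ∀ i ≤ k, ∀ j ≤ k, i ≠ j → parentAdj par i j →
    ∃ p, D i ∩ D j = {p} ∧ CrossNormallyAt s.X (D i) (D j) p
  disjoint : ∀ i ≤ k, ∀ j ≤ k, i ≠ j → ¬ parentAdj par i j → D i ∩ D j = ∅
  hol_aff : IsHolChart s.X A
  aff_target : A.target = univ
  aff_symm : ∀ z, A.symm z = s.aff z
  aff_notMem : ∀ j ≤ k, ∀ z, s.aff z ∉ D j
  hol : ∀ i, IsHolChart s.X (τ i)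
  mem_target : ∀ i (w : ℂ × ℂ), w.1 ≠ 0 → w ∈ (τ i).target
  zero_mem_target : ∀ i, (0, 0) ∈ (τ i).target
  symm_eq : ∀ i (w : ℂ × ℂ), w.1 ≠ 0 → (τ i).symm w = s.aff (σ i (w.1, w.1 ^ m i * w.2))
  -- A branch that has not been started keeps only a small disc of the line w.1 = 0, so that the
  -- three charts do not meet there. The first blowing-up on the branch makes the target the whole
  -- plane.
  target_eq : ∀ i, m i ≠ 0 → (τ i).target = univ
  tip_le : ∀ i, t i ≤ k
  tip : ∀ i, ∀ x ∈ (τ i).source, x ∈ D (t i) ↔ (τ i x).1 = 0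
  notMem : ∀ i, ∀ j ≤ k, j ≠ t i → ∀ x ∈ (τ i).source, x ∉ D j
  -- Two branches share their last curve only while both still end at the line at infinity.
  tip_inj : ∀ i j, i ≠ j → t i = t j → t i = 0
  tip_zero : ∀ i, m i = 0 → t i = 0
  inter : ∀ i j, i ≠ j → (τ i).source ∩ (τ j).source ⊆ range s.aff
  -- Only charts of started branches count here, so the line at infinity is admitted among the
  -- remaining curves even while it is still a tip.
  cover : ∀ x, x ∈ range s.aff ∨ (∃ i, m i ≠ 0 ∧ x ∈ (τ i).source) ∨
    ∃ j ≤ k, (j = 0 ∨ ∀ i, t i ≠ j) ∧ x ∈ D j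

namespace Configuration

variable {σ : Fin 3 → ℂ × ℂ → ℂ × ℂ} {par : ℕ → ℕ} {s : Stage} {k : ℕ} {m t : Fin 3 → ℕ}
  {n : ℕ → ℤ} {D : ℕ → Set s.X} {A : OpenPartialHomeomorph s.X (ℂ × ℂ)}
  {τ : Fin 3 → OpenPartialHomeomorph s.X (ℂ × ℂ)}

/-- The curves after blowing up. -/
def blowCurves (D : ℕ → Set s.X) (k c : ℕ) (p : s.X) (j : ℕ) : Set (blowUp s.X p) :=
  if j = k + 1 then down p ⁻¹' {p} else if j = c then strict p (D c) else down p ⁻¹' D j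

/-- In the chart along the tip the arc is the graph w = g(u) with g(u) → 0, so it runs into the
origin. -/
theorem tendsto_center (h : Configuration σ par s k m t n D A τ) (i : Fin 3) {γ : ℂ → ℂ × ℂ}
    {g : ℂ → ℂ} (hg : Tendsto g (𝓝[≠] 0) (𝓝 0))
    (hγ : ∀ u, u ≠ 0 → γ u = σ i (u, u ^ m i * g u)) :
    Tendsto (fun u => s.aff (γ u)) (𝓝[≠] 0) (𝓝 ((τ i).symm (0, 0))) := by
  have h1 : Tendsto (fun u : ℂ => (u, g u)) (𝓝[≠] 0) (𝓝 (0, 0)) :=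
    (tendsto_id.mono_left nhdsWithin_le_nhds).prodMk_nhds hg
  refine (((τ i).continuousAt_symm (h.zero_mem_target i)).tendsto.comp h1).congr' ?_
  filter_upwards [eventually_mem_nhdsWithin] with u hu
  rw [hγ u hu]
  exact h.symm_eq i (u, g u) hu

/-- The configuration after blowing up the origin of one of the charts along the tips. -/
theorem exists_blow (h : Configuration σ par s k m t n D A τ) (i₀ : Fin 3)
    (hpar : ∀ j, j ≠ 0 → par j < j) (hk : par (k + 1) = t i₀) :
    ∃ D' A' τ', Configuration σ par (s.blow ((τ i₀).symm (0, 0))) (k + 1)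
      (Function.update m i₀ (m i₀ + 1)) (Function.update t i₀ (k + 1))
      (Function.update (Function.update n (t i₀) (n (t i₀) - 1)) (k + 1) (-1)) D' A' τ' := by
  set p := (τ i₀).symm (0, 0) with hp
  have hpτ : p ∈ (τ i₀).source := (τ i₀).map_target (h.zero_mem_target i₀)
  have hτp : τ i₀ p = (0, 0) := (τ i₀).right_inv (h.zero_mem_target i₀)
  have hpD : p ∈ D (t i₀) := (h.tip i₀ p hpτ).2 (by rw [hτp])
  -- The centre lies on the tip alone; every other curve is transported unchanged.
  have hpD' : ∀ j ≤ k, j ≠ t i₀ → p ∉ D j := fun j hj hne => h.notMem i₀ j hj hne p hpτ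
  have hpaff : p ∉ range s.aff := by
    rintro ⟨z, hz⟩
    exact h.aff_notMem _ (h.tip_le i₀) z (hz ▸ hpD)
  have haff : ∀ z, s.aff z ≠ p := fun z hz => hpaff ⟨z, hz⟩
  have hpA : p ∉ A.source := by
    intro hA
    exact haff (A p) (by rw [← h.aff_symm, A.left_inv hA])
  have hpτ' : ∀ i, i ≠ i₀ → p ∉ (τ i).source := fun i hi hpi => hpaff (h.inter i i₀ hi ⟨hpi, hpτ⟩)
  have htip : ∀ x ∈ (τ i₀).source, x ∈ D (t i₀) ↔ (τ i₀ x).1 = (τ i₀ p).1 := by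
    intro x hx
    rw [h.tip i₀ x hx, hτp]
  set D' := blowCurves D k (t i₀) p with hD'
  have hDnew : D' (k + 1) = down p ⁻¹' {p} := if_pos rfl
  have hDtip : D' (t i₀) = strict p (D (t i₀)) := by
    have := h.tip_le i₀
    rw [hD', blowCurves, if_neg (by omega), if_pos rfl]
  have hDold : ∀ j ≤ k, j ≠ t i₀ → D' j = down p ⁻¹' D j := by
    intro j hj hne
    rw [hD', blowCurves, if_neg (by omega), if_neg hne]
  have hsub : ∀ j ≤ k, D' j ⊆ down p ⁻¹' D j := by
    intro j hj
    by_cases hjt : j = t i₀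
    · subst hjt
      rw [hDtip]
      exact strict_subset (h.closed _ hj)
    · rw [hDold j hj hjt]
  have hmem : ∀ j ≤ k, ∀ y, down p y ≠ p → (y ∈ D' j ↔ down p y ∈ D j) := by
    intro j hj y hy
    by_cases hjt : j = t i₀
    · subst hjt
      rw [hDtip]
      exact mem_strict_iff (h.closed _ hj) hy
    · rw [hDold j hj hjt]
      rfl
  classical
  let τ' : Fin 3 → OpenPartialHomeomorph (blowUp s.X p) (ℂ × ℂ) := fun i =>
    if hi : i = i₀ then slope (τ i₀) (h.hol i₀) hpτ else lift (τ i) (h.hol i) (hpτ' i hi)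
  have hτ₀ : τ' i₀ = slope (τ i₀) (h.hol i₀) hpτ := dif_pos rfl
  have hτ₁ : ∀ i (hi : i ≠ i₀), τ' i = lift (τ i) (h.hol i) (hpτ' i hi) := fun i hi => dif_neg hi
  have hsrc : ∀ i (hi : i ≠ i₀), ∀ y ∈ (τ' i).source, down p y ∈ (τ i).source ∧ down p y ≠ p := by
    intro i hi y hy
    rw [hτ₁ i hi] at hy
    exact ⟨hy, fun hyp => hpτ' i hi (hyp ▸ hy)⟩
  have hsrc₀ : ∀ i, ∀ y ∈ (τ' i).source, down p y ∈ (τ i).source := by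
    intro i y hy
    by_cases hi : i = i₀
    · subst hi
      rw [hτ₀] at hy
      exact down_mem_source _ _ hy
    · exact (hsrc i hi y hy).1
  have hbl : ∀ w : ℂ × ℂ, τ i₀ p + blowDown w = blowDown w := fun w => by
    rw [hτp]; exact zero_add _
  -- The map (a, b) ↦ (a, a b) sends the line a = 0 to the origin and keeps a ≠ 0 elsewhere, so it
  -- never reaches the part of the plane missing from the old target.
  have htarget₀ : (τ' i₀).target = univ := by
    rw [hτ₀, slope_target]
    ext w
    change τ i₀ p + blowDown w ∈ (τ i₀).target ↔ w ∈ univ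
    rw [hbl]
    simp only [mem_univ, iff_true]
    by_cases hw : w.1 = 0
    · have : blowDown w = (0, 0) := by simp [blowDown, hw]
      rw [this]
      exact h.zero_mem_target i₀
    · exact h.mem_target i₀ _ hw
  refine ⟨D', lift A h.hol_aff hpA, τ', ?_⟩
  constructor
  case closed =>
    intro j hj
    rcases Nat.le_succ_iff.1 hj with hj | rfl
    · by_cases hjt : j = t i₀
      · subst hjt
        rw [hDtip]
        exact isClosed_strict _
      · rw [hDold j hj hjt]
        exact (h.closed j hj).preimage continuous_down
    · rw [Nat.succ_eq_add_one, hDnew]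
      exact isClosed_singleton.preimage continuous_down
  case rational =>
    intro j hj
    rcases Nat.le_succ_iff.1 hj with hj | rfl
    · rw [Function.update_of_ne (by omega)]
      by_cases hjt : j = t i₀
      · subst hjt
        rw [hDtip, Function.update_self]
        exact isSmoothRationalCurve_strict (h.rational _ hj) (h.closed _ hj) hpD
      · rw [hDold j hj hjt, Function.update_of_ne hjt]
        exact isSmoothRationalCurve_preimage (h.rational j hj) (hpD' j hj hjt)
    · rw [Nat.succ_eq_add_one, hDnew, Function.update_self]
      exact isSmoothRationalCurve_exceptional
  case meet =>
    have hnew : ∀ j ≤ k, parentAdj par (k + 1) j →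
        ∃ q, D' j ∩ D' (k + 1) = {q} ∧
          CrossNormallyAt (blowUp s.X p) (D' j) (D' (k + 1)) q := by
      intro j hj hadj
      have hjt : j = t i₀ := by
        rcases hadj with ⟨-, h1⟩ | ⟨h0, h1⟩
        · rw [← h1, hk]
        · have := hpar j h0
          omega
      subst hjt
      rw [hDtip, hDnew]
      exact crossNormally_strict_exceptional (h.hol i₀) hpτ htip
    intro i hi j hj hij hadj
    rcases Nat.le_succ_iff.1 hi with hi | rfl <;> rcases Nat.le_succ_iff.1 hj with hj | rfl
    · obtain ⟨q, hq, hcross⟩ := h.meet i hi j hj hij hadj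
      -- An old crossing lies on two curves, the centre on only one.
      have hqp : q ≠ p := by
        intro hqp
        have hqm : p ∈ D i ∩ D j := by rw [hq]; exact hqp.symm
        by_cases hit : i = t i₀
        · exact hpD' j hj (fun hjt => hij (hit.trans hjt.symm)) hqm.2
        · exact hpD' i hi hit hqm.1
      refine ⟨up p q, ?_, crossNormallyAt_up hqp (hmem i hi) (hmem j hj) hcross⟩
      ext y
      constructor
      · rintro ⟨h1, h2⟩
        have h3 : down p y ∈ D i ∩ D j := ⟨hsub i hi h1, hsub j hj h2⟩
        rw [hq] at h3
        have h4 : down p y = q := h3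
        exact (up_down (h4.trans_ne hqp)).symm.trans (congrArg (up p) h4)
      · rintro rfl
        have h3 : down p (up p q) = q := down_up hqp
        have hqm : q ∈ D i ∩ D j := by rw [hq]; rfl
        exact ⟨(hmem i hi _ (by rwa [h3])).2 (by rw [h3]; exact hqm.1),
          (hmem j hj _ (by rwa [h3])).2 (by rw [h3]; exact hqm.2)⟩
    · exact hnew i hi (hadj.symm)
    · obtain ⟨q, hq, hc⟩ := hnew j hj hadj
      exact ⟨q, (inter_comm _ _).trans hq, hc.symm⟩
    · exact (hij rfl).elim
  case disjoint =>
    have hnew : ∀ j ≤ k, ¬ parentAdj par (k + 1) j → D' j ∩ D' (k + 1) = ∅ := by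
      intro j hj hadj
      have hjt : j ≠ t i₀ := fun hjt => hadj (.inl ⟨by omega, hk.trans hjt.symm⟩)
      rw [hDold j hj hjt, hDnew]
      refine eq_empty_of_forall_notMem ?_
      rintro y ⟨h1, h2⟩
      exact hpD' j hj hjt ((show down p y = p from h2) ▸ h1)
    intro i hi j hj hij hadj
    rcases Nat.le_succ_iff.1 hi with hi | rfl <;> rcases Nat.le_succ_iff.1 hj with hj | rfl
    · refine eq_empty_of_forall_notMem ?_
      rintro y ⟨h1, h2⟩
      have h3 : down p y ∈ D i ∩ D j := ⟨hsub i hi h1, hsub j hj h2⟩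
      rw [h.disjoint i hi j hj hij hadj] at h3
      exact h3
    · exact hnew i hi fun h' => hadj h'.symm
    · exact (inter_comm _ _).trans (hnew j hj hadj)
    · exact (hij rfl).elim
  case hol_aff => exact isHolChart_lift _ _
  case aff_target => exact h.aff_target
  case aff_symm =>
    intro z
    exact congrArg (up p) (h.aff_symm z)
  case aff_notMem =>
    intro j hj z hz
    have h1 : down p (up p (s.aff z)) = s.aff z := down_up (haff z)
    change up p (s.aff z) ∈ D' j at hz
    rcases Nat.le_succ_iff.1 hj with hj | rfl
    · have h2 := hsub j hj hz
      rw [mem_preimage, h1] at h2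
      exact h.aff_notMem j hj z h2
    · rw [Nat.succ_eq_add_one, hDnew, mem_preimage, h1] at hz
      exact haff z hz
  case hol =>
    intro i
    by_cases hi : i = i₀
    · subst hi
      rw [hτ₀]
      exact isHolChart_slope _ _
    · rw [hτ₁ i hi]
      exact isHolChart_lift _ _
  case mem_target =>
    intro i w hw
    by_cases hi : i = i₀
    · subst hi
      rw [htarget₀]
      trivial
    · rw [hτ₁ i hi]
      exact h.mem_target i w hw
  case zero_mem_target =>
    intro i
    by_cases hi : i = i₀
    · subst hi
      rw [htarget₀]
      trivial
    · rw [hτ₁ i hi]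
      exact h.zero_mem_target i
  case symm_eq =>
    intro i w hw
    by_cases hi : i = i₀
    · subst hi
      rw [hτ₀, Function.update_self]
      have h1 := down_slope_symm (h.hol i) hpτ w
      rw [hbl, h.symm_eq i (blowDown w) hw] at h1
      refine (up_down (h1.trans_ne (haff _))).symm.trans (congrArg (up p) (h1.trans ?_))
      -- Here a^m (a b) = a^(m+1) b: each blowing-up raises the exponent by one.
      rw [pow_succ, mul_assoc]
      rfl
    · rw [hτ₁ i hi, Function.update_of_ne hi]
      exact congrArg (up p) (h.symm_eq i w hw)
  case target_eq =>
    intro i hmi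
    by_cases hi : i = i₀
    · subst hi
      exact htarget₀
    · rw [Function.update_of_ne hi] at hmi
      rw [hτ₁ i hi]
      exact h.target_eq i hmi
  case tip_le =>
    intro i
    by_cases hi : i = i₀
    · subst hi
      rw [Function.update_self]
    · rw [Function.update_of_ne hi]
      exact (h.tip_le i).trans (Nat.le_succ k)
  case tip =>
    intro i y hy
    by_cases hi : i = i₀
    · subst hi
      rw [Function.update_self, hDnew, hτ₀]
      rw [hτ₀] at hy
      exact down_eq_iff _ _ hy
    · rw [Function.update_of_ne hi, hτ₁ i hi]
      exact (hmem _ (h.tip_le i) y (hsrc i hi y hy).2).trans (h.tip i _ (hsrc i hi y hy).1)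
  case notMem =>
    intro i j hj hjt y hy hyD
    by_cases hi : i = i₀
    · subst hi
      rw [Function.update_self] at hjt
      have hj' : j ≤ k := by omega
      by_cases hjt' : j = t i
      · subst hjt'
        rw [hDtip] at hyD
        rw [hτ₀] at hy
        exact notMem_strict_of_fst (h.hol i) hpτ htip hy hyD
      · exact h.notMem i j hj' hjt' _ (hsrc₀ i y hy) (hsub j hj' hyD)
    · rw [Function.update_of_ne hi] at hjt
      obtain ⟨h1, h2⟩ := hsrc i hi y hy
      rcases Nat.le_succ_iff.1 hj with hj | rfl
      · exact h.notMem i j hj hjt _ h1 (hsub j hj hyD)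
      · rw [Nat.succ_eq_add_one, hDnew] at hyD
        exact h2 hyD
  case tip_inj =>
    intro i j hij hij'
    by_cases hi : i = i₀
    · subst hi
      rw [Function.update_self, Function.update_of_ne hij.symm] at hij'
      have := h.tip_le j
      omega
    · rw [Function.update_of_ne hi] at hij' ⊢
      by_cases hj : j = i₀
      · subst hj
        rw [Function.update_self] at hij'
        have := h.tip_le i
        omega
      · rw [Function.update_of_ne hj] at hij'
        exact h.tip_inj i j hij hij'
  case tip_zero =>
    intro i hmi
    by_cases hi : i = i₀
    · subst hi
      rw [Function.update_self] at hmi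
      omega
    · rw [Function.update_of_ne hi] at hmi ⊢
      exact h.tip_zero i hmi
  case inter =>
    rintro i j hij y ⟨hyi, hyj⟩
    obtain ⟨z, hz⟩ := h.inter i j hij ⟨hsrc₀ i y hyi, hsrc₀ j y hyj⟩
    refine ⟨z, ?_⟩
    change up p (s.aff z) = y
    rw [hz]
    exact up_down (by rw [← hz]; exact haff z)
  case cover =>
    intro y
    by_cases hy : down p y = p
    -- The new tip chart covers the new curve except for its crossing with the strict transform of
    -- the old tip. That strict transform is from now on one of the remaining curves.
    · rcases mem_slope_or_mem_strict (y := y) (h.hol i₀) hpτ htip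
        (by rw [hy]; exact hpτ) with h1 | h1
      · refine .inr (.inl ⟨i₀, ?_, by rw [hτ₀]; exact h1⟩)
        rw [Function.update_self]
        omega
      · refine .inr (.inr ⟨t i₀, (h.tip_le i₀).trans (Nat.le_succ k), ?_, by rw [hDtip]; exact h1⟩)
        by_cases h0 : t i₀ = 0
        · exact .inl h0
        · refine .inr fun i => ?_
          by_cases hi : i = i₀
          · subst hi
            rw [Function.update_self]
            have := h.tip_le i
            omega
          · rw [Function.update_of_ne hi]
            exact fun h2 => h0 (h.tip_inj i₀ i (Ne.symm hi) h2.symm)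
    · rcases h.cover (down p y) with ⟨z, hz⟩ | ⟨i, hmi, hi⟩ | ⟨j, hj, hjt, hjD⟩
      · refine .inl ⟨z, ?_⟩
        change up p (s.aff z) = y
        rw [hz]
        exact up_down hy
      · by_cases hii : i = i₀
        · subst hii
          by_cases h0 : (τ i (down p y)).1 = 0
          · have hyD := (h.tip i _ hi).2 h0
            refine .inr (.inr ⟨t i, (h.tip_le i).trans (Nat.le_succ k), ?_,
              (hmem _ (h.tip_le i) y hy).2 hyD⟩)
            by_cases h0 : t i = 0
            · exact .inl h0
            · refine .inr fun i' => ?_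
              by_cases hi' : i' = i
              · subst hi'
                rw [Function.update_self]
                have := h.tip_le i'
                omega
              · rw [Function.update_of_ne hi']
                exact fun h2 => h0 (h.tip_inj i i' (Ne.symm hi') h2.symm)
          · refine .inr (.inl ⟨i, by rw [Function.update_self]; omega, ?_⟩)
            rw [hτ₀]
            refine (mem_slope_source_iff _ _ hy).2 ⟨hi, ?_⟩
            rwa [hτp]
        · refine .inr (.inl ⟨i, by rwa [Function.update_of_ne hii], ?_⟩)
          rw [hτ₁ i hii]
          exact hi
      · refine .inr (.inr ⟨j, hj.trans (Nat.le_succ k), ?_, (hmem j hj y hy).2 hjD⟩)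
        refine hjt.imp_right fun h1 i => ?_
        by_cases hi : i = i₀
        · subst hi
          rw [Function.update_self]
          omega
        · rw [Function.update_of_ne hi]
          exact h1 i

end Configuration

/-! ### Sheared coordinates at the three points at infinity -/

namespace Plane

/-- Coordinates near three points of the line at infinity, in which this line is given by the
vanishing of the first coordinate. -/
def cornerChart : Fin 3 → OpenPartialHomeomorph surface (ℂ × ℂ) :=
  ![std 1, std 1, swapChart (std 2)]

/-- Homogeneous coordinates in terms of the coordinates near the three points. -/
def cornerVec (i : Fin 3) (w : ℂ × ℂ) : Fin 3 → ℂ :=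
  match i with
  | 0 => ![w.1, 1, w.2]
  | 1 => ![w.1, 1, w.2]
  | 2 => ![w.1, w.2, 1]

theorem cornerVec_ne_zero (i : Fin 3) (w : ℂ × ℂ) : cornerVec i w ≠ 0 := by
  intro h
  fin_cases i
  · simpa [cornerVec] using congrFun h 1
  · simpa [cornerVec] using congrFun h 1
  · simpa [cornerVec] using congrFun h 2

theorem cornerChart_symm (i : Fin 3) (w : ℂ × ℂ) : (cornerChart i).symm w =
    Projectivization.mk ℂ (cornerVec i w) (cornerVec_ne_zero i w) := by
  fin_cases i <;> rfl

theorem cornerChart_target (i : Fin 3) : (cornerChart i).target = univ := by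
  fin_cases i <;> rfl

theorem isHolChart_cornerChart (i : Fin 3) : IsHolChart surface (cornerChart i) := by
  fin_cases i
  · exact isHolChart_std 1
  · exact isHolChart_std 1
  · exact (isHolChart_std 2).swap

/-- The affine coordinates `(x, y)` in terms of the coordinates near the three points. -/
def cornerMap (i : Fin 3) (w : ℂ × ℂ) : ℂ × ℂ :=
  match i with
  | 0 => (1 / w.1, w.2 / w.1)
  | 1 => (1 / w.1, w.2 / w.1)
  | 2 => (w.2 / w.1, 1 / w.1)

theorem dehom_cornerVec (i : Fin 3) (w : ℂ × ℂ) : dehom 0 (cornerVec i w) = cornerMap i w := by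
  fin_cases i <;> rfl

theorem cornerVec_zero (i : Fin 3) (w : ℂ × ℂ) : cornerVec i w 0 = w.1 := by
  fin_cases i <;> rfl

theorem cornerChart_symm_eq (i : Fin 3) {w : ℂ × ℂ} (hw : w.1 ≠ 0) :
    (cornerChart i).symm w = (std 0).symm (cornerMap i w) := by
  rw [cornerChart_symm, ← dehom_cornerVec]
  have h : (Projectivization.mk ℂ (cornerVec i w) (cornerVec_ne_zero i w) : surface) ∈
      (std 0).source := (mk_mem_std_source _).2 (by rwa [cornerVec_zero])
  rw [← (std 0).left_inv h, std_mk]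

theorem cornerChart_symm_mem (i : Fin 3) (w : ℂ × ℂ) :
    (cornerChart i).symm w ∈ lineAtInfinity ↔ w.1 = 0 := by
  rw [cornerChart_symm]
  exact (mk_mem_lineAtInfinity _).trans (by rw [cornerVec_zero])

/-- The shear `(a, b) ↦ (a, b + P a)`. -/
def shear (P : ℂ → ℂ) (hP : ContDiff ℂ ω P) : (ℂ × ℂ) ≃ₜ (ℂ × ℂ) where
  toFun w := (w.1, w.2 + P w.1)
  invFun w := (w.1, w.2 - P w.1)
  left_inv w := by simp
  right_inv w := by simp
  continuous_toFun :=
    continuous_fst.prodMk (continuous_snd.add (hP.continuous.comp continuous_fst))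
  continuous_invFun :=
    continuous_fst.prodMk (continuous_snd.sub (hP.continuous.comp continuous_fst))

/-- A part of the plane which contains the origin, and of the line `a = 0` only a small disk. -/
def tipDomain : Set (ℂ × ℂ) := {w | w.1 ≠ 0} ∪ {w | ‖w.2‖ < 1 / 2}

theorem isOpen_tipDomain : IsOpen tipDomain :=
  (isOpen_ne_fun continuous_fst continuous_const).union
    (isOpen_lt continuous_snd.norm continuous_const)

variable (P : Fin 3 → ℂ → ℂ) (hP : ∀ i, ContDiff ℂ ω (P i))

/-- Sheared coordinates near the three points. -/
def tipChart (i : Fin 3) : OpenPartialHomeomorph surface (ℂ × ℂ) :=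
  ((cornerChart i).transHomeomorph (shear (P i) (hP i))).trans
    (OpenPartialHomeomorph.ofSet tipDomain isOpen_tipDomain)

/-- The affine coordinates in terms of the sheared coordinates. -/
def tipMap (i : Fin 3) (w : ℂ × ℂ) : ℂ × ℂ := cornerMap i (w.1, w.2 - P i w.1)

theorem tipChart_target (i : Fin 3) : (tipChart P hP i).target = tipDomain := by
  ext w
  simp [tipChart, cornerChart_target]

theorem tipChart_symm (i : Fin 3) (w : ℂ × ℂ) :
    (tipChart P hP i).symm w = (cornerChart i).symm (w.1, w.2 - P i w.1) := rfl

theorem isHolChart_tipChart (i : Fin 3) : IsHolChart surface (tipChart P hP i) := by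
  refine IsHolChart.trans ((isHolChart_cornerChart i).transHomeomorph ?_ ?_) contDiffOn_id
    contDiffOn_id
  · exact contDiff_fst.prodMk (contDiff_snd.add ((hP i).comp contDiff_fst))
  · exact contDiff_fst.prodMk (contDiff_snd.sub ((hP i).comp contDiff_fst))

theorem tipChart_mem_lineAtInfinity (i : Fin 3) {x : surface} (hx : x ∈ (tipChart P hP i).source) :
    x ∈ lineAtInfinity ↔ (tipChart P hP i x).1 = 0 := by
  conv_lhs => rw [← (tipChart P hP i).left_inv hx, tipChart_symm, cornerChart_symm_mem]

theorem exists_of_mem_tipChart (i : Fin 3) {x : surface} (hx : x ∈ (tipChart P hP i).source)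
    (hx' : x ∈ lineAtInfinity) : ∃ b : ℂ, ‖b‖ < 1 / 2 ∧
      x = Projectivization.mk ℂ (cornerVec i (0, b - P i 0)) (cornerVec_ne_zero i _) := by
  have h0 := (tipChart_mem_lineAtInfinity P hP i hx).1 hx'
  have ht := (tipChart P hP i).map_source hx
  rw [tipChart_target] at ht
  refine ⟨_, ht.resolve_left (not_not.2 h0), ?_⟩
  rw [← cornerChart_symm]
  conv_lhs => rw [← (tipChart P hP i).left_inv hx, tipChart_symm, h0]

/-- On the line at infinity the three charts are the discs of radius 1/2 around y/x = -1, y/x = 1/2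
and x/y = 0. The first two centres are 3/2 > 1 apart. The third disc is |y/x| > 2, whereas |y/x| is
below 3/2 and below 1 on the others. -/
theorem tipChart_inter (h0 : P 0 0 = 1) (h1 : P 1 0 = -1 / 2) (h2 : P 2 0 = 0) {i j : Fin 3}
    (hij : i < j) {x : surface} (hi : x ∈ (tipChart P hP i).source)
    (hj : x ∈ (tipChart P hP j).source) : x ∉ lineAtInfinity := by
  intro hx
  obtain ⟨b, hb, hbx⟩ := exists_of_mem_tipChart P hP i hi hx
  obtain ⟨c, hc, hcx⟩ := exists_of_mem_tipChart P hP j hj hx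
  rw [hbx] at hcx
  obtain ⟨a, ha⟩ := (Projectivization.mk_eq_mk_iff' ℂ _ _ _ _).1 hcx
  have ha1 := congrFun ha 1
  have ha2 := congrFun ha 2
  fin_cases i <;> fin_cases j <;> simp at hij
  · simp [cornerVec] at ha1 ha2
    subst ha1
    have h3 : 1 * (c - P 1 0) = b - P 0 0 := ha2
    rw [h0, h1] at h3
    have h4 := norm_sub_le b c
    rw [show b - c = 3 / 2 by linear_combination -h3] at h4
    norm_num at h4
    linarith
  · simp [cornerVec] at ha1 ha2
    subst ha2
    have h3 : (b - P 0 0) * (c - P 2 0) = 1 := ha1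
    rw [h0, h2] at h3
    have h4 := norm_sub_le (b * c) c
    rw [show b * c - c = 1 by linear_combination h3, norm_mul, norm_one] at h4
    nlinarith [norm_nonneg b, norm_nonneg c]
  · simp [cornerVec] at ha1 ha2
    subst ha2
    have h3 : (b - P 1 0) * (c - P 2 0) = 1 := ha1
    rw [h1, h2] at h3
    have h4 := norm_add_le (b * c) (c / 2)
    rw [show b * c + c / 2 = 1 by linear_combination h3, norm_mul, norm_div, norm_one] at h4
    norm_num at h4
    nlinarith [norm_nonneg b, norm_nonneg c]

/-- The projective plane with its affine part. -/
def stage : Stage := ⟨surface, (std 0).symm⟩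

theorem configuration (h0 : P 0 0 = 1) (h1 : P 1 0 = -1 / 2) (h2 : P 2 0 = 0) (par : ℕ → ℕ) :
    Configuration (tipMap P) par stage 0 (fun _ => 0) (fun _ => 0) (fun _ => 1)
      (fun _ => lineAtInfinity) (std 0) (tipChart P hP) := by
  have hmem : ∀ x : surface, x ∉ lineAtInfinity → x ∈ range (std 0).symm := by
    intro x hx
    rw [lineAtInfinity_eq, notMem_compl_iff] at hx
    exact ⟨_, (std 0).left_inv hx⟩
  constructor
  case closed => exact fun _ _ => isClosed_lineAtInfinity
  case rational => exact fun _ _ => isSmoothRationalCurve_lineAtInfinity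
  case meet =>
    intro i hi j hj hij
    omega
  case disjoint =>
    intro i hi j hj hij
    omega
  case hol_aff => exact isHolChart_std 0
  case aff_target => exact std_target 0
  case aff_symm => exact fun _ => rfl
  case aff_notMem =>
    intro j _ z hz
    have := (std_symm_mem_lineAtInfinity 0 z).1 hz
    simp [homog] at this
  case hol => exact isHolChart_tipChart P hP
  case mem_target =>
    intro i w hw
    rw [tipChart_target]
    exact .inl hw
  case zero_mem_target =>
    intro i
    rw [tipChart_target]
    right
    simp
  case symm_eq =>
    intro i w hw
    rw [pow_zero, one_mul]
    exact cornerChart_symm_eq i (w := (w.1, w.2 - P i w.1)) hw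
  case target_eq => exact fun _ h => (h rfl).elim
  case tip_le => exact fun _ => le_rfl
  case tip => exact fun i x hx => tipChart_mem_lineAtInfinity P hP i hx
  case notMem =>
    intro i j hj hne
    omega
  case tip_inj => exact fun _ _ _ _ => rfl
  case tip_zero => exact fun _ _ => rfl
  case inter =>
    rintro i j hij x ⟨hi, hj⟩
    refine hmem x ?_
    rcases lt_or_gt_of_ne hij with h | h
    · exact tipChart_inter P hP h0 h1 h2 h hi hj
    · exact tipChart_inter P hP h0 h1 h2 h hj hi
  case cover =>
    intro x
    by_cases hx : x ∈ lineAtInfinity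
    · exact .inr (.inr ⟨0, le_rfl, .inl rfl, hx⟩)
    · exact .inl (hmem x hx)

end Plane

section

/-! ### The tower of blowing-ups -/

instance (s : Stage) : Nonempty s.X := ⟨s.aff 0⟩

/-- The limit point of an arc. -/
def Stage.center (s : Stage) (γ : ℂ → ℂ × ℂ) : s.X := limUnder (𝓝[≠] 0) fun u => s.aff (γ u)

/-- The stages of the tower. -/
def stages (γ : ℕ → ℂ → ℂ × ℂ) : ℕ → Stage
  | 0 => Plane.stage
  | k + 1 => (stages γ k).blow ((stages γ k).center (γ k))

instance (γ : ℕ → ℂ → ℂ × ℂ) (k : ℕ) : CompactSpace (stages γ k).X := by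
  induction k with
  | zero => exact inferInstanceAs (CompactSpace Plane.surface)
  | succ k ih => exact BlowUp.compactSpace

/-- The arc along which the `k`-th blowing-up takes place. -/
def branch (k : ℕ) : Fin 3 := if k < 2 then 0 else if k < 6 then 1 else 2

/-- The numbers of blowing-ups along the three arcs. -/
def branchLength : ℕ → Fin 3 → ℕ
  | 0 => fun _ => 0
  | k + 1 => Function.update (branchLength k) (branch k) (branchLength k (branch k) + 1)

/-- The last curves along the three arcs. -/
def branchTip : ℕ → Fin 3 → ℕ
  | 0 => fun _ => 0
  | k + 1 => Function.update (branchTip k) (branch k) (k + 1)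

/-- The curve that contains the centre of the blowing-up that produces the `j`-th curve. -/
def branchParent (j : ℕ) : ℕ := branchTip (j - 1) (branch (j - 1))

/-- The self-intersection numbers of the curves. -/
def selfIntersection : ℕ → ℕ → ℤ
  | 0 => fun _ => 1
  | k + 1 => Function.update (Function.update (selfIntersection k) (branchTip k (branch k))
      (selfIntersection k (branchTip k (branch k)) - 1)) (k + 1) (-1)

theorem branchTip_le (k : ℕ) (i : Fin 3) : branchTip k i ≤ k := by
  induction k with
  | zero => exact le_rfl
  | succ k ih =>
    rw [branchTip, Function.update_apply]
    split_ifs <;> omega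

theorem branchParent_lt {j : ℕ} (hj : j ≠ 0) : branchParent j < j := by
  have := branchTip_le (j - 1) (branch (j - 1))
  unfold branchParent
  omega

variable {P : Fin 3 → ℂ → ℂ}

/-- By the condition on the arcs, the limit that defines each centre is the origin of the tip chart
of the current branch. So `Configuration.exists_blow` applies at every stage, starting from the line
at infinity as the common tip of the three branches. -/
theorem stages_configuration (hP : ∀ i, ContDiff ℂ ω (P i)) (h0 : P 0 0 = 1)
    (h1 : P 1 0 = -1 / 2) (h2 : P 2 0 = 0) {γ : ℕ → ℂ → ℂ × ℂ} {k : ℕ}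
    (hγ : ∀ l < k, ∃ g : ℂ → ℂ, Tendsto g (𝓝[≠] 0) (𝓝 0) ∧ ∀ u, u ≠ 0 →
      γ l u = Plane.tipMap P (branch l) (u, u ^ branchLength l (branch l) * g u)) :
    ∃ D A τ, Configuration (Plane.tipMap P) branchParent (stages γ k) k (branchLength k)
      (branchTip k) (selfIntersection k) D A τ := by
  induction k with
  | zero => exact ⟨_, _, _, Plane.configuration P hP h0 h1 h2 _⟩
  | succ k ih =>
    obtain ⟨D, A, τ, h⟩ := ih fun l hl => hγ l (hl.trans (Nat.lt_succ_self k))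
    obtain ⟨g, hg, hgγ⟩ := hγ k (Nat.lt_succ_self k)
    have hc : (stages γ k).center (γ k) = (τ (branch k)).symm (0, 0) :=
      (h.tendsto_center (branch k) hg hgγ).limUnder_eq
    have := h.exists_blow (branch k) (fun j hj => branchParent_lt hj) rfl
    rw [← hc] at this
    exact this

theorem tendsto_stages_center (hP : ∀ i, ContDiff ℂ ω (P i)) (h0 : P 0 0 = 1)
    (h1 : P 1 0 = -1 / 2) (h2 : P 2 0 = 0) {γ : ℕ → ℂ → ℂ × ℂ} {k : ℕ}
    (hγ : ∀ l < k + 1, ∃ g : ℂ → ℂ, Tendsto g (𝓝[≠] 0) (𝓝 0) ∧ ∀ u, u ≠ 0 →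
      γ l u = Plane.tipMap P (branch l) (u, u ^ branchLength l (branch l) * g u)) :
    Tendsto (fun u => (stages γ k).aff (γ k u)) (𝓝[≠] 0) (𝓝 ((stages γ k).center (γ k))) := by
  obtain ⟨D, A, τ, h⟩ := stages_configuration hP h0 h1 h2 (k := k) fun l hl => hγ l (by omega)
  obtain ⟨g, hg, hgγ⟩ := hγ k (by omega)
  exact tendsto_nhds_limUnder ⟨_, h.tendsto_center (branch k) hg hgγ⟩

theorem stages_down_aff {γ : ℕ → ℂ → ℂ × ℂ} {k : ℕ} {z : ℂ × ℂ}
    (h : (stages γ k).aff z ≠ (stages γ k).center (γ k)) :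
    BlowUp.down _ ((stages γ (k + 1)).aff z) = (stages γ k).aff z := BlowUp.down_up h

theorem stages_aff_ne_center (hP : ∀ i, ContDiff ℂ ω (P i)) (h0 : P 0 0 = 1)
    (h1 : P 1 0 = -1 / 2) (h2 : P 2 0 = 0) {γ : ℕ → ℂ → ℂ × ℂ} {k : ℕ}
    (hγ : ∀ l < k + 1, ∃ g : ℂ → ℂ, Tendsto g (𝓝[≠] 0) (𝓝 0) ∧ ∀ u, u ≠ 0 →
      γ l u = Plane.tipMap P (branch l) (u, u ^ branchLength l (branch l) * g u)) (z : ℂ × ℂ) :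
    (stages γ k).aff z ≠ (stages γ k).center (γ k) := by
  obtain ⟨D, A, τ, h⟩ := stages_configuration hP h0 h1 h2 (k := k) fun l hl => hγ l (by omega)
  obtain ⟨g, hg, hgγ⟩ := hγ k (by omega)
  have hc : (stages γ k).center (γ k) = (τ (branch k)).symm (0, 0) :=
    (h.tendsto_center (branch k) hg hgγ).limUnder_eq
  rw [hc]
  intro hz
  refine h.aff_notMem _ (h.tip_le (branch k)) z ?_
  rw [hz, h.tip _ _ ((τ _).map_target (h.zero_mem_target _)),
    (τ _).right_inv (h.zero_mem_target _)]

/-- A sequence of ten arcs, extended by constant ones. -/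
def extendArcs (γ : Fin 10 → ℂ → ℂ × ℂ) (k : ℕ) : ℂ → ℂ × ℂ :=
  if h : k < 10 then γ ⟨k, h⟩ else 0

theorem extendArcs_val (γ : Fin 10 → ℂ → ℂ × ℂ) (k : Fin 10) : extendArcs γ k = γ k :=
  dif_pos k.2

/-- The tower of blowing-ups. -/
def tower (γ : Fin 10 → ℂ → ℂ × ℂ) (hP : ∀ i, ContDiff ℂ ω (P i)) (h0 : P 0 0 = 1)
    (h1 : P 1 0 = -1 / 2) (h2 : P 2 0 = 0)
    (hγ : ∀ l < 10, ∃ g : ℂ → ℂ, Tendsto g (𝓝[≠] 0) (𝓝 0) ∧ ∀ u, u ≠ 0 →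
      extendArcs γ l u = Plane.tipMap P (branch l) (u, u ^ branchLength l (branch l) * g u)) :
    BlowUpTower γ where
  S k := (stages (extendArcs γ) k).X
  compact k := inferInstance
  plane := Equiv.refl (ℙ ℂ (Fin 3 → ℂ))
  isPlane := Plane.isProjectivePlane
  affine k := (stages (extendArcs γ) k).aff
  affine_zero _ := rfl
  π k := BlowUp.down ((stages (extendArcs γ) k).center (extendArcs γ k))
  affine_succ k z := stages_down_aff
    (stages_aff_ne_center hP h0 h1 h2 (fun l hl => hγ l (by omega)) z)
  center k := (stages (extendArcs γ) k).center (extendArcs γ k)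
  center_spec k := by
    have := tendsto_stages_center hP h0 h1 h2 (k := k) (fun l hl => hγ l (by omega))
    simp only [extendArcs_val] at this ⊢
    exact this
  isBlowUp k := BlowUp.isBlowUp

end

/-! ### The surfaces of the Ince-XXXV system -/

/-- The position of the `(-2)`-curve at a node of the Dynkin diagram in the sequence of all
curves. -/
def curveIndex : Fin 8 → ℕ := ![5, 4, 3, 0, 7, 8, 9, 1]

theorem curveIndex_le (i : Fin 8) : curveIndex i ≤ 10 := by decide +revert

theorem curveIndex_injective : Function.Injective curveIndex := by
  unfold Function.Injective
  decide

/-- The line at infinity (number 0) loses 1 for each of the three branches, 1 - 3 = -2. Every other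
listed curve is exceptional and carries exactly one later centre, -1 - 1 = -2. The unlisted curves
2, 6, 10 end the branches and remain (-1)-curves. -/
theorem selfIntersection_curveIndex (i : Fin 8) : selfIntersection 10 (curveIndex i) = -2 := by
  decide +revert

theorem branchTip_ne_curveIndex (i : Fin 3) (j : Fin 8) : curveIndex j ≠ branchTip 10 i := by
  decide +revert

theorem branchLength_ne_zero (i : Fin 3) : branchLength 10 i ≠ 0 := by
  decide +revert

theorem exists_curveIndex {j : ℕ} (hj : j ≤ 10) (h : j = 0 ∨ ∀ i, branchTip 10 i ≠ j) :
    ∃ i, curveIndex i = j := by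
  revert j
  decide

/-- Without the ends 2, 6, 10 the branches are the chains 1, then 3 - 4 - 5, then 7 - 8 - 9, all
attached to 0. This is the chain 5 - 4 - 3 - 0 - 7 - 8 - 9 with 1 attached to its middle. -/
theorem dynkinAffineE7_adj_iff (i j : Fin 8) (hij : i ≠ j) :
    dynkinAffineE7.Adj i j ↔ parentAdj branchParent (curveIndex i) (curveIndex j) := by
  rw [dynkinAffineE7, SimpleGraph.fromEdgeSet_adj, and_iff_left hij]
  simp only [mem_insert_iff, mem_singleton_iff, parentAdj]
  decide +revert

/-! ### From the final configuration to the diagram and the gluing -/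

namespace Configuration

variable {σ : Fin 3 → ℂ × ℂ → ℂ × ℂ} {par : ℕ → ℕ} {s : Stage} {k : ℕ} {m t : Fin 3 → ℕ}
  {n : ℕ → ℤ} {D : ℕ → Set s.X} {A : OpenPartialHomeomorph s.X (ℂ × ℂ)}
  {τ : Fin 3 → OpenPartialHomeomorph s.X (ℂ × ℂ)}

theorem apply_aff (h : Configuration σ par s k m t n D A τ) (z : ℂ × ℂ) : A (s.aff z) = z := by
  rw [← h.aff_symm]
  exact A.right_inv (by rw [h.aff_target]; trivial)

theorem aff_apply (h : Configuration σ par s k m t n D A τ) {x : s.X} (hx : x ∈ A.source) :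
    s.aff (A x) = x := by
  rw [← h.aff_symm]
  exact A.left_inv hx

theorem aff_mem_source (h : Configuration σ par s k m t n D A τ) (z : ℂ × ℂ) :
    s.aff z ∈ A.source := by
  rw [← h.aff_symm]
  exact A.map_target (by rw [h.aff_target]; trivial)

theorem tip_apply_aff (h : Configuration σ par s k m t n D A τ) (i : Fin 3) {z c : ℂ × ℂ}
    (hc : c.1 ≠ 0) (hz : σ i (c.1, c.1 ^ m i * c.2) = z) :
    s.aff z ∈ (τ i).source ∧ τ i (s.aff z) = c := by
  rw [← hz, ← h.symm_eq i c hc]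
  exact ⟨(τ i).map_target (h.mem_target i c hc), (τ i).right_inv (h.mem_target i c hc)⟩

theorem exists_of_aff_mem (h : Configuration σ par s k m t n D A τ) (i : Fin 3) {z : ℂ × ℂ}
    (hz : s.aff z ∈ (τ i).source) :
    ∃ c : ℂ × ℂ, c.1 ≠ 0 ∧ σ i (c.1, c.1 ^ m i * c.2) = z := by
  have h0 : (τ i (s.aff z)).1 ≠ 0 := fun h0 =>
    h.aff_notMem _ (h.tip_le i) z ((h.tip i _ hz).2 h0)
  refine ⟨_, h0, ?_⟩
  rw [← h.apply_aff (σ i _), ← h.symm_eq i _ h0, (τ i).left_inv hz, h.apply_aff]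

/-- The chart of the affine plane together with modifications of the three charts along the
tips. -/
def allCharts (A : OpenPartialHomeomorph s.X (ℂ × ℂ))
    (τ : Fin 3 → OpenPartialHomeomorph s.X (ℂ × ℂ)) (e : Fin 3 → (ℂ × ℂ) ≃ₜ (ℂ × ℂ)) :
    Fin 4 → OpenPartialHomeomorph s.X (ℂ × ℂ) :=
  Fin.cons A fun i => (τ i).transHomeomorph (e i)

theorem isTypeAffineE7
    (h : Configuration σ branchParent s 10 m t (selfIntersection 10) D A τ) :
    IsTypeAffineE7 s.X (D ∘ curveIndex) where
  minus_two i := by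
    have := h.rational _ (curveIndex_le i)
    rwa [selfIntersection_curveIndex] at this
  meet i j hij := h.meet _ (curveIndex_le i) _ (curveIndex_le j)
    (curveIndex_injective.ne hij.ne) ((dynkinAffineE7_adj_iff i j hij.ne).1 hij)
  disjoint i j hij hadj := h.disjoint _ (curveIndex_le i) _ (curveIndex_le j)
    (curveIndex_injective.ne hij) (mt (dynkinAffineE7_adj_iff i j hij).2 hadj)

/-- After all ten blowings-up every branch has been started. So a point outside the eight curves
lies in the affine plane or in a tip chart, and the tip charts meet none of the eight curves and
meet each other only in the affine plane. -/
theorem isGluedBy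
    (h : Configuration σ branchParent s 10 (branchLength 10) (branchTip 10) n D A τ)
    {e : Fin 3 → (ℂ × ℂ) ≃ₜ (ℂ × ℂ)} {dom : Fin 4 → Set (ℂ × ℂ)}
    {T : Fin 4 → ℂ × ℂ → ℂ × ℂ} (hdom₀ : dom 0 = univ) (hT₀ : ∀ z, T 0 z = z)
    (hdom : ∀ i c d, c ≠ 0 → σ i (c, d) ∈ dom i.succ)
    (hT : ∀ i z, z ∈ dom i.succ → ∃ c : ℂ × ℂ, c.1 ≠ 0 ∧
      σ i (c.1, c.1 ^ branchLength 10 i * c.2) = z ∧ T i.succ z = e i c) :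
    IsGluedBy (⋃ i, (D ∘ curveIndex) i)ᶜ (allCharts A τ e) dom T := by
  have hov : ∀ i, ∀ p ∈ A.source, p ∈ (τ i).source ↔ A p ∈ dom i.succ := by
    intro i p hp
    constructor
    · intro hi
      rw [← h.aff_apply hp] at hi
      obtain ⟨c, hc, hz⟩ := h.exists_of_aff_mem i hi
      rw [← hz]
      exact hdom i _ _ hc
    · intro hi
      obtain ⟨c, hc, hz, -⟩ := hT i _ hi
      have := (h.tip_apply_aff i hc hz).1
      rwa [h.aff_apply hp] at this
  have hsrc : ∀ i : Fin 3, (allCharts A τ e i.succ).source = (τ i).source := fun i => rfl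
  have hrange : range s.aff ⊆ A.source := by
    rintro _ ⟨z, rfl⟩
    exact h.aff_mem_source z
  constructor
  case cover =>
    ext p
    rw [mem_iUnion, mem_compl_iff, mem_iUnion]
    constructor
    · rintro ⟨j, hj⟩ ⟨i, hi⟩
      refine Fin.cases (fun hj => ?_) (fun j hj => ?_) j hj
      · refine h.aff_notMem _ (curveIndex_le i) (A p) ?_
        rwa [h.aff_apply hj]
      · exact h.notMem j _ (curveIndex_le i) (branchTip_ne_curveIndex j i) p hj hi
    · intro hp
      rcases h.cover p with hp' | ⟨i, -, hi⟩ | ⟨j, hj, hj', hpj⟩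
      · exact ⟨0, hrange hp'⟩
      · exact ⟨i.succ, hi⟩
      · obtain ⟨i, rfl⟩ := exists_curveIndex hj hj'
        exact (hp ⟨i, hpj⟩).elim
  case overlap =>
    intro j p hp
    refine Fin.cases ?_ (fun i => ?_) j
    · rw [hdom₀]
      exact iff_of_true hp trivial
    · exact hov i p hp
  case transition =>
    rintro j p ⟨hp, hj⟩
    refine Fin.cases (fun _ => (hT₀ _).symm) (fun i hi => ?_) j hj
    obtain ⟨c, hc, hz, hTc⟩ := hT i _ ((hov i p hp).1 hi)
    have := (h.tip_apply_aff i hc hz).2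
    rw [h.aff_apply hp] at this
    change e i (τ i p) = T i.succ (A p)
    rw [hTc, this]
  case inter =>
    intro i j
    refine Fin.cases (fun _ => inter_subset_left) (fun i => ?_) i
    refine Fin.cases (fun _ => inter_subset_right) (fun j hij => ?_) j
    exact (h.inter i j fun h' => hij (congrArg _ h')).trans hrange

end Configuration

/-! ### The ten centres in sheared coordinates -/

section

variable (q r : ℂ → ℂ) (t : ℂ)

/-- The polynomials whose Taylor coefficients are the coordinates of the centres. -/
def centrePoly : Fin 3 → ℂ → ℂ
  | 0 => fun a => 1 - 4 * q t * a
  | 1 => fun a => -1 / 2 + 2 * q t * a - (9 * r t / 2 + 6 * deriv q t) * a ^ 2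
      + (9 * deriv r t + 12 * iteratedDeriv 2 q t) * a ^ 3
  | 2 => fun a => -(9 * r t / 2) * a ^ 2 + (18 * q t * r t - 27 * deriv r t) / 2 * a ^ 3

theorem contDiff_centrePoly (i : Fin 3) : ContDiff ℂ ω (centrePoly q r t i) := by
  fin_cases i <;> (simp only [centrePoly]; fun_prop)

/-- The passage from the charts along the tips to the charts of the phase space. -/
def chartChange : Fin 3 → (ℂ × ℂ) ≃ₜ (ℂ × ℂ)
  | 0 => Homeomorph.refl _
  | 1 => (Homeomorph.refl ℂ).prodCongr (Homeomorph.neg ℂ)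
  | 2 => ((Homeomorph.refl ℂ).prodCongr (Homeomorph.neg ℂ)).trans (Homeomorph.prodComm ℂ ℂ)

theorem contDiff_chartChange (i : Fin 3) :
    ContDiff ℂ ω (chartChange i) ∧ ContDiff ℂ ω (chartChange i).symm := by
  fin_cases i
  · exact ⟨contDiff_id, contDiff_id⟩
  · exact ⟨contDiff_fst.prodMk contDiff_snd.neg, contDiff_fst.prodMk contDiff_snd.neg⟩
  · exact ⟨contDiff_snd.neg.prodMk contDiff_fst, contDiff_snd.prodMk contDiff_fst.neg⟩

/-- Solving X^m w = y/x + P(X), respectively x/y + P(X), for w with m = 2, 4, 4 yields the nested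
products in `coord`. The signs and the order of the coordinates are the task of `chartChange`. -/
theorem exists_coord_eq (i : Fin 3) (z : ℂ × ℂ) (hz : z ∈ coordDom i.succ) :
    ∃ c : ℂ × ℂ, c.1 ≠ 0 ∧
      Plane.tipMap (centrePoly q r t) i (c.1, c.1 ^ branchLength 10 i * c.2) = z ∧
      coord q r t i.succ z = chartChange i c := by
  obtain ⟨x, y⟩ := z
  fin_cases i
  · have hx : x ≠ 0 := hz
    refine ⟨(1 / x, (y + x - 4 * q t) * x), one_div_ne_zero hx, ?_, rfl⟩
    change (1 / (1 / x), ((1 / x) ^ 2 * ((y + x - 4 * q t) * x) - (1 - 4 * q t * (1 / x))) / (1 / x))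
      = (x, y)
    ext1
    · field_simp
    · field_simp
      ring
  · have hx : x ≠ 0 := hz
    refine ⟨(1 / x, (((y - x / 2 + 2 * q t) * x - 9 * r t / 2 - 6 * deriv q t) * x
            + 9 * deriv r t + 12 * iteratedDeriv 2 q t) * x), one_div_ne_zero hx, ?_, ?_⟩
    · change (1 / (1 / x), ((1 / x) ^ 4 * ((((y - x / 2 + 2 * q t) * x - 9 * r t / 2
        - 6 * deriv q t) * x + 9 * deriv r t + 12 * iteratedDeriv 2 q t) * x)
        - (-1 / 2 + 2 * q t * (1 / x) - (9 * r t / 2 + 6 * deriv q t) * (1 / x) ^ 2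
        + (9 * deriv r t + 12 * iteratedDeriv 2 q t) * (1 / x) ^ 3)) / (1 / x)) = (x, y)
      ext1
      · field_simp
      · field_simp
        ring
    · change (_, _) = (_, _)
      ext1
      · rfl
      · exact neg_mul _ _
  · have hy : y ≠ 0 := hz
    refine ⟨(1 / y, ((x * y - 9 * r t / 2) * y + (18 * q t * r t - 27 * deriv r t) / 2) * y),
      one_div_ne_zero hy, ?_, ?_⟩
    · change (((1 / y) ^ 4 * (((x * y - 9 * r t / 2) * y + (18 * q t * r t - 27 * deriv r t) / 2) * y)
        - (-(9 * r t / 2) * (1 / y) ^ 2 + (18 * q t * r t - 27 * deriv r t) / 2 * (1 / y) ^ 3))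
        / (1 / y), 1 / (1 / y)) = (x, y)
      ext1
      · field_simp
        ring
      · field_simp
    · change (_, _) = (_, _)
      ext1
      · exact neg_mul _ _
      · rfl

theorem tipMap_mem_coordDom (P : Fin 3 → ℂ → ℂ) (i : Fin 3) (c d : ℂ) (hc : c ≠ 0) :
    Plane.tipMap P i (c, d) ∈ coordDom i.succ := by
  fin_cases i <;> exact one_div_ne_zero hc

/-- Each arc truncates the expansion encoded in `centrePoly` after the terms that the earlier
blowings-up of its branch have used. So u^m g(u) is the remaining tail of the polynomial, and g = 0
for the last arc of a branch. -/
theorem extendArcs_arc (l : ℕ) (hl : l < 10) : ∃ g : ℂ → ℂ, Tendsto g (𝓝[≠] 0) (𝓝 0) ∧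
    ∀ u, u ≠ 0 → extendArcs (arc q r t) l u =
      Plane.tipMap (centrePoly q r t) (branch l) (u, u ^ branchLength l (branch l) * g u) := by
  have key : ∀ g : ℂ → ℂ, Continuous g → g 0 = 0 → Tendsto g (𝓝[≠] 0) (𝓝 0) := fun g hg h0 => by
    have := hg.tendsto 0
    rw [h0] at this
    exact this.mono_left nhdsWithin_le_nhds
  set Q := q t
  set S := 9 * r t / 2 + 6 * deriv q t with hS
  set E := 9 * deriv r t + 12 * iteratedDeriv 2 q t with hE
  set R := 9 * r t / 2 with hR
  set K := (18 * q t * r t - 27 * deriv r t) / 2 with hK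
  interval_cases l
  · refine ⟨fun u => -4 * Q * u, key _ (by fun_prop) (by simp), fun u hu => ?_⟩
    change (1 / u, -1 / u) = (1 / u, (u ^ 0 * (-4 * Q * u) - (1 - 4 * Q * u)) / u)
    congr 1
    field_simp
    ring
  · refine ⟨fun u => 0, key _ (by fun_prop) (by simp), fun u hu => ?_⟩
    change (1 / u, -1 / u + 4 * Q) = (1 / u, (u ^ 1 * 0 - (1 - 4 * Q * u)) / u)
    congr 1
    field_simp
    ring
  · refine ⟨fun u => 2 * Q * u - S * u ^ 2 + E * u ^ 3, key _ (by fun_prop) (by simp),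
      fun u hu => ?_⟩
    change (1 / u, 1 / (2 * u)) = (1 / u, (u ^ 0 * (2 * Q * u - S * u ^ 2 + E * u ^ 3)
      - (-1 / 2 + 2 * Q * u - S * u ^ 2 + E * u ^ 3)) / u)
    congr 1
    field_simp
    ring
  · refine ⟨fun u => - S * u + E * u ^ 2, key _ (by fun_prop) (by simp), fun u hu => ?_⟩
    change (1 / u, 1 / (2 * u) - 2 * Q) = (1 / u, (u ^ 1 * (- S * u + E * u ^ 2)
      - (-1 / 2 + 2 * Q * u - S * u ^ 2 + E * u ^ 3)) / u)
    congr 1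
    field_simp
    ring
  · refine ⟨fun u => E * u, key _ (by fun_prop) (by simp), fun u hu => ?_⟩
    change (1 / u, 1 / (2 * u) - 2 * Q + S * u) = (1 / u, (u ^ 2 * (E * u)
      - (-1 / 2 + 2 * Q * u - S * u ^ 2 + E * u ^ 3)) / u)
    congr 1
    field_simp
    ring
  · refine ⟨fun u => 0, key _ (by fun_prop) (by simp), fun u hu => ?_⟩
    change (1 / u, 1 / (2 * u) - 2 * Q + S * u - E * u ^ 2) = (1 / u, (u ^ 3 * 0
      - (-1 / 2 + 2 * Q * u - S * u ^ 2 + E * u ^ 3)) / u)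
    congr 1
    field_simp
    ring
  -- On the third branch the constant and linear coefficients are zero; this is why its first two
  -- arcs coincide.
  · refine ⟨fun u => - R * u ^ 2 + K * u ^ 3, key _ (by fun_prop) (by simp), fun u hu => ?_⟩
    change (0, 1 / u) = ((u ^ 0 * (- R * u ^ 2 + K * u ^ 3) - (- R * u ^ 2 + K * u ^ 3)) / u, 1 / u)
    congr 1
    field_simp
    ring
  · refine ⟨fun u => - R * u + K * u ^ 2, key _ (by fun_prop) (by simp), fun u hu => ?_⟩
    change (0, 1 / u) = ((u ^ 1 * (- R * u + K * u ^ 2) - (- R * u ^ 2 + K * u ^ 3)) / u, 1 / u)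
    congr 1
    field_simp
    ring
  · refine ⟨fun u => K * u, key _ (by fun_prop) (by simp), fun u hu => ?_⟩
    change (R * u, 1 / u) = ((u ^ 2 * (K * u) - (- R * u ^ 2 + K * u ^ 3)) / u, 1 / u)
    congr 1
    field_simp
    ring
  · refine ⟨fun u => 0, key _ (by fun_prop) (by simp), fun u hu => ?_⟩
    change (R * u - K * u ^ 2, 1 / u) = ((u ^ 3 * 0 - (- R * u ^ 2 + K * u ^ 3)) / u, 1 / u)
    congr 1
    field_simp
    ring

theorem exists_tower : ∃ (X : BlowUpTower (arc q r t)) (D : Fin 8 → Set X.top)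
    (ψ : Fin 4 → OpenPartialHomeomorph X.top (ℂ × ℂ)),
    IsTypeAffineE7 X.top D ∧ (∀ j, IsHolChart X.top (ψ j) ∧ (ψ j).target = univ) ∧
    (∀ z, (ψ 0).symm z = X.affine (Fin.last 10) z) ∧
    IsGluedBy (⋃ i, D i)ᶜ ψ coordDom (coord q r t) := by
  have hP := contDiff_centrePoly q r t
  have h0 : centrePoly q r t 0 0 = 1 := by simp [centrePoly]
  have h1 : centrePoly q r t 1 0 = -1 / 2 := by simp [centrePoly]
  have h2 : centrePoly q r t 2 0 = 0 := by simp [centrePoly]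
  have hγ := extendArcs_arc q r t
  obtain ⟨D, A, τ, h⟩ := stages_configuration hP h0 h1 h2 hγ
  refine ⟨tower _ hP h0 h1 h2 hγ, D ∘ curveIndex, Configuration.allCharts A τ chartChange,
    h.isTypeAffineE7, ?_, h.aff_symm, h.isGluedBy rfl (fun _ => rfl)
      (fun i c d hc => tipMap_mem_coordDom _ i c d hc) (exists_coord_eq q r t)⟩
  intro j
  refine Fin.cases ⟨h.hol_aff, h.aff_target⟩ (fun i => ⟨?_, ?_⟩) j
  · exact (h.hol i).transHomeomorph (contDiff_chartChange i).1 (contDiff_chartChange i).2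
  · change (chartChange i).symm ⁻¹' (τ i).target = univ
    rw [h.target_eq i (branchLength_ne_zero i), preimage_univ]

end

/-! ### The threefold -/

section

variable (q r : ℂ → ℂ)

/-- The affine coordinates `(x, y)` in terms of the coordinates `(x_j, y_j)`. -/
def affineCoord (t : ℂ) : Fin 4 → ℂ × ℂ → ℂ × ℂ :=
  Fin.cons id fun i w => Plane.tipMap (centrePoly q r t) i
    (((chartChange i).symm w).1,
      ((chartChange i).symm w).1 ^ branchLength 10 i * ((chartChange i).symm w).2)

/-- The domain of definition of `affineCoord`. -/
def affineCoordDom : Fin 4 → Set (ℂ × ℂ) :=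
  Fin.cons univ fun i => {w | ((chartChange i).symm w).1 ≠ 0}

theorem cornerMap_injective (i : Fin 3) {v w : ℂ × ℂ} (hv : v.1 ≠ 0) (hw : w.1 ≠ 0)
    (h : Plane.cornerMap i v = Plane.cornerMap i w) : v = w := by
  obtain ⟨a, b⟩ := v
  obtain ⟨c, d⟩ := w
  have key : ∀ {a b c d : ℂ}, a ≠ 0 → c ≠ 0 → 1 / a = 1 / c → b / a = d / c → (a, b) = (c, d) := by
    intro a b c d ha hc h1 h2
    rw [one_div, one_div, inv_inj] at h1
    subst h1
    rw [div_left_inj' ha] at h2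
    rw [h2]
  fin_cases i
  · exact key hv hw (congrArg Prod.fst h) (congrArg Prod.snd h)
  · exact key hv hw (congrArg Prod.fst h) (congrArg Prod.snd h)
  · exact key hv hw (congrArg Prod.snd h) (congrArg Prod.fst h)

theorem tipMap_pow_injective {P : Fin 3 → ℂ → ℂ} (i : Fin 3) {m : ℕ} {v w : ℂ × ℂ}
    (hv : v.1 ≠ 0) (hw : w.1 ≠ 0)
    (h : Plane.tipMap P i (v.1, v.1 ^ m * v.2) = Plane.tipMap P i (w.1, w.1 ^ m * w.2)) :
    v = w := by
  have h' := cornerMap_injective i (v := (v.1, v.1 ^ m * v.2 - P i v.1))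
    (w := (w.1, w.1 ^ m * w.2 - P i w.1)) hv hw h
  obtain ⟨h1, h2⟩ := Prod.ext_iff.1 h'
  simp only at h1 h2
  rw [h1, sub_left_inj] at h2
  exact Prod.ext h1 (mul_left_cancel₀ (pow_ne_zero m hw) h2)

theorem affineCoord_coord (t : ℂ) (j : Fin 4) {z : ℂ × ℂ} (hz : z ∈ coordDom j) :
    coord q r t j z ∈ affineCoordDom j ∧ affineCoord q r t j (coord q r t j z) = z := by
  refine Fin.cases (fun _ => ⟨trivial, rfl⟩) (fun i hi => ?_) j hz
  obtain ⟨c, hc, hcz, hT⟩ := exists_coord_eq q r t i z hi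
  rw [hT]
  refine ⟨?_, ?_⟩
  · change ((chartChange i).symm (chartChange i c)).1 ≠ 0
    rwa [Homeomorph.symm_apply_apply]
  · simp only [affineCoord, Fin.cons_succ, Homeomorph.symm_apply_apply]
    exact hcz

theorem coord_affineCoord (t : ℂ) (j : Fin 4) {w : ℂ × ℂ} (hw : w ∈ affineCoordDom j) :
    affineCoord q r t j w ∈ coordDom j ∧ coord q r t j (affineCoord q r t j w) = w := by
  refine Fin.cases (fun _ => ⟨trivial, rfl⟩) (fun i hi => ?_) j hw
  have hi' : ((chartChange i).symm w).1 ≠ 0 := hi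
  have hdom : affineCoord q r t i.succ w ∈ coordDom i.succ :=
    tipMap_mem_coordDom _ i _ _ hi'
  refine ⟨hdom, ?_⟩
  obtain ⟨c, hc, hcz, hT⟩ := exists_coord_eq q r t i _ hdom
  rw [hT, tipMap_pow_injective i hc hi' hcz, Homeomorph.apply_symm_apply]

theorem isOpen_coordDom (j : Fin 4) : IsOpen (coordDom j) := by
  fin_cases j
  · exact isOpen_univ
  · exact isOpen_ne_fun continuous_fst continuous_const
  · exact isOpen_ne_fun continuous_fst continuous_const
  · exact isOpen_ne_fun continuous_snd continuous_const

theorem isOpen_affineCoordDom (j : Fin 4) : IsOpen (affineCoordDom j) := by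
  refine Fin.cases isOpen_univ (fun i => ?_) j
  exact isOpen_ne_fun (continuous_fst.comp (chartChange i).symm.continuous) continuous_const

variable {q r} {B : Set ℂ}

theorem contDiffAt_coefficients (hB : IsOpen B) (hq : DifferentiableOn ℂ q B)
    (hr : DifferentiableOn ℂ r B) {t : ℂ} (ht : t ∈ B) :
    ContDiffAt ℂ ω q t ∧ ContDiffAt ℂ ω r t ∧ ContDiffAt ℂ ω (deriv q) t ∧
    ContDiffAt ℂ ω (deriv r) t ∧ ContDiffAt ℂ ω (iteratedDeriv 2 q) t := by
  have hq' := hq.analyticAt (hB.mem_nhds ht)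
  have hr' := hr.analyticAt (hB.mem_nhds ht)
  refine ⟨hq'.contDiffAt, hr'.contDiffAt, hq'.deriv.contDiffAt, hr'.deriv.contDiffAt, ?_⟩
  simp only [iteratedDeriv_succ, iteratedDeriv_zero]
  exact hq'.deriv.deriv.contDiffAt

theorem contDiffAt_coordT (hB : IsOpen B) (hq : DifferentiableOn ℂ q B)
    (hr : DifferentiableOn ℂ r B) (j : Fin 4) {z : (ℂ × ℂ) × ℂ} (hz : z ∈ coordTDom B j) :
    ContDiffAt ℂ ω (coordT q r j) z := by
  obtain ⟨h1, h2, h3, h4, h5⟩ := contDiffAt_coefficients hB hq hr hz.2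
  refine ContDiffAt.prodMk ?_ contDiffAt_snd
  fin_cases j
  · exact contDiffAt_fst
  · have hx : z.1.1 ≠ 0 := hz.1
    simp only [coord]
    fun_prop (disch := assumption)
  · have hx : z.1.1 ≠ 0 := hz.1
    simp only [coord]
    fun_prop (disch := assumption)
  · have hy : z.1.2 ≠ 0 := hz.1
    simp only [coord]
    fun_prop (disch := assumption)

theorem contDiffAt_centrePoly (hB : IsOpen B) (hq : DifferentiableOn ℂ q B)
    (hr : DifferentiableOn ℂ r B) (i : Fin 3) {z : ℂ × ℂ} (hz : z.2 ∈ B) :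
    ContDiffAt ℂ ω (fun z : ℂ × ℂ => centrePoly q r z.2 i z.1) z := by
  obtain ⟨h1, h2, h3, h4, h5⟩ := contDiffAt_coefficients hB hq hr hz
  fin_cases i <;> (simp only [centrePoly]; fun_prop (disch := assumption))

theorem contDiffAt_cornerMap (i : Fin 3) {z : ℂ × ℂ} (hz : z.1 ≠ 0) :
    ContDiffAt ℂ ω (Plane.cornerMap i) z := by
  fin_cases i <;>
    exact ContDiffAt.prodMk (by fun_prop (disch := assumption)) (by fun_prop (disch := assumption))

/-- The coordinates near the three points of the line at infinity in terms of those of the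
threefold. -/
def cornerCoord (q r : ℂ → ℂ) (i : Fin 3) (z : (ℂ × ℂ) × ℂ) : ℂ × ℂ :=
  (((chartChange i).symm z.1).1,
    ((chartChange i).symm z.1).1 ^ branchLength 10 i * ((chartChange i).symm z.1).2
      - centrePoly q r z.2 i ((chartChange i).symm z.1).1)

theorem contDiffAt_cornerCoord (hB : IsOpen B) (hq : DifferentiableOn ℂ q B)
    (hr : DifferentiableOn ℂ r B) (i : Fin 3) {z : (ℂ × ℂ) × ℂ} (hz : z.2 ∈ B) :
    ContDiffAt ℂ ω (cornerCoord q r i) z := by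
  have hc : ContDiffAt ℂ ω (fun z : (ℂ × ℂ) × ℂ => (chartChange i).symm z.1) z :=
    (contDiff_chartChange i).2.contDiffAt.comp z contDiffAt_fst
  refine hc.fst.prodMk (((hc.fst.pow _).mul hc.snd).sub ?_)
  exact (contDiffAt_centrePoly hB hq hr i (z := (((chartChange i).symm z.1).1, z.2)) hz).comp z
    (hc.fst.prodMk contDiffAt_snd)

theorem contDiffAt_affineCoord (hB : IsOpen B) (hq : DifferentiableOn ℂ q B)
    (hr : DifferentiableOn ℂ r B) (j : Fin 4) {z : (ℂ × ℂ) × ℂ} (hz : z.1 ∈ affineCoordDom j)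
    (hzB : z.2 ∈ B) :
    ContDiffAt ℂ ω (fun z : (ℂ × ℂ) × ℂ => (affineCoord q r z.2 j z.1, z.2)) z := by
  refine ContDiffAt.prodMk ?_ contDiffAt_snd
  refine Fin.cases (fun _ => contDiffAt_fst) (fun i hi => ?_) j hz
  exact (contDiffAt_cornerMap i (z := cornerCoord q r i z) hi).comp z
    (contDiffAt_cornerCoord hB hq hr i hzB)

/-- The image of a point of the threefold in the projective plane. -/
def planeMap (q r : ℂ → ℂ) : Fin 4 → (ℂ × ℂ) × ℂ → Plane.surface :=
  Fin.cons (fun z => (Plane.std 0).symm z.1) fun i z =>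
    (Plane.cornerChart i).symm (cornerCoord q r i z)

theorem planeMap_eq (j : Fin 4) {z : (ℂ × ℂ) × ℂ} (hz : z.1 ∈ affineCoordDom j) :
    planeMap q r j z = (Plane.std 0).symm (affineCoord q r z.2 j z.1) := by
  refine Fin.cases (fun _ => rfl) (fun i hi => ?_) j hz
  exact Plane.cornerChart_symm_eq i (w := cornerCoord q r i z) hi

theorem planeMap_mem_lineAtInfinity (j : Fin 4) {z : (ℂ × ℂ) × ℂ} :
    planeMap q r j z ∈ Plane.lineAtInfinity ↔ z.1 ∉ affineCoordDom j := by
  refine Fin.cases ?_ (fun i => ?_) j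
  · refine iff_of_false (fun h => ?_) (fun h => h trivial)
    have := (Plane.std_symm_mem_lineAtInfinity 0 z.1).1 h
    simp [homog] at this
  · refine (Plane.cornerChart_symm_mem i (cornerCoord q r i z)).trans not_not.symm

/-- At X = 0 the term X^m w vanishes, so the whole line goes to the first centre of its branch. The
three first centres lie in discs of the line at infinity that are disjoint by `tipChart_inter`, so
the image tells the charts apart. -/
theorem planeMap_injective_index {i j : Fin 4} {z w : (ℂ × ℂ) × ℂ} (hz : z.1 ∉ affineCoordDom i)
    (hw : w.1 ∉ affineCoordDom j) (ht : z.2 = w.2) (h : planeMap q r i z = planeMap q r j w) :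
    i = j := by
  have hmem : ∀ (i : Fin 3) (z : (ℂ × ℂ) × ℂ), z.1 ∉ affineCoordDom i.succ →
      planeMap q r i.succ z ∈
        (Plane.tipChart (centrePoly q r z.2) (contDiff_centrePoly q r z.2) i).source := by
    intro i z hi
    have h0 : ((chartChange i).symm z.1).1 = 0 := not_not.1 hi
    have h1 : planeMap q r i.succ z =
        (Plane.tipChart (centrePoly q r z.2) (contDiff_centrePoly q r z.2) i).symm (0, 0) := by
      rw [Plane.tipChart_symm]
      change (Plane.cornerChart i).symm (cornerCoord q r i z) = _
      rw [cornerCoord, h0, zero_pow (branchLength_ne_zero i), zero_mul]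
    rw [h1]
    refine (Plane.tipChart _ _ i).map_target ?_
    rw [Plane.tipChart_target]
    right
    simp
  have key : ∀ {i j : Fin 3} {z w : (ℂ × ℂ) × ℂ}, z.1 ∉ affineCoordDom i.succ →
      w.1 ∉ affineCoordDom j.succ → z.2 = w.2 → planeMap q r i.succ z = planeMap q r j.succ w →
      ¬ i < j := by
    intro i j z w hz hw ht h hij
    have h1 := hmem i z hz
    have h2 := hmem j w hw
    rw [← h, ← ht] at h2
    exact Plane.tipChart_inter _ (contDiff_centrePoly q r z.2) (by simp [centrePoly])
      (by simp [centrePoly]) (by simp [centrePoly]) hij h1 h2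
      ((planeMap_mem_lineAtInfinity _).2 hz)
  revert hz hw h
  refine Fin.cases (fun hz => (hz trivial).elim) (fun i hz => ?_) i
  refine Fin.cases (fun hw => (hw trivial).elim) (fun j hw h => ?_) j
  rcases lt_trichotomy i j with hij | hij | hij
  · exact (key hz hw ht h hij).elim
  · rw [hij]
  · exact (key hw hz ht.symm h.symm hij).elim

theorem continuousAt_planeMap (hB : IsOpen B) (hq : DifferentiableOn ℂ q B)
    (hr : DifferentiableOn ℂ r B) (j : Fin 4) {z : (ℂ × ℂ) × ℂ} (hz : z.2 ∈ B) :
    ContinuousAt (planeMap q r j) z := by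
  refine Fin.cases ?_ (fun i => ?_) j
  · exact ((Plane.std 0).continuousAt_symm trivial).comp continuousAt_fst
  · refine ((Plane.cornerChart i).continuousAt_symm ?_).comp
      (contDiffAt_cornerCoord hB hq hr i hz).continuousAt
    rw [Plane.cornerChart_target]
    trivial

end

/-! ### The total space of a family of glued surfaces -/

section

variable {q r : ℂ → ℂ} {B : Set ℂ}

theorem IsGluedBy.symm_mem_iff {X : Surface} {U : Set X}
    {ψ : Fin 4 → OpenPartialHomeomorph X (ℂ × ℂ)} {t : ℂ}
    (h : IsGluedBy U ψ coordDom (coord q r t)) (hψ : ∀ j, (ψ j).target = univ) (i : Fin 4)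
    (w : ℂ × ℂ) :
    (ψ i).symm w ∈ (ψ 0).source ↔ w ∈ affineCoordDom i := by
  have hw : w ∈ (ψ i).target := by rw [hψ]; trivial
  constructor
  · intro h0
    have hi := (ψ i).map_target hw
    have := (affineCoord_coord q r t i ((h.overlap i _ h0).1 hi)).1
    rwa [← h.transition i _ ⟨h0, hi⟩, (ψ i).right_inv hw] at this
  · intro hi
    obtain ⟨h1, h2⟩ := coord_affineCoord q r t i hi
    have hz : affineCoord q r t i w ∈ (ψ 0).target := by rw [hψ]; trivial
    have h3 := (ψ 0).map_target hz
    have h4 := (h.overlap i _ h3).2 (by rwa [(ψ 0).right_inv hz])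
    have h5 := h.transition i _ ⟨h3, h4⟩
    rw [(ψ 0).right_inv hz, h2] at h5
    rw [← h5, (ψ i).left_inv h4]
    exact h3

theorem IsGluedBy.apply_symm {X : Surface} {U : Set X}
    {ψ : Fin 4 → OpenPartialHomeomorph X (ℂ × ℂ)} {t : ℂ}
    (h : IsGluedBy U ψ coordDom (coord q r t)) (hψ : ∀ j, (ψ j).target = univ) (i : Fin 4)
    {w : ℂ × ℂ} (hw : w ∈ affineCoordDom i) :
    ψ 0 ((ψ i).symm w) = affineCoord q r t i w := by
  have h0 := (h.symm_mem_iff hψ i w).2 hw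
  have hw' : w ∈ (ψ i).target := by rw [hψ]; trivial
  have hi := (ψ i).map_target hw'
  have h1 := (affineCoord_coord q r t i ((h.overlap i _ h0).1 hi)).2
  rw [← h1, ← h.transition i _ ⟨h0, hi⟩, (ψ i).right_inv hw']

/-- The data from which the threefold is built: a family of glued surfaces. -/
structure Family (q r : ℂ → ℂ) (B : Set ℂ) where
  X : B → Surface
  U : ∀ t, Set (X t)
  ψ : ∀ t, Fin 4 → OpenPartialHomeomorph (X t) (ℂ × ℂ)
  target_eq : ∀ t j, (ψ t j).target = univ
  glued : ∀ t, IsGluedBy (U t) (ψ t) coordDom (coord q r t)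

namespace Family

variable (F : Family q r B)

/-- The points of the threefold. -/
def Points : Type := {p : Σ t : B, F.X t // p.2 ∈ F.U p.1}

theorem symm_mem (t : B) (j : Fin 4) (w : ℂ × ℂ) : (F.ψ t j).symm w ∈ F.U t := by
  rw [← (F.glued t).cover]
  exact mem_iUnion.2 ⟨j, (F.ψ t j).map_target (by rw [F.target_eq]; trivial)⟩

/-- The point with given coordinates. -/
def point (j : Fin 4) (w : ℂ × ℂ) (t : B) : F.Points :=
  ⟨⟨t, (F.ψ t j).symm w⟩, F.symm_mem t j w⟩

open Classical in
/-- The coordinates `(x_j, y_j, t)`. -/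
def chart [Nonempty B] (j : Fin 4) : PartialEquiv F.Points ((ℂ × ℂ) × ℂ) where
  toFun p := (F.ψ p.1.1 j p.1.2, p.1.1)
  -- The arbitrary time is used only for points outside the target.
  invFun z := F.point j z.1 (if h : z.2 ∈ B then ⟨z.2, h⟩ else Classical.arbitrary B)
  source := {p | p.1.2 ∈ (F.ψ p.1.1 j).source}
  target := univ ×ˢ B
  map_source' p _ := ⟨trivial, p.1.1.2⟩
  map_target' z _ := (F.ψ _ j).map_target (by rw [F.target_eq]; trivial)
  left_inv' := by
    rintro ⟨⟨t, x⟩, hx⟩ h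
    change F.point j (F.ψ t j x) (if h : (t : ℂ) ∈ B then ⟨t, h⟩ else Classical.arbitrary B) = _
    rw [dif_pos t.2]
    exact Subtype.ext (Sigma.ext rfl (heq_of_eq ((F.ψ t j).left_inv h)))
  right_inv' := by
    rintro ⟨w, t⟩ ⟨-, ht⟩
    simp only [point]
    rw [dif_pos ht]
    exact Prod.ext ((F.ψ _ j).right_inv (by rw [F.target_eq]; trivial)) rfl

variable [Nonempty B]

theorem exists_mem_chart (p : F.Points) : ∃ j, p ∈ (F.chart j).source := by
  have h : p.1.2 ∈ ⋃ j, (F.ψ p.1.1 j).source := by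
    rw [(F.glued _).cover]
    exact p.2
  obtain ⟨j, hj⟩ := mem_iUnion.1 h
  exact ⟨j, hj⟩

theorem chart_symm (j : Fin 4) (w : ℂ × ℂ) (t : B) : (F.chart j).symm (w, t) = F.point j w t := by
  change F.point j w _ = _
  simp

theorem point_mem_iff (i j : Fin 4) (w : ℂ × ℂ) (t : B) :
    F.point i w t ∈ (F.chart j).source ↔ (F.ψ t i).symm w ∈ (F.ψ t j).source := Iff.rfl

theorem chart_point (i j : Fin 4) (w : ℂ × ℂ) (t : B) :
    F.chart j (F.point i w t) = (F.ψ t j ((F.ψ t i).symm w), (t : ℂ)) := rfl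

theorem point_mem_iff_of_ne {i j : Fin 4} (hij : i ≠ j) (w : ℂ × ℂ) (t : B) :
    F.point i w t ∈ (F.chart j).source ↔
      w ∈ affineCoordDom i ∧ affineCoord q r t i w ∈ coordDom j := by
  rw [point_mem_iff]
  have hi := (F.ψ t i).map_target (x := w) (by rw [F.target_eq]; trivial)
  constructor
  · intro hj
    have h0 := (F.glued t).inter i j hij ⟨hi, hj⟩
    have hw := ((F.glued t).symm_mem_iff (F.target_eq t) i w).1 h0
    refine ⟨hw, ?_⟩
    rw [← (F.glued t).apply_symm (F.target_eq t) i hw]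
    exact ((F.glued t).overlap j _ h0).1 hj
  · rintro ⟨hw, hj⟩
    rw [← (F.glued t).apply_symm (F.target_eq t) i hw] at hj
    exact ((F.glued t).overlap j _ (((F.glued t).symm_mem_iff (F.target_eq t) i w).2 hw)).2 hj

theorem chart_point_of_mem {i j : Fin 4} {w : ℂ × ℂ} {t : B} (hw : w ∈ affineCoordDom i)
    (hj : F.point i w t ∈ (F.chart j).source) :
    F.chart j (F.point i w t) = coordT q r j (affineCoord q r t i w, t) := by
  rw [chart_point, (F.glued t).transition j _
    ⟨((F.glued t).symm_mem_iff (F.target_eq t) i w).2 hw, hj⟩,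
    (F.glued t).apply_symm (F.target_eq t) i hw]
  rfl

theorem transition_source {i j : Fin 4} (hij : i ≠ j) :
    ((F.chart i).symm.trans (F.chart j)).source =
      {z | z.2 ∈ B ∧ z.1 ∈ affineCoordDom i ∧ affineCoord q r z.2 i z.1 ∈ coordDom j} := by
  ext ⟨w, t⟩
  constructor
  · rintro ⟨⟨-, ht⟩, h⟩
    change (F.chart i).symm (w, t) ∈ (F.chart j).source at h
    rw [F.chart_symm i w ⟨t, ht⟩] at h
    exact ⟨ht, (F.point_mem_iff_of_ne hij w ⟨t, ht⟩).1 h⟩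
  · rintro ⟨ht, h⟩
    refine ⟨⟨trivial, ht⟩, ?_⟩
    change (F.chart i).symm (w, t) ∈ (F.chart j).source
    rw [F.chart_symm i w ⟨t, ht⟩]
    exact (F.point_mem_iff_of_ne hij w ⟨t, ht⟩).2 h

theorem transition_apply {i j : Fin 4} (hij : i ≠ j) {z : (ℂ × ℂ) × ℂ}
    (hz : z ∈ ((F.chart i).symm.trans (F.chart j)).source) :
    (F.chart i).symm.trans (F.chart j) z =
      coordT q r j (affineCoord q r z.2 i z.1, z.2) := by
  have hz' := hz
  rw [F.transition_source hij] at hz'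
  obtain ⟨ht, hw, -⟩ := hz'
  have h := hz.2
  obtain ⟨w, t⟩ := z
  change (F.chart i).symm (w, t) ∈ (F.chart j).source at h
  rw [F.chart_symm i w ⟨t, ht⟩] at h
  change F.chart j ((F.chart i).symm (w, t)) = _
  rw [F.chart_symm i w ⟨t, ht⟩, F.chart_point_of_mem hw h]

variable (hB : IsOpen B) (hq : DifferentiableOn ℂ q B) (hr : DifferentiableOn ℂ r B)

theorem isOpen_transition_source (hB : IsOpen B) (hq : DifferentiableOn ℂ q B)
    (hr : DifferentiableOn ℂ r B) {i j : Fin 4} (hij : i ≠ j) :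
    IsOpen ((F.chart i).symm.trans (F.chart j)).source := by
  rw [F.transition_source hij]
  have hO : IsOpen (affineCoordDom i ×ˢ B) := (isOpen_affineCoordDom i).prod hB
  have hc : ContinuousOn (fun z : (ℂ × ℂ) × ℂ => (affineCoord q r z.2 i z.1, z.2))
      (affineCoordDom i ×ˢ B) := fun z hz =>
    (contDiffAt_affineCoord hB hq hr i hz.1 hz.2).continuousAt.continuousWithinAt
  have := hc.isOpen_inter_preimage hO ((isOpen_coordDom j).prod isOpen_univ)
  convert this using 1
  ext z
  constructor
  · rintro ⟨h1, h2, h3⟩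
    exact ⟨⟨h2, h1⟩, h3, trivial⟩
  · rintro ⟨⟨h2, h1⟩, h3, -⟩
    exact ⟨h1, h2, h3⟩

/-- The holomorphic atlas of the threefold. -/
def atlas (hB : IsOpen B) (hq : DifferentiableOn ℂ q B) (hr : DifferentiableOn ℂ r B) :
    HolAtlas F.Points ((ℂ × ℂ) × ℂ) where
  ι := Fin 4
  e := F.chart
  cover := F.exists_mem_chart
  isOpen i j := by
    by_cases hij : i = j
    · subst hij
      rw [PartialEquiv.trans_source, PartialEquiv.symm_source]
      have : (F.chart i).target ∩ (F.chart i).symm ⁻¹' (F.chart i).source = (F.chart i).target :=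
        inter_eq_left.2 fun z hz => (F.chart i).map_target hz
      rw [this]
      exact isOpen_univ.prod hB
    · exact F.isOpen_transition_source hB hq hr hij
  contDiffOn i j := by
    by_cases hij : i = j
    · subst hij
      refine contDiffOn_id.congr fun z hz => ?_
      exact (F.chart i).right_inv hz.1
    · have h : ContDiffOn ℂ ω (fun z : (ℂ × ℂ) × ℂ =>
          coordT q r j (affineCoord q r z.2 i z.1, z.2))
          ((F.chart i).symm.trans (F.chart j)).source := by
        intro z hz
        rw [F.transition_source hij] at hz
        exact ((contDiffAt_coordT hB hq hr j (z := (affineCoord q r z.2 i z.1, z.2))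
          ⟨hz.2.2, hz.1⟩).comp z (contDiffAt_affineCoord hB hq hr i hz.2.1 hz.1)).contDiffWithinAt
      exact h.congr fun z hz => F.transition_apply hij hz

/-- The map to the product of the projective plane and the time domain. -/
def toPlane (p : F.Points) : Plane.surface × ℂ :=
  (planeMap q r (F.exists_mem_chart p).choose (F.chart (F.exists_mem_chart p).choose p), p.1.1)

theorem mem_chart_zero_iff {j : Fin 4} {p : F.Points} (hp : p ∈ (F.chart j).source) :
    p ∈ (F.chart 0).source ↔ (F.chart j p).1 ∈ affineCoordDom j := by
  obtain ⟨⟨t, x⟩, hx⟩ := p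
  have hp' : x ∈ (F.ψ t j).source := hp
  have := (F.glued t).symm_mem_iff (F.target_eq t) j (F.ψ t j x)
  rw [(F.ψ t j).left_inv hp'] at this
  exact this

theorem planeMap_chart_eq {i j : Fin 4} {p : F.Points} (hi : p ∈ (F.chart i).source)
    (hj : p ∈ (F.chart j).source) :
    planeMap q r i (F.chart i p) = planeMap q r j (F.chart j p) := by
  by_cases hij : i = j
  · rw [hij]
  · obtain ⟨⟨t, x⟩, hx⟩ := p
    have h0 : (⟨⟨t, x⟩, hx⟩ : F.Points) ∈ (F.chart 0).source :=
      (F.glued t).inter i j hij ⟨hi, hj⟩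
    have key : ∀ k, (⟨⟨t, x⟩, hx⟩ : F.Points) ∈ (F.chart k).source →
        planeMap q r k (F.chart k ⟨⟨t, x⟩, hx⟩) = (Plane.std 0).symm (F.ψ t 0 x) := by
      intro k hk
      have hk' : x ∈ (F.ψ t k).source := hk
      have hd := (F.mem_chart_zero_iff hk).1 h0
      rw [planeMap_eq k hd]
      have := (F.glued t).apply_symm (F.target_eq t) k hd
      change F.ψ t 0 ((F.ψ t k).symm (F.ψ t k x)) = affineCoord q r t k (F.ψ t k x) at this
      rw [(F.ψ t k).left_inv hk'] at this
      rw [this]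
      rfl
    rw [key i hi, key j hj]

theorem toPlane_eq {j : Fin 4} {p : F.Points} (hp : p ∈ (F.chart j).source) :
    F.toPlane p = (planeMap q r j (F.chart j p), (p.1.1 : ℂ)) :=
  Prod.ext (F.planeMap_chart_eq (F.exists_mem_chart p).choose_spec hp) rfl

/-- Two points with the same image in the product of the plane and the time axis belong to the same
time. Either both are affine and lie in chart 0, or both map to the line at infinity and
`planeMap_injective_index` puts them in the same chart. -/
theorem t2 : @T2Space F.Points (F.atlas hB hq hr).top := by
  refine (F.atlas hB hq hr).t2Space_of_map F.toPlane ?_ ?_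
  · intro j
    have h : ContinuousOn (fun z : (ℂ × ℂ) × ℂ => (planeMap q r j z, z.2)) (F.chart j).target :=
      fun z hz => ((continuousAt_planeMap hB hq hr j hz.2).prodMk
        continuousAt_snd).continuousWithinAt
    refine h.congr fun z hz => ?_
    change F.toPlane ((F.chart j).symm z) = _
    rw [F.toPlane_eq ((F.chart j).map_target hz)]
    have h2 := (F.chart j).right_inv hz
    exact Prod.ext (congrArg (planeMap q r j) h2) (congrArg (fun z : (ℂ × ℂ) × ℂ => z.2) h2)
  · intro x y hxy
    obtain ⟨i, hi⟩ := F.exists_mem_chart x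
    obtain ⟨j, hj⟩ := F.exists_mem_chart y
    rw [F.toPlane_eq hi, F.toPlane_eq hj] at hxy
    obtain ⟨h1, h2⟩ := Prod.ext_iff.1 hxy
    simp only at h1 h2
    have hm := planeMap_mem_lineAtInfinity (q := q) (r := r) i (z := F.chart i x)
    rw [h1, planeMap_mem_lineAtInfinity, ← F.mem_chart_zero_iff hi, ← F.mem_chart_zero_iff hj,
      not_iff_not] at hm
    by_cases h0 : x ∈ (F.chart 0).source
    · exact ⟨(0 : Fin 4), h0, hm.2 h0⟩
    · obtain rfl := planeMap_injective_index (mt (F.mem_chart_zero_iff hi).2 h0)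
        (mt (F.mem_chart_zero_iff hj).2 (mt hm.1 h0)) h2 h1
      exact ⟨i, hi, hj⟩

/-- The threefold. -/
def threefold : Threefold := (F.atlas hB hq hr).toManifold (F.t2 hB hq hr)

/-- The charts of the threefold. -/
def threefoldChart (j : Fin 4) :
    OpenPartialHomeomorph (F.threefold hB hq hr) ((ℂ × ℂ) × ℂ) :=
  (F.atlas hB hq hr).chart (F.t2 hB hq hr) j

theorem threefold_isGluedBy :
    IsGluedBy univ (F.threefoldChart hB hq hr) (coordTDom B) (coordT q r) where
  cover := eq_univ_of_forall fun p => mem_iUnion.2 ((F.atlas hB hq hr).cover p)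
  overlap j := by
    rintro ⟨⟨t, x⟩, hx⟩ h0
    exact ((F.glued t).overlap j x h0).trans ⟨fun h => ⟨h, t.2⟩, fun h => h.1⟩
  transition j := by
    rintro ⟨⟨t, x⟩, hx⟩ ⟨h0, hj⟩
    exact Prod.ext ((F.glued t).transition j x ⟨h0, hj⟩) rfl
  inter i j hij := by
    rintro ⟨⟨t, x⟩, hx⟩ ⟨hi, hj⟩
    exact (F.glued t).inter i j hij ⟨hi, hj⟩

theorem exists_fibre_map (t : B) : ∃ e : F.threefold hB hq hr → F.X t,
    ∀ j, ∀ p ∈ (F.threefoldChart hB hq hr j).source, (F.threefoldChart hB hq hr j p).2 = t →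
      e p ∈ (F.ψ t j).source ∧ F.ψ t j (e p) = (F.threefoldChart hB hq hr j p).1 := by
  classical
  -- The value outside the fibre over t is arbitrary.
  refine ⟨fun p => if h : p.1.1 = t then h ▸ p.1.2 else (F.ψ t 0).symm 0, ?_⟩
  rintro j ⟨⟨t', x⟩, hx⟩ hp ht
  obtain rfl : t' = t := Subtype.ext ht
  simp only [dif_pos]
  exact ⟨hp, rfl⟩

end Family

theorem exists_threefold [Nonempty B] (F : Family q r B) (hB : IsOpen B)
    (hq : DifferentiableOn ℂ q B) (hr : DifferentiableOn ℂ r B) :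
    ∃ (P : Threefold) (φ : Fin 4 → OpenPartialHomeomorph P ((ℂ × ℂ) × ℂ)),
      (∀ j, IsHolChart P (φ j) ∧ (φ j).target = univ ×ˢ B) ∧
      IsGluedBy univ φ (coordTDom B) (coordT q r) ∧
      (∀ t : B, ∃ e : P → F.X t, ∀ j, ∀ p ∈ (φ j).source, (φ j p).2 = t →
        e p ∈ (F.ψ t j).source ∧ F.ψ t j (e p) = (φ j p).1) :=
  ⟨F.threefold hB hq hr, F.threefoldChart hB hq hr,
    fun j => ⟨(F.atlas hB hq hr).isHolChart (F.t2 hB hq hr) j, rfl⟩,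
    F.threefold_isGluedBy hB hq hr, F.exists_fibre_map hB hq hr⟩

end

/-! ### The system in the four charts -/

section

variable {q r : ℂ → ℂ} {B : Set ℂ}

theorem hasDerivAt_coefficients (hB : IsOpen B) (hq : DifferentiableOn ℂ q B)
    (hr : DifferentiableOn ℂ r B) {t : ℂ} (ht : t ∈ B) :
    HasDerivAt q (deriv q t) t ∧ HasDerivAt r (deriv r t) t ∧
    HasDerivAt (deriv q) (iteratedDeriv 2 q t) t ∧ HasDerivAt (deriv r) (deriv (deriv r) t) t ∧
    HasDerivAt (iteratedDeriv 2 q) (deriv (iteratedDeriv 2 q) t) t := by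
  obtain ⟨h1, h2, h3, h4, h5⟩ := contDiffAt_coefficients hB hq hr ht
  have key : ∀ {f : ℂ → ℂ}, ContDiffAt ℂ ω f t → HasDerivAt f (deriv f t) t := fun h =>
    (h.differentiableAt (by simp)).hasDerivAt
  refine ⟨key h1, key h2, ?_, key h4, key h5⟩
  have := key h3
  rwa [iteratedDeriv_succ, iteratedDeriv_one]

/-- The chain rule for the coordinates along a curve that is tangent to the vector field. -/
theorem hasDerivAt_coordT (hB : IsOpen B) (hq : DifferentiableOn ℂ q B)
    (hr : DifferentiableOn ℂ r B) (j : Fin 4) {c : ℂ → (ℂ × ℂ) × ℂ} {s : ℂ}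
    (hc : HasDerivAt c (field q r (c s)) s) (hs : c s ∈ coordTDom B j) :
    HasDerivAt (fun s => coordT q r j (c s)) (fderiv ℂ (coordT q r j) (c s) (field q r (c s))) s :=
  ((contDiffAt_coordT hB hq hr j hs).differentiableAt (by simp)).hasFDerivAt.comp_hasDerivAt s hc

theorem hasDerivAt_line (a b : ℂ) : HasDerivAt (fun s : ℂ => a + s * b) b 0 := by
  simpa using ((hasDerivAt_id (0 : ℂ)).mul_const b).const_add a

theorem hasDerivAt_shift {f : ℂ → ℂ} {f' t : ℂ} (hf : HasDerivAt f f' t) :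
    HasDerivAt (fun s : ℂ => f (t + s)) f' 0 := by
  have : HasDerivAt f f' (t + 0) := by rwa [add_zero]
  simpa using this.comp_const_add t 0

/-- The derivative in the direction of the field can be taken along the straight line with that
velocity, which makes it a derivative in one variable and needs no solution of the system. -/
theorem fderiv_coordT_eq (hB : IsOpen B) (hq : DifferentiableOn ℂ q B)
    (hr : DifferentiableOn ℂ r B) (j : Fin 4) {z : (ℂ × ℂ) × ℂ} (hz : z ∈ coordTDom B j)
    {a : ℂ × ℂ}
    (h : HasDerivAt (fun s => coord q r (z.2 + s) j
      (z.1.1 + s * (rhs q r z).1, z.1.2 + s * (rhs q r z).2)) a 0) :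
    fderiv ℂ (coordT q r j) z (field q r z) = (a, 1) := by
  have hid' : HasDerivAt (fun s : ℂ => z.2 + s) 1 0 := by
    simpa using (hasDerivAt_id (0 : ℂ)).const_add z.2
  have hc : HasDerivAt (fun s : ℂ => ((z.1.1 + s * (rhs q r z).1, z.1.2 + s * (rhs q r z).2),
      z.2 + s)) (field q r z) 0 :=
    ((hasDerivAt_line _ _).prodMk (hasDerivAt_line _ _)).prodMk hid'
  have h0 : ((z.1.1 + 0 * (rhs q r z).1, z.1.2 + 0 * (rhs q r z).2), z.2 + 0) = z := by simp
  have h2 := HasFDerivAt.comp_hasDerivAt_of_eq (0 : ℂ)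
    ((contDiffAt_coordT hB hq hr j hz).differentiableAt (by simp)).hasFDerivAt hc h0.symm
  exact h2.unique (h.prodMk hid')

/-- The right-hand sides in the four charts, up to a multiple of `1 / x_1`, `1 / x_2`, `1 / y_3`. -/
def chartRhs (q r : ℂ → ℂ) (j : Fin 4) (X Y t : ℂ) : ℂ × ℂ :=
  match j with
  | 0 => rhs q r ((X, Y), t)
  | 1 => (1 - 4 * q t * X + 3 * r t * X ^ 2 - X ^ 2 * Y,
      2 * q t * Y - 3 * r t * X * Y + 2 / 3 * X * Y ^ 2)
  | 2 => (-1 / 2 + 2 * q t * X + (-3 / 2 * r t - 6 * deriv q t) * X ^ 2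
        + (9 * deriv r t + 12 * iteratedDeriv 2 q t) * X ^ 3 + X ^ 4 * Y,
      (81 / 2 * r t * deriv r t + 54 * iteratedDeriv 2 q t * r t + 126 * deriv q t * deriv r t
          + 168 * deriv q t * iteratedDeriv 2 q t)
        - 4 * q t * Y
        + (-135 * deriv r t ^ 2 - 360 * iteratedDeriv 2 q t * deriv r t
          - 240 * iteratedDeriv 2 q t ^ 2) * X
        + (6 * r t + 20 * deriv q t) * X * Y
        + (-39 * deriv r t - 52 * iteratedDeriv 2 q t) * X ^ 2 * Y
        - 8 / 3 * X ^ 3 * Y ^ 2)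
  | 3 => (81 / 2 * q t * r t ^ 2 + 48 * q t ^ 3 * r t - 72 * q t ^ 2 * deriv r t
          + 72 * q t * deriv q t * r t - 108 * deriv q t * deriv r t + 81 / 2 * r t * deriv r t
        + (-243 / 4 * r t ^ 3 - 297 * q t ^ 2 * r t ^ 2 + 567 / 2 * q t * r t * deriv r t
          + 243 * deriv r t ^ 2) * Y
        + (486 * q t * r t ^ 3 - 729 * r t ^ 2 * deriv r t + 540 * q t ^ 3 * r t ^ 2
          - 1620 * q t ^ 2 * r t * deriv r t + 1215 * q t * deriv r t ^ 2) * Y ^ 2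
        + (-1215 * q t ^ 2 * r t ^ 3 + 3645 * q t * r t ^ 2 * deriv r t
          - 10935 / 4 * r t * deriv r t ^ 2) * Y ^ 3
        + (972 * q t ^ 3 * r t ^ 3 - 4374 * q t ^ 2 * r t ^ 2 * deriv r t
          + 6561 * q t * r t * deriv r t ^ 2 - 6561 / 2 * deriv r t ^ 3) * Y ^ 4
        + (2 * q t + (-3 * r t + 8 * q t ^ 2 + 12 * deriv q t) * Y
          + (-30 * q t * r t - 45 * deriv r t) * Y ^ 2
          + (135 / 2 * r t ^ 2 + 150 * q t ^ 2 * r t - 225 * q t * deriv r t) * Y ^ 3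
          + (-324 * q t * r t ^ 2 + 486 * r t * deriv r t) * Y ^ 4
          + (378 * q t ^ 2 * r t ^ 2 - 1134 * q t * r t * deriv r t
            + 1701 / 2 * deriv r t ^ 2) * Y ^ 5) * X
        + (2 * Y ^ 3 + 10 * q t * Y ^ 4 - 21 * r t * Y ^ 5
          + (48 * q t * r t - 72 * deriv r t) * Y ^ 6) * X ^ 2
        + 2 * Y ^ 7 * X ^ 3,
      1 / 3 - 2 / 3 * q t * Y + (-8 / 3 * q t ^ 2 - 4 * deriv q t) * Y ^ 2
        + (9 * q t * r t + 9 * deriv r t) * Y ^ 3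
        + (-27 / 2 * r t ^ 2 - 30 * q t ^ 2 * r t + 45 * q t * deriv r t) * Y ^ 4
        + (54 * q t * r t ^ 2 - 81 * r t * deriv r t) * Y ^ 5
        + (-54 * q t ^ 2 * r t ^ 2 + 162 * q t * r t * deriv r t
          - 243 / 2 * deriv r t ^ 2) * Y ^ 6
        - 2 / 3 * X * Y ^ 4 - 10 / 3 * q t * X * Y ^ 5 + 6 * r t * X * Y ^ 6
        + (-12 * q t * r t + 18 * deriv r t) * X * Y ^ 7 - 2 / 3 * X ^ 2 * Y ^ 8)

/-- The coefficient of `1 / x_2` in the chart `j = 2`. -/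
def obstruction₂ (q r : ℂ → ℂ) (t : ℂ) : ℂ :=
  -12 * deriv (iteratedDeriv 2 q) t - 9 * deriv (deriv r) t
    - 18 * (deriv q t * r t + q t * deriv r t) - 24 * (deriv q t ^ 2 + q t * iteratedDeriv 2 q t)

/-- The coefficient of `1 / y_3` in the chart `j = 3`. -/
def obstruction₃ (q r : ℂ → ℂ) (t : ℂ) : ℂ :=
  27 / 2 * deriv (deriv r) t - 27 * (deriv q t * r t + q t * deriv r t)

theorem fderiv_coordT_zero (hB : IsOpen B) (hq : DifferentiableOn ℂ q B)
    (hr : DifferentiableOn ℂ r B) {z : (ℂ × ℂ) × ℂ} (hz : z.2 ∈ B) :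
    fderiv ℂ (coordT q r 0) z (field q r z) = (rhs q r z, 1) := by
  refine fderiv_coordT_eq hB hq hr 0 ⟨trivial, hz⟩ ?_
  exact (hasDerivAt_line _ _).prodMk (hasDerivAt_line _ _)

theorem fderiv_coordT_one (hB : IsOpen B) (hq : DifferentiableOn ℂ q B)
    (hr : DifferentiableOn ℂ r B) {z : (ℂ × ℂ) × ℂ} (hz : z ∈ coordTDom B 1) :
    fderiv ℂ (coordT q r 1) z (field q r z) =
      (chartRhs q r 1 (coord q r z.2 1 z.1).1 (coord q r z.2 1 z.1).2 z.2, 1) := by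
  refine fderiv_coordT_eq hB hq hr 1 hz ?_
  obtain ⟨h1, h2, h3, h4, h5⟩ := hasDerivAt_coefficients hB hq hr hz.2
  obtain ⟨⟨x, y⟩, t⟩ := z
  have hx : x ≠ 0 := hz.1
  have hx0 : x + 0 * (rhs q r ((x, y), t)).1 ≠ 0 := by rwa [zero_mul, add_zero]
  have dx := hasDerivAt_line x (rhs q r ((x, y), t)).1
  have dy := hasDerivAt_line y (rhs q r ((x, y), t)).2
  have dX := (hasDerivAt_const (0 : ℂ) (1 : ℂ)).fun_div dx hx0
  have dY := ((dy.fun_add dx).fun_sub ((hasDerivAt_shift h1).const_mul 4)).fun_mul dx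
  refine (dX.prodMk dY).congr_deriv ?_
  simp only [chartRhs, coord, rhs, zero_mul, add_zero]
  ext1
  · field_simp
    ring
  · field_simp
    ring

/-- The choice of the centres cancels all poles in X = 1/x except one simple pole, whose coefficient
depends on t alone. The same happens in chart 3 with 1/y, whereas chart 1 has no such term. -/
theorem fderiv_coordT_two (hB : IsOpen B) (hq : DifferentiableOn ℂ q B)
    (hr : DifferentiableOn ℂ r B) {z : (ℂ × ℂ) × ℂ} (hz : z ∈ coordTDom B 2) :
    fderiv ℂ (coordT q r 2) z (field q r z) =
      (chartRhs q r 2 (coord q r z.2 2 z.1).1 (coord q r z.2 2 z.1).2 z.2 +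
        (0, obstruction₂ q r z.2 / (coord q r z.2 2 z.1).1), 1) := by
  refine fderiv_coordT_eq hB hq hr 2 hz ?_
  obtain ⟨h1, h2, h3, h4, h5⟩ := hasDerivAt_coefficients hB hq hr hz.2
  obtain ⟨⟨x, y⟩, t⟩ := z
  have hx : x ≠ 0 := hz.1
  have hx0 : x + 0 * (rhs q r ((x, y), t)).1 ≠ 0 := by rwa [zero_mul, add_zero]
  have dx := hasDerivAt_line x (rhs q r ((x, y), t)).1
  have dy := hasDerivAt_line y (rhs q r ((x, y), t)).2
  have dX := (hasDerivAt_const (0 : ℂ) (1 : ℂ)).fun_div dx hx0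
  have dU := ((((dy.fun_sub (dx.div_const 2)).fun_add ((hasDerivAt_shift h1).const_mul 2)).fun_mul
    dx).fun_sub (((hasDerivAt_shift h2).const_mul 9).div_const 2)).fun_sub
    ((hasDerivAt_shift h3).const_mul 6)
  have dV := (((dU.fun_mul dx).fun_add ((hasDerivAt_shift h4).const_mul 9)).fun_add
    ((hasDerivAt_shift h5).const_mul 12)).fun_neg.fun_mul dx
  refine (dX.prodMk dV).congr_deriv ?_
  simp only [chartRhs, coord, rhs, zero_mul, add_zero, obstruction₂]
  ext1
  · simp only [Prod.fst_add]
    field_simp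
    ring
  · simp only [Prod.snd_add]
    field_simp
    ring

theorem fderiv_coordT_three (hB : IsOpen B) (hq : DifferentiableOn ℂ q B)
    (hr : DifferentiableOn ℂ r B) {z : (ℂ × ℂ) × ℂ} (hz : z ∈ coordTDom B 3) :
    fderiv ℂ (coordT q r 3) z (field q r z) =
      (chartRhs q r 3 (coord q r z.2 3 z.1).1 (coord q r z.2 3 z.1).2 z.2 +
        (obstruction₃ q r z.2 / (coord q r z.2 3 z.1).2, 0), 1) := by
  refine fderiv_coordT_eq hB hq hr 3 hz ?_
  obtain ⟨h1, h2, h3, h4, h5⟩ := hasDerivAt_coefficients hB hq hr hz.2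
  obtain ⟨⟨x, y⟩, t⟩ := z
  have hy : y ≠ 0 := hz.1
  have hy0 : y + 0 * (rhs q r ((x, y), t)).2 ≠ 0 := by rwa [zero_mul, add_zero]
  have dx := hasDerivAt_line x (rhs q r ((x, y), t)).1
  have dy := hasDerivAt_line y (rhs q r ((x, y), t)).2
  have dY := (hasDerivAt_const (0 : ℂ) (1 : ℂ)).fun_div dy hy0
  have dU := (((dx.fun_mul dy).fun_sub (((hasDerivAt_shift h2).const_mul 9).div_const 2)).fun_mul
    dy).fun_add (((((hasDerivAt_shift h1).const_mul 18).fun_mul (hasDerivAt_shift h2)).fun_sub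
      ((hasDerivAt_shift h4).const_mul 27)).div_const 2)
  have dX := dU.fun_neg.fun_mul dy
  refine (dX.prodMk dY).congr_deriv ?_
  simp only [chartRhs, coord, rhs, zero_mul, add_zero, obstruction₃]
  ext1
  · simp only [Prod.fst_add]
    field_simp
    ring
  · simp only [Prod.snd_add]
    field_simp
    ring

end

/-! ### The condition on the coefficients -/

section

variable {q r : ℂ → ℂ} {B : Set ℂ}

/-- Multiplying by X and letting X tend to 0 isolates c. -/
theorem eq_zero_of_continuous_eq {f g : ℂ → ℂ} {c : ℂ} (hf : Continuous f) (hg : Continuous g)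
    (h : ∀ X, X ≠ 0 → f X = g X + c / X) : c = 0 := by
  have h1 : Tendsto (fun X => X * (f X - g X)) (𝓝[≠] 0) (𝓝 0) := by
    have : Continuous fun X => X * (f X - g X) := by fun_prop
    simpa using (this.tendsto 0).mono_left (nhdsWithin_le_nhds (s := {0}ᶜ))
  refine tendsto_nhds_unique (tendsto_const_nhds.congr' ?_) h1
  filter_upwards [self_mem_nhdsWithin] with X hX
  have hX' : X ≠ 0 := hX
  rw [h X hX']
  field_simp
  ring

/-- Restricted to the line Y = 0 at time t, the holomorphic extension is continuous at X = 0 and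
leaves no room for the pole. -/
theorem obstruction₂_eq_zero (hB : IsOpen B) (hq : DifferentiableOn ℂ q B)
    (hr : DifferentiableOn ℂ r B) (h : HolomorphicInChart q r B 2) {t : ℂ} (ht : t ∈ B) :
    obstruction₂ q r t = 0 := by
  obtain ⟨F, hF, hFz⟩ := h
  have hc : Continuous fun X : ℂ => (F ((X, 0), t)).1.2 := by
    have : Continuous fun X : ℂ => F ((X, 0), t) :=
      hF.continuousOn.comp_continuous (by fun_prop) fun X => ⟨trivial, ht⟩
    exact this.fst.snd
  refine eq_zero_of_continuous_eq (g := fun X => (chartRhs q r 2 X 0 t).2) hc ?_ fun X hX => ?_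
  · simp only [chartRhs]
    fun_prop
  · obtain ⟨h1, h2⟩ := coord_affineCoord q r t 2 (w := (X, 0)) hX
    have hz : (affineCoord q r t 2 (X, 0), t) ∈ coordTDom B 2 := ⟨h1, ht⟩
    have h3 := hFz _ hz
    rw [fderiv_coordT_two hB hq hr hz, coordT] at h3
    simp only [h2] at h3
    exact (congrArg (fun z : (ℂ × ℂ) × ℂ => z.1.2) h3).symm

theorem obstruction₃_eq_zero (hB : IsOpen B) (hq : DifferentiableOn ℂ q B)
    (hr : DifferentiableOn ℂ r B) (h : HolomorphicInChart q r B 3) {t : ℂ} (ht : t ∈ B) :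
    obstruction₃ q r t = 0 := by
  obtain ⟨F, hF, hFz⟩ := h
  have hc : Continuous fun Y : ℂ => (F ((0, Y), t)).1.1 := by
    have : Continuous fun Y : ℂ => F ((0, Y), t) :=
      hF.continuousOn.comp_continuous (by fun_prop) fun X => ⟨trivial, ht⟩
    exact this.fst.fst
  refine eq_zero_of_continuous_eq (g := fun Y => (chartRhs q r 3 0 Y t).1) hc ?_ fun Y hY => ?_
  · simp only [chartRhs]
    fun_prop
  · obtain ⟨h1, h2⟩ := coord_affineCoord q r t 3 (w := (0, Y)) hY
    have hz : (affineCoord q r t 3 (0, Y), t) ∈ coordTDom B 3 := ⟨h1, ht⟩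
    have h3 := hFz _ hz
    rw [fderiv_coordT_three hB hq hr hz, coordT] at h3
    simp only [h2] at h3
    exact (congrArg (fun z : (ℂ × ℂ) × ℂ => z.1.1) h3).symm

theorem exists_eq_const (hB : IsOpen B) (hBc : IsConnected B) {f : ℂ → ℂ}
    (hf : ∀ t ∈ B, HasDerivAt f 0 t) : ∃ c, ∀ t ∈ B, f t = c := by
  obtain ⟨t₀, ht₀⟩ := hBc.nonempty
  refine ⟨f t₀, fun t ht => ?_⟩
  exact hB.is_const_of_deriv_eq_zero hBc.isPreconnected
    (fun t ht => (hf t ht).differentiableAt.differentiableWithinAt)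
    (fun t ht => (hf t ht).deriv) ht ht₀

/-- The obstructions are total derivatives: `obstruction₃` is 27/2 times the derivative of r' - 2qr,
and the derivative of q'' + 2qq' + 3qr is -1/12 of `obstruction₂` minus 1/18 of `obstruction₃`. Both
functions are therefore constant on the connected set B. -/
theorem constraint_of_holomorphicInChart (hB : IsOpen B) (hBc : IsConnected B)
    (hq : DifferentiableOn ℂ q B) (hr : DifferentiableOn ℂ r B)
    (h : ∀ j, HolomorphicInChart q r B j) : Constraint q r B := by
  have hr2 : ∀ t ∈ B, HasDerivAt (fun t => deriv r t - 2 * (q t * r t)) 0 t := by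
    intro t ht
    obtain ⟨h1, h2, h3, h4, h5⟩ := hasDerivAt_coefficients hB hq hr ht
    refine (h4.fun_sub ((h1.fun_mul h2).const_mul 2)).congr_deriv ?_
    have := obstruction₃_eq_zero hB hq hr (h 3) ht
    rw [obstruction₃] at this
    linear_combination 2 / 27 * this
  have hq3 : ∀ t ∈ B, HasDerivAt
      (fun t => iteratedDeriv 2 q t + 2 * (q t * deriv q t) + 3 * (q t * r t)) 0 t := by
    intro t ht
    obtain ⟨h1, h2, h3, h4, h5⟩ := hasDerivAt_coefficients hB hq hr ht
    refine ((h5.fun_add ((h1.fun_mul h3).const_mul 2)).fun_add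
      ((h1.fun_mul h2).const_mul 3)).congr_deriv ?_
    have e2 := obstruction₂_eq_zero hB hq hr (h 2) ht
    have e3 := obstruction₃_eq_zero hB hq hr (h 3) ht
    rw [obstruction₂] at e2
    rw [obstruction₃] at e3
    linear_combination -1 / 12 * e2 - 1 / 18 * e3
  obtain ⟨c₁, hc₁⟩ := exists_eq_const hB hBc hr2
  obtain ⟨d, hd⟩ := exists_eq_const hB hBc hq3
  -- The second constant solves -(3c₁ + c₂)/4 = d.
  refine ⟨c₁, -4 * d - 3 * c₁, fun t ht => ⟨?_, ?_⟩⟩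
  · linear_combination hd t ht
  · linear_combination hc₁ t ht

theorem Constraint.obstruction_eq_zero (h : Constraint q r B) (hB : IsOpen B)
    (hq : DifferentiableOn ℂ q B) (hr : DifferentiableOn ℂ r B) {t : ℂ} (ht : t ∈ B) :
    obstruction₂ q r t = 0 ∧ obstruction₃ q r t = 0 := by
  obtain ⟨c₁, c₂, hc⟩ := h
  obtain ⟨h1, h2, h3, h4, h5⟩ := hasDerivAt_coefficients hB hq hr ht
  have e3 : deriv (deriv r) t = 2 * (deriv q t * r t + q t * deriv r t) := by
    refine h4.unique ?_
    refine HasDerivAt.congr_of_eventuallyEq (f := fun t => 2 * (q t * r t) + c₁)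
      (((h1.fun_mul h2).const_mul 2).add_const c₁) ?_
    filter_upwards [hB.mem_nhds ht] with s hs
    linear_combination (hc s hs).2
  have e2 : deriv (iteratedDeriv 2 q) t = -2 * (deriv q t * deriv q t + q t * iteratedDeriv 2 q t)
      - 3 * (deriv q t * r t + q t * deriv r t) := by
    refine h5.unique ?_
    refine HasDerivAt.congr_of_eventuallyEq
      (f := fun t => -2 * (q t * deriv q t) - 3 * (q t * r t) - (3 * c₁ + c₂) / 4)
      ((((h1.fun_mul h3).const_mul (-2)).fun_sub ((h1.fun_mul h2).const_mul 3)).sub_const _) ?_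
    filter_upwards [hB.mem_nhds ht] with s hs
    linear_combination (hc s hs).1
  rw [obstruction₂, obstruction₃, e2, e3]
  constructor <;> ring

/-- The system in the four charts under the condition on the coefficients. -/
theorem Constraint.fderiv_coordT (h : Constraint q r B) (hB : IsOpen B)
    (hq : DifferentiableOn ℂ q B) (hr : DifferentiableOn ℂ r B) (j : Fin 4) {z : (ℂ × ℂ) × ℂ}
    (hz : z ∈ coordTDom B j) :
    fderiv ℂ (coordT q r j) z (field q r z) =
      (chartRhs q r j (coord q r z.2 j z.1).1 (coord q r z.2 j z.1).2 z.2, 1) := by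
  obtain ⟨h2, h3⟩ := h.obstruction_eq_zero hB hq hr hz.2
  fin_cases j
  · exact fderiv_coordT_zero hB hq hr hz.2
  · exact fderiv_coordT_one hB hq hr hz
  · refine (fderiv_coordT_two hB hq hr hz).trans ?_
    rw [h2, zero_div, ← Prod.zero_eq_mk, add_zero]
    rfl
  · refine (fderiv_coordT_three hB hq hr hz).trans ?_
    rw [h3, zero_div, ← Prod.zero_eq_mk, add_zero]
    rfl

/-! ### Polynomials with holomorphic coefficients -/

/-- `f` is a polynomial in its first two arguments, with coefficients that are holomorphic
functions of the third one. -/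
def IsPolynomial (B : Set ℂ) (f : ℂ → ℂ → ℂ → ℂ) : Prop :=
  ∃ P : MvPolynomial (Fin 2) (ℂ → ℂ), (∀ m, DifferentiableOn ℂ (P.coeff m) B) ∧
    ∀ X Y t, MvPolynomial.eval ![X, Y] (P.map (Pi.evalRingHom (fun _ => ℂ) t)) = f X Y t

namespace IsPolynomial

variable {f g : ℂ → ℂ → ℂ → ℂ}

theorem add (hf : IsPolynomial B f) (hg : IsPolynomial B g) :
    IsPolynomial B fun X Y t => f X Y t + g X Y t := by
  obtain ⟨P, hP, hPe⟩ := hf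
  obtain ⟨Q, hQ, hQe⟩ := hg
  refine ⟨P + Q, fun m => ?_, fun X Y t => ?_⟩
  · rw [MvPolynomial.coeff_add]
    exact (hP m).add (hQ m)
  · rw [map_add, map_add, hPe, hQe]

theorem mul (hf : IsPolynomial B f) (hg : IsPolynomial B g) :
    IsPolynomial B fun X Y t => f X Y t * g X Y t := by
  classical
  obtain ⟨P, hP, hPe⟩ := hf
  obtain ⟨Q, hQ, hQe⟩ := hg
  refine ⟨P * Q, fun m => ?_, fun X Y t => ?_⟩
  · rw [MvPolynomial.coeff_mul]
    exact DifferentiableOn.sum fun i _ => (hP i.1).mul (hQ i.2)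
  · rw [map_mul, map_mul, hPe, hQe]

theorem coefficient {a : ℂ → ℂ} (ha : DifferentiableOn ℂ a B) :
    IsPolynomial B fun _ _ t => a t := by
  classical
  refine ⟨MvPolynomial.C a, fun m => ?_, fun X Y t => ?_⟩
  · rw [MvPolynomial.coeff_C]
    split_ifs
    · exact ha
    · exact differentiableOn_const 0
  · rw [MvPolynomial.map_C, MvPolynomial.eval_C]
    rfl

theorem var (i : Fin 2) : IsPolynomial B fun X Y _ => ![X, Y] i := by
  classical
  refine ⟨MvPolynomial.X i, fun m => ?_, fun X Y t => ?_⟩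
  · rw [MvPolynomial.coeff_X]
    split_ifs
    · exact differentiableOn_const 1
    · exact differentiableOn_const 0
  · rw [MvPolynomial.map_X, MvPolynomial.eval_X]

theorem fst : IsPolynomial B fun X _ _ => X := var 0

theorem snd : IsPolynomial B fun _ Y _ => Y := var 1

theorem pow (hf : IsPolynomial B f) (n : ℕ) : IsPolynomial B fun X Y t => f X Y t ^ n := by
  induction n with
  | zero => simpa using coefficient (differentiableOn_const (1 : ℂ))
  | succ n ih =>
    simp only [pow_succ]
    exact ih.mul hf

theorem sub (hf : IsPolynomial B f) (hg : IsPolynomial B g) :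
    IsPolynomial B fun X Y t => f X Y t - g X Y t := by
  have := hf.add ((coefficient (differentiableOn_const (-1 : ℂ))).mul hg)
  simpa only [neg_one_mul, ← sub_eq_add_neg] using this

end IsPolynomial

theorem isPolynomial_chartRhs (hB : IsOpen B) (hq : DifferentiableOn ℂ q B)
    (hr : DifferentiableOn ℂ r B) (j : Fin 4) :
    (IsPolynomial B fun X Y t => (chartRhs q r j X Y t).1) ∧
      IsPolynomial B fun X Y t => (chartRhs q r j X Y t).2 := by
  have hd : ∀ {f : ℂ → ℂ}, (∀ t ∈ B, ContDiffAt ℂ ω f t) → DifferentiableOn ℂ f B :=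
    fun h t ht => ((h t ht).differentiableAt (by simp)).differentiableWithinAt
  have hq1 : DifferentiableOn ℂ (deriv q) B :=
    hd fun t ht => (contDiffAt_coefficients hB hq hr ht).2.2.1
  have hr1 : DifferentiableOn ℂ (deriv r) B :=
    hd fun t ht => (contDiffAt_coefficients hB hq hr ht).2.2.2.1
  have hq2 : DifferentiableOn ℂ (iteratedDeriv 2 q) B :=
    hd fun t ht => (contDiffAt_coefficients hB hq hr ht).2.2.2.2
  fin_cases j <;> constructor <;> simp only [chartRhs, rhs] <;>
    repeat' first
      | exact IsPolynomial.fst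
      | exact IsPolynomial.snd
      | exact IsPolynomial.coefficient (by fun_prop)
      | refine IsPolynomial.pow ?_ _
      | refine IsPolynomial.add ?_ ?_
      | refine IsPolynomial.sub ?_ ?_
      | refine IsPolynomial.mul ?_ ?_

theorem Constraint.polynomialInChart (h : Constraint q r B) (hB : IsOpen B)
    (hq : DifferentiableOn ℂ q B) (hr : DifferentiableOn ℂ r B) (j : Fin 4) :
    PolynomialInChart q r B j := by
  obtain ⟨⟨P, hP, hPe⟩, Q, hQ, hQe⟩ := isPolynomial_chartRhs hB hq hr j
  refine ⟨P, Q, hP, hQ, ?_⟩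
  rintro z hz _ rfl
  rw [h.fderiv_coordT hB hq hr j hz, hPe, hQe]
  rfl

end

/-! ### Limits of meromorphic functions -/

section

variable {f f' g : ℂ → ℂ} {t₀ : ℂ}

theorem meromorphicOrderAt_sub_mul (hf : MeromorphicAt f t₀) :
    meromorphicOrderAt (fun t => (t - t₀) * f t) t₀ = 1 + meromorphicOrderAt f t₀ := by
  have h : MeromorphicAt (fun t : ℂ => t - t₀) t₀ := by fun_prop
  rw [← meromorphicOrderAt_id_sub_const (x := t₀)]
  exact meromorphicOrderAt_mul h hf

/-- The order of f exceeds -1, and it is an integer or infinite, so it is not negative: a function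
with at most a simple pole and zero residue has a limit. -/
theorem exists_tendsto_of_sub_mul (hf : MeromorphicAt f t₀)
    (h : Tendsto (fun t => (t - t₀) * f t) (𝓝[≠] t₀) (𝓝 0)) :
    ∃ a, Tendsto f (𝓝[≠] t₀) (𝓝 a) := by
  have hm : MeromorphicAt (fun t => (t - t₀) * f t) t₀ := by fun_prop
  have h1 := (tendsto_zero_iff_meromorphicOrderAt_pos hm).1 h
  rw [meromorphicOrderAt_sub_mul hf] at h1
  refine (tendsto_nhds_iff_meromorphicOrderAt_nonneg hf).2 ?_
  cases hn : meromorphicOrderAt f t₀ with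
  | top => exact le_top
  | coe n =>
    rw [hn] at h1
    have h2 : (0 : ℤ) < 1 + n := by exact_mod_cast h1
    have h3 : (0 : ℤ) ≤ n := by omega
    exact_mod_cast h3

theorem order_eq_neg_one_of_sub_mul (hf : MeromorphicAt f t₀) {a : ℂ} (ha : a ≠ 0)
    (h : Tendsto (fun t => (t - t₀) * f t) (𝓝[≠] t₀) (𝓝 a)) :
    meromorphicOrderAt f t₀ = (-1 : ℤ) := by
  have hm : MeromorphicAt (fun t => (t - t₀) * f t) t₀ := by fun_prop
  have h1 := (tendsto_ne_zero_iff_meromorphicOrderAt_eq_zero hm).1 ⟨a, ha, h⟩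
  rw [meromorphicOrderAt_sub_mul hf] at h1
  cases hn : meromorphicOrderAt f t₀ with
  | top =>
    rw [hn] at h1
    exact absurd h1 (by simp)
  | coe n =>
    rw [hn] at h1
    have h2 : (1 : ℤ) + n = 0 := by exact_mod_cast h1
    have h3 : n = -1 := by omega
    rw [h3]

/-- The residue of the logarithmic derivative is the order. -/
theorem tendsto_sub_mul_logDeriv (hf : MeromorphicAt f t₀) {n : ℤ}
    (hn : meromorphicOrderAt f t₀ = n) (hd : ∀ᶠ t in 𝓝[≠] t₀, HasDerivAt f (f' t) t) :
    Tendsto (fun t => (t - t₀) * f' t / f t) (𝓝[≠] t₀) (𝓝 n) := by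
  obtain ⟨g, hg, hg0, hfg⟩ := (meromorphicOrderAt_eq_int_iff hf).1 hn
  have hga : ∀ᶠ t in 𝓝[≠] t₀, AnalyticAt ℂ g t := hg.eventually_analyticAt.filter_mono
    nhdsWithin_le_nhds
  have hgn : ∀ᶠ t in 𝓝[≠] t₀, g t ≠ 0 := (hg.continuousAt.eventually_ne hg0).filter_mono
    nhdsWithin_le_nhds
  have h1 : Tendsto (fun t => n + (t - t₀) * (deriv g t / g t)) (𝓝[≠] t₀) (𝓝 n) := by
    have h2 : ContinuousAt (fun t => n + (t - t₀) * (deriv g t / g t)) t₀ :=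
      continuousAt_const.add ((continuousAt_id.sub continuousAt_const).mul
        (hg.deriv.continuousAt.div hg.continuousAt hg0))
    have h3 := h2.tendsto.mono_left (nhdsWithin_le_nhds (s := {t₀}ᶜ))
    simpa using h3
  refine h1.congr' ?_
  filter_upwards [hga, hgn, hd, eventually_eventually_nhdsWithin.2 hfg, self_mem_nhdsWithin]
    with t hgt hgt0 hdt hfgt ht
  have ht0 : t - t₀ ≠ 0 := sub_ne_zero.2 ht
  have hfgt' : f =ᶠ[𝓝 t] fun s => (s - t₀) ^ n • g s := by
    rwa [isOpen_compl_singleton.nhdsWithin_eq ht] at hfgt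
  have hd' := (((hasDerivAt_zpow n (t - t₀) (.inl ht0)).comp_sub_const t t₀).fun_mul
    hgt.differentiableAt.hasDerivAt)
  have hu := hdt.unique (hd'.congr_of_eventuallyEq hfgt')
  rw [hu, hfgt'.eq_of_nhds, smul_eq_mul, zpow_sub_one₀ ht0]
  have := zpow_ne_zero n ht0
  field_simp

theorem exists_order_neg_of_not_tendsto (hf : MeromorphicAt f t₀)
    (h : ¬ ∃ a, Tendsto f (𝓝[≠] t₀) (𝓝 a)) :
    ∃ n : ℤ, n < 0 ∧ meromorphicOrderAt f t₀ = n := by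
  rw [tendsto_nhds_iff_meromorphicOrderAt_nonneg hf, not_le] at h
  cases hn : meromorphicOrderAt f t₀ with
  | top =>
    rw [hn] at h
    exact absurd h (by simp)
  | coe n =>
    rw [hn] at h
    exact ⟨n, by exact_mod_cast h, rfl⟩

theorem eventually_ne_zero_of_order (hf : MeromorphicAt f t₀) {n : ℤ}
    (hn : meromorphicOrderAt f t₀ = n) : ∀ᶠ t in 𝓝[≠] t₀, f t ≠ 0 :=
  (meromorphicOrderAt_ne_top_iff_eventually_ne_zero hf).1 (by rw [hn]; simp)

theorem tendsto_inv_zero_of_order_neg {n : ℤ} (hn : meromorphicOrderAt f t₀ = n) (h0 : n < 0) :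
    Tendsto (fun t => (f t)⁻¹) (𝓝[≠] t₀) (𝓝 0) :=
  tendsto_inv₀_cobounded.comp
    (tendsto_cobounded_of_meromorphicOrderAt_neg (by rw [hn]; exact_mod_cast h0))

theorem tendsto_sub_nhdsNE : Tendsto (fun t => t - t₀) (𝓝[≠] t₀) (𝓝 0) := by
  have : ContinuousAt (fun t : ℂ => t - t₀) t₀ := by fun_prop
  simpa using this.tendsto.mono_left (nhdsWithin_le_nhds (s := {t₀}ᶜ))

/-- Meromorphic solutions of linear equations with coefficients that have limits have limits. -/
theorem exists_tendsto_of_linear (hf : MeromorphicAt f t₀) {A C : ℂ → ℂ} {a c : ℂ}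
    (hA : Tendsto A (𝓝[≠] t₀) (𝓝 a)) (hC : Tendsto C (𝓝[≠] t₀) (𝓝 c))
    (hd : ∀ᶠ t in 𝓝[≠] t₀, HasDerivAt f (A t + C t * f t) t) :
    ∃ b, Tendsto f (𝓝[≠] t₀) (𝓝 b) := by
  by_contra h
  obtain ⟨n, hn, hfn⟩ := exists_order_neg_of_not_tendsto hf h
  -- At a pole the residue of f'/f would be the order n ≠ 0. But f'/f = A/f + C stays bounded
  -- because 1/f tends to 0.
  have h1 := tendsto_sub_mul_logDeriv hf hfn hd
  have h2 : Tendsto (fun t => (t - t₀) * (A t * (f t)⁻¹ + C t)) (𝓝[≠] t₀) (𝓝 0) := by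
    simpa using tendsto_sub_nhdsNE.mul ((hA.mul (tendsto_inv_zero_of_order_neg hfn hn)).add hC)
  have h3 : (n : ℂ) = 0 := by
    refine tendsto_nhds_unique h1 (h2.congr' ?_)
    filter_upwards [eventually_ne_zero_of_order hf hfn] with t ht
    field_simp
  exact hn.ne (by exact_mod_cast h3)

end

/-! ### Limits of meromorphic solutions -/

section

variable {q r : ℂ → ℂ} {B : Set ℂ} {t₀ : ℂ} {x y : ℂ → ℂ}

/-- The equations of a solution in the four charts. -/
theorem Constraint.hasDerivAt_coord (h : Constraint q r B) (hB : IsOpen B)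
    (hq : DifferentiableOn ℂ q B) (hr : DifferentiableOn ℂ r B) (j : Fin 4) {t : ℂ}
    (hx : HasDerivAt x (rhs q r ((x t, y t), t)).1 t)
    (hy : HasDerivAt y (rhs q r ((x t, y t), t)).2 t) (ht : t ∈ B)
    (hj : (x t, y t) ∈ coordDom j) :
    HasDerivAt (fun t => (coord q r t j (x t, y t)).1)
      (chartRhs q r j (coord q r t j (x t, y t)).1 (coord q r t j (x t, y t)).2 t).1 t ∧
    HasDerivAt (fun t => (coord q r t j (x t, y t)).2)
      (chartRhs q r j (coord q r t j (x t, y t)).1 (coord q r t j (x t, y t)).2 t).2 t := by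
  have hc : HasDerivAt (fun t => ((x t, y t), t)) (field q r ((x t, y t), t)) t :=
    (hx.prodMk hy).prodMk (hasDerivAt_id t)
  have := hasDerivAt_coordT hB hq hr j hc ⟨hj, ht⟩
  rw [h.fderiv_coordT hB hq hr j (z := ((x t, y t), t)) ⟨hj, ht⟩] at this
  have h1 : HasDerivAt (fun t => coord q r t j (x t, y t))
      (chartRhs q r j (coord q r t j (x t, y t)).1 (coord q r t j (x t, y t)).2 t) t :=
    (ContinuousLinearMap.fst ℂ (ℂ × ℂ) ℂ).hasFDerivAt.comp_hasDerivAt t this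
  exact ⟨(ContinuousLinearMap.fst ℂ ℂ ℂ).hasFDerivAt.comp_hasDerivAt t h1,
    (ContinuousLinearMap.snd ℂ ℂ ℂ).hasFDerivAt.comp_hasDerivAt t h1⟩

theorem tendsto_coefficients (hB : IsOpen B) (hq : DifferentiableOn ℂ q B)
    (hr : DifferentiableOn ℂ r B) (ht₀ : t₀ ∈ B) :
    Tendsto q (𝓝[≠] t₀) (𝓝 (q t₀)) ∧ Tendsto r (𝓝[≠] t₀) (𝓝 (r t₀)) ∧
    Tendsto (deriv q) (𝓝[≠] t₀) (𝓝 (deriv q t₀)) ∧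
    Tendsto (deriv r) (𝓝[≠] t₀) (𝓝 (deriv r t₀)) ∧
    Tendsto (iteratedDeriv 2 q) (𝓝[≠] t₀) (𝓝 (iteratedDeriv 2 q t₀)) := by
  obtain ⟨h1, h2, h3, h4, h5⟩ := contDiffAt_coefficients hB hq hr ht₀
  have key : ∀ {f : ℂ → ℂ}, ContDiffAt ℂ ω f t₀ → Tendsto f (𝓝[≠] t₀) (𝓝 (f t₀)) := fun h =>
    h.continuousAt.tendsto.mono_left nhdsWithin_le_nhds
  exact ⟨key h1, key h2, key h3, key h4, key h5⟩

theorem meromorphicAt_coefficients (hB : IsOpen B) (hq : DifferentiableOn ℂ q B)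
    (hr : DifferentiableOn ℂ r B) (ht₀ : t₀ ∈ B) :
    MeromorphicAt q t₀ ∧ MeromorphicAt r t₀ ∧ MeromorphicAt (deriv q) t₀ ∧
    MeromorphicAt (deriv r) t₀ ∧ MeromorphicAt (iteratedDeriv 2 q) t₀ := by
  have hq' := hq.analyticAt (hB.mem_nhds ht₀)
  have hr' := hr.analyticAt (hB.mem_nhds ht₀)
  refine ⟨hq'.meromorphicAt, hr'.meromorphicAt, hq'.deriv.meromorphicAt,
    hr'.deriv.meromorphicAt, ?_⟩
  simp only [iteratedDeriv_succ, iteratedDeriv_zero]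
  exact hq'.deriv.deriv.meromorphicAt

/-- The behaviour of the solutions with a pole of `x`. -/
theorem tendsto_of_pole (hB : IsOpen B) (hq : DifferentiableOn ℂ q B)
    (hr : DifferentiableOn ℂ r B) (ht₀ : t₀ ∈ B) (hsol : IsMeromorphicSolutionAt q r x y t₀)
    (hpole : ¬ ∃ a, Tendsto x (𝓝[≠] t₀) (𝓝 a)) :
    Tendsto (fun t => (x t)⁻¹) (𝓝[≠] t₀) (𝓝 0) ∧ (∀ᶠ t in 𝓝[≠] t₀, x t ≠ 0) ∧
    Tendsto (fun t => (t - t₀) * y t) (𝓝[≠] t₀) (𝓝 (-1)) ∧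
    ∃ a, (a = 1 ∨ a = -2) ∧ Tendsto (fun t => (t - t₀) * x t) (𝓝[≠] t₀) (𝓝 a) := by
  obtain ⟨hx, hy, hd⟩ := hsol
  obtain ⟨hQ, hR, hQ', hR', hQ''⟩ := tendsto_coefficients hB hq hr ht₀
  have hs : Tendsto (fun t => t - t₀) (𝓝[≠] t₀) (𝓝 0) := tendsto_sub_nhdsNE
  obtain ⟨n, hn, hxn⟩ := exists_order_neg_of_not_tendsto hx hpole
  have hX := tendsto_inv_zero_of_order_neg hxn hn
  have hx0 := eventually_ne_zero_of_order hx hxn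
  -- The first equation reads x'/x = y - 3r/x. The residue of the left-hand side is the order n of
  -- x, and r/x tends to 0.
  have hsy : Tendsto (fun t => (t - t₀) * y t) (𝓝[≠] t₀) (𝓝 n) := by
    have h1 := tendsto_sub_mul_logDeriv hx hxn (hd.mono fun t h => h.1)
    have h2 : Tendsto (fun t => (t - t₀) * (3 * r t * (x t)⁻¹)) (𝓝[≠] t₀) (𝓝 0) := by
      simpa using hs.mul ((hR.const_mul 3).mul hX)
    have h3 := h1.add h2
    rw [add_zero] at h3
    refine h3.congr' ?_
    filter_upwards [hx0] with t ht
    simp only [rhs]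
    field_simp
    ring
  have hn0 : (n : ℂ) ≠ 0 := by exact_mod_cast hn.ne
  have hyn := order_eq_neg_one_of_sub_mul hy hn0 hsy
  have hy0 := eventually_ne_zero_of_order hy hyn
  -- Since y has order -1, the product (t - t₀) y'/y · (t - t₀) y tends to -n.
  have hsy' : Tendsto (fun t => (t - t₀) ^ 2 * (rhs q r ((x t, y t), t)).2) (𝓝[≠] t₀)
      (𝓝 (-n)) := by
    have h1 := (tendsto_sub_mul_logDeriv hy hyn (hd.mono fun t h => h.2)).mul hsy
    have h2 : ((-1 : ℤ) : ℂ) * n = -n := by push_cast; ring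
    rw [h2] at h1
    refine h1.congr' ?_
    filter_upwards [hy0] with t ht
    field_simp
  have hK : Tendsto (fun t => 8 / 3 * q t ^ 2 + 3 * r t + 4 * deriv q t) (𝓝[≠] t₀)
      (𝓝 (8 / 3 * q t₀ ^ 2 + 3 * r t₀ + 4 * deriv q t₀)) :=
    (((hQ.pow 2).const_mul _).add (hR.const_mul _)).add (hQ'.const_mul _)
  have hmul : MeromorphicAt (fun t => (t - t₀) * x t) t₀ := by fun_prop
  have hord : meromorphicOrderAt (fun t => (t - t₀) * x t) t₀ = (1 + n : ℤ) := by
    rw [meromorphicOrderAt_sub_mul hx, hxn]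
    norm_cast
  -- Were the pole of x of higher order, the term 2x²/3 would dominate the second equation; division
  -- by ((t - t₀) x)² would give 2/3 = 0 in the limit.
  have hn1 : n = -1 := by
    by_contra hne
    have hξ := tendsto_inv_zero_of_order_neg hord (by omega)
    have hξ0 := eventually_ne_zero_of_order hmul hord
    have h1 := (hξ.pow 2).mul hsy'
    have h2 := ((((hξ.pow 2).mul (hsy.pow 2)).const_mul (1 / 3)).add
      ((hξ.mul hsy).const_mul (2 / 3))).add (hs.mul ((((hQ.mul hξ).const_mul (10 / 3)).sub
        ((hQ.mul ((hξ.pow 2).mul hsy)).const_mul (2 / 3))).sub ((hξ.pow 2).mul (hs.mul hK))))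
    have h3 := h1.add h2
    have h4 : (2 / 3 : ℂ) = 0 := by
      refine tendsto_nhds_unique (tendsto_const_nhds.congr' ?_) (h3.trans_eq ?_)
      · filter_upwards [hξ0] with t ht
        have h5 := left_ne_zero_of_mul ht
        have h6 := right_ne_zero_of_mul ht
        simp only [rhs]
        field_simp
        ring
      · simp
    norm_num at h4
  subst hn1
  refine ⟨hX, hx0, by simpa using hsy, ?_⟩
  obtain ⟨a, ha0, ha⟩ := (tendsto_ne_zero_iff_meromorphicOrderAt_eq_zero hmul).2
    (by rw [hord]; norm_num)
  refine ⟨a, ?_, ha⟩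
  have h2 := ((((ha.pow 2).const_mul (2 / 3)).sub ((hsy.pow 2).const_mul (1 / 3))).sub
    ((ha.mul hsy).const_mul (2 / 3))).sub (hs.mul ((((hQ.mul ha).const_mul (10 / 3)).sub
      ((hQ.mul hsy).const_mul (2 / 3))).sub (hs.mul hK)))
  have h3 : Tendsto (fun t => (t - t₀) ^ 2 * (rhs q r ((x t, y t), t)).2) (𝓝[≠] t₀) _ :=
    h2.congr' (Eventually.of_forall fun t => by simp only [rhs]; ring)
  have h4 := tendsto_nhds_unique hsy' h3
  push_cast at h4
  -- The terms of order -2 in the second equation give 1 = 2a²/3 - 1/3 + 2a/3 for the residue a of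
  -- x.
  have h5 : (a - 1) * (a + 2) = 0 := by linear_combination -3 / 2 * h4
  rcases mul_eq_zero.1 h5 with h6 | h6
  · exact .inl (by linear_combination h6)
  · exact .inr (by linear_combination h6)

end

/-! ### Limits of the remaining coordinate in the charts 1, 2, 3 -/

section

variable {q r : ℂ → ℂ} {B : Set ℂ} {t₀ : ℂ} {x y : ℂ → ℂ}

theorem meromorphicAt_coord (hB : IsOpen B) (hq : DifferentiableOn ℂ q B)
    (hr : DifferentiableOn ℂ r B) (ht₀ : t₀ ∈ B) (hx : MeromorphicAt x t₀)
    (hy : MeromorphicAt y t₀) (j : Fin 4) :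
    MeromorphicAt (fun t => (coord q r t j (x t, y t)).1) t₀ ∧
    MeromorphicAt (fun t => (coord q r t j (x t, y t)).2) t₀ := by
  obtain ⟨h1, h2, h3, h4, h5⟩ := meromorphicAt_coefficients hB hq hr ht₀
  fin_cases j <;> constructor <;> simp only [coord] <;> fun_prop

/-- The residues 1 of x and -1 of y cancel in XY = x + y - 4q, which therefore has a limit. With XY
taken as a known coefficient, the quadratic term X Y² of the equation for Y becomes linear in Y. -/
theorem exists_tendsto_chart_one (h : Constraint q r B) (hB : IsOpen B)
    (hq : DifferentiableOn ℂ q B) (hr : DifferentiableOn ℂ r B) (ht₀ : t₀ ∈ B)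
    (hsol : IsMeromorphicSolutionAt q r x y t₀)
    (hX : Tendsto (fun t => (x t)⁻¹) (𝓝[≠] t₀) (𝓝 0)) (hx0 : ∀ᶠ t in 𝓝[≠] t₀, x t ≠ 0)
    (hsy : Tendsto (fun t => (t - t₀) * y t) (𝓝[≠] t₀) (𝓝 (-1)))
    (hsx : Tendsto (fun t => (t - t₀) * x t) (𝓝[≠] t₀) (𝓝 1)) :
    ∃ b, Tendsto (fun t => (coord q r t 1 (x t, y t)).2) (𝓝[≠] t₀) (𝓝 b) := by
  obtain ⟨hx, hy, hd⟩ := hsol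
  obtain ⟨hQ, hR, hQ', hR', hQ''⟩ := tendsto_coefficients hB hq hr ht₀
  have hqm := (meromorphicAt_coefficients hB hq hr ht₀).1
  have hs : Tendsto (fun t => t - t₀) (𝓝[≠] t₀) (𝓝 0) := tendsto_sub_nhdsNE
  have hBt : ∀ᶠ t in 𝓝[≠] t₀, t ∈ B := nhdsWithin_le_nhds (hB.mem_nhds ht₀)
  obtain ⟨w, hw⟩ : ∃ w, Tendsto (fun t => y t + x t - 4 * q t) (𝓝[≠] t₀) (𝓝 w) := by
    refine exists_tendsto_of_sub_mul (by fun_prop) ?_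
    have h1 := (hsy.add hsx).sub (hs.mul (hQ.const_mul 4))
    refine (h1.congr fun t => ?_).trans_eq ?_
    · ring
    · simp
  refine exists_tendsto_of_linear (meromorphicAt_coord hB hq hr ht₀ hx hy 1).2
    (A := fun _ => 0) tendsto_const_nhds
    (((hQ.const_mul 2).sub ((hR.mul hX).const_mul 3)).add (hw.const_mul (2 / 3))) ?_
  filter_upwards [hx0, hBt, hd] with t hxt ht hdt
  refine (h.hasDerivAt_coord hB hq hr 1 hdt.1 hdt.2 ht hxt).2.congr_deriv ?_
  simp only [chartRhs, coord]
  field_simp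
  ring

/-- Here the quadratic term is X³ Y², and X³ Y is -(y - x/2) up to terms with limits. The residues
-1 of y and -2 of x cancel in it, so X³ Y has a limit and the equation for Y is treated as linear.
-/
theorem exists_tendsto_chart_two (h : Constraint q r B) (hB : IsOpen B)
    (hq : DifferentiableOn ℂ q B) (hr : DifferentiableOn ℂ r B) (ht₀ : t₀ ∈ B)
    (hsol : IsMeromorphicSolutionAt q r x y t₀)
    (hX : Tendsto (fun t => (x t)⁻¹) (𝓝[≠] t₀) (𝓝 0)) (hx0 : ∀ᶠ t in 𝓝[≠] t₀, x t ≠ 0)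
    (hsy : Tendsto (fun t => (t - t₀) * y t) (𝓝[≠] t₀) (𝓝 (-1)))
    (hsx : Tendsto (fun t => (t - t₀) * x t) (𝓝[≠] t₀) (𝓝 (-2))) :
    ∃ b, Tendsto (fun t => (coord q r t 2 (x t, y t)).2) (𝓝[≠] t₀) (𝓝 b) := by
  obtain ⟨hx, hy, hd⟩ := hsol
  obtain ⟨hQ, hR, hQ', hR', hQ''⟩ := tendsto_coefficients hB hq hr ht₀
  have hBt : ∀ᶠ t in 𝓝[≠] t₀, t ∈ B := nhdsWithin_le_nhds (hB.mem_nhds ht₀)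
  have hYm := (meromorphicAt_coord hB hq hr ht₀ hx hy 2).2
  obtain ⟨w, hw⟩ : ∃ w, Tendsto (fun t => (x t)⁻¹ ^ 3 * (coord q r t 2 (x t, y t)).2)
      (𝓝[≠] t₀) (𝓝 w) := by
    refine exists_tendsto_of_sub_mul (by fun_prop) ?_
    have h1 := hsx.mul (((((hsy.div hsx (by norm_num)).sub_const (1 / 2)).add
      ((hQ.const_mul 2).mul hX)).sub (((hR.const_mul (9 / 2)).add (hQ'.const_mul 6)).mul
        (hX.pow 2))).add (((hR'.const_mul 9).add (hQ''.const_mul 12)).mul (hX.pow 3))).neg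
    refine (h1.congr' ?_).trans_eq ?_
    · filter_upwards [hx0, self_mem_nhdsWithin] with t hxt ht
      have hst : t - t₀ ≠ 0 := sub_ne_zero.2 ht
      simp only [coord, Pi.div_apply]
      field_simp
      ring
    · norm_num
  refine exists_tendsto_of_linear hYm
    (((((hR.mul hR').const_mul (81 / 2)).add ((hQ''.mul hR).const_mul 54)).add
      (((hQ'.mul hR').const_mul 126).add ((hQ'.mul hQ'').const_mul 168))).add
      ((((hR'.pow 2).const_mul (-135)).sub ((hQ''.mul hR').const_mul 360)).sub
        ((hQ''.pow 2).const_mul 240) |>.mul hX))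
    ((((hQ.const_mul (-4)).add (((hR.const_mul 6).add (hQ'.const_mul 20)).mul hX)).sub
      (((hR'.const_mul 39).add (hQ''.const_mul 52)).mul (hX.pow 2))).sub (hw.const_mul (8 / 3))) ?_
  filter_upwards [hx0, hBt, hd] with t hxt ht hdt
  refine (h.hasDerivAt_coord hB hq hr 2 hdt.1 hdt.2 ht hxt).2.congr_deriv ?_
  have h1 : (coord q r t 2 (x t, y t)).1 = (x t)⁻¹ := one_div _
  rw [h1]
  simp only [chartRhs]
  ring

/-- With x bounded, y'/y is -y/3 up to bounded terms, so (t - t₀) y tends to -3 times the order of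
y; hence the order is -1 and the residue is 3. A non-zero limit of x would give x'/x residue 0,
while x'/x = y - 3r/x has residue 3. -/
theorem tendsto_of_pole_snd (hB : IsOpen B) (hq : DifferentiableOn ℂ q B)
    (hr : DifferentiableOn ℂ r B) (ht₀ : t₀ ∈ B) (hsol : IsMeromorphicSolutionAt q r x y t₀)
    {x₀ : ℂ} (hx₀ : Tendsto x (𝓝[≠] t₀) (𝓝 x₀))
    (hpole : ¬ ∃ a, Tendsto y (𝓝[≠] t₀) (𝓝 a)) :
    Tendsto (fun t => (y t)⁻¹) (𝓝[≠] t₀) (𝓝 0) ∧ (∀ᶠ t in 𝓝[≠] t₀, y t ≠ 0) ∧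
    Tendsto (fun t => (t - t₀) * y t) (𝓝[≠] t₀) (𝓝 3) ∧ x₀ = 0 := by
  obtain ⟨hx, hy, hd⟩ := hsol
  obtain ⟨hQ, hR, hQ', hR', hQ''⟩ := tendsto_coefficients hB hq hr ht₀
  have hs : Tendsto (fun t => t - t₀) (𝓝[≠] t₀) (𝓝 0) := tendsto_sub_nhdsNE
  obtain ⟨n, hn, hyn⟩ := exists_order_neg_of_not_tendsto hy hpole
  have hY := tendsto_inv_zero_of_order_neg hyn hn
  have hy0 := eventually_ne_zero_of_order hy hyn
  have hsy : Tendsto (fun t => (t - t₀) * y t) (𝓝[≠] t₀) (𝓝 (-3 * n)) := by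
    have h1 := tendsto_sub_mul_logDeriv hy hyn (hd.mono fun t h => h.2)
    have h2 := (h1.const_mul (-3)).add (hs.mul ((((((hx₀.pow 2).const_mul 2).sub
      ((hQ.mul hx₀).const_mul 10)).add (((hQ.pow 2).const_mul 8).add
        ((hR.const_mul 9).add (hQ'.const_mul 12)))).mul hY).add
          ((hQ.const_mul 2).sub (hx₀.const_mul 2))))
    rw [zero_mul, add_zero] at h2
    refine h2.congr' ?_
    filter_upwards [hy0] with t ht
    simp only [rhs]
    field_simp
    ring
  have hn0 : (-3 * n : ℂ) ≠ 0 := by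
    refine mul_ne_zero (by norm_num) ?_
    exact_mod_cast hn.ne
  have hn1 : n = -1 := by
    have := order_eq_neg_one_of_sub_mul hy hn0 hsy
    rw [hyn] at this
    exact_mod_cast this
  subst hn1
  have hsy3 : Tendsto (fun t => (t - t₀) * y t) (𝓝[≠] t₀) (𝓝 3) := by
    refine hsy.trans_eq ?_
    norm_num
  refine ⟨hY, hy0, hsy3, ?_⟩
  by_contra hne
  have hxn : meromorphicOrderAt x t₀ = (0 : ℤ) :=
    (tendsto_ne_zero_iff_meromorphicOrderAt_eq_zero hx).1 ⟨x₀, hne, hx₀⟩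
  have h1 := tendsto_sub_mul_logDeriv hx hxn (hd.mono fun t h => h.1)
  have h2 := h1.add (hs.mul ((hR.const_mul 3).div hx₀ hne))
  have h3 : (3 : ℂ) = 0 := by
    refine tendsto_nhds_unique hsy3 ((h2.congr' ?_).trans_eq ?_)
    · filter_upwards [eventually_ne_zero_of_order hx hxn] with t ht
      simp only [rhs, Pi.div_apply]
      field_simp
      ring
    · simp
  norm_num at h3

/-- The coefficients of the right-hand side of the equation for `x_3`, as a polynomial in `x_3`. -/
def chartThreeCoeff (q r : ℂ → ℂ) (i : Fin 3) (p : ℂ × ℂ) : ℂ :=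
  match i with
  | 0 => (chartRhs q r 3 0 p.1 p.2).1
  | 1 => 2 * q p.2
      + (-3 * r p.2 + 8 * q p.2 ^ 2 + 12 * deriv q p.2) * p.1
      + (-30 * q p.2 * r p.2 - 45 * deriv r p.2) * p.1 ^ 2
      + (135 / 2 * r p.2 ^ 2 + 150 * q p.2 ^ 2 * r p.2 - 225 * q p.2 * deriv r p.2) * p.1 ^ 3
      + (-324 * q p.2 * r p.2 ^ 2 + 486 * r p.2 * deriv r p.2) * p.1 ^ 4
      + (378 * q p.2 ^ 2 * r p.2 ^ 2 - 1134 * q p.2 * r p.2 * deriv r p.2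
        + 1701 / 2 * deriv r p.2 ^ 2) * p.1 ^ 5
  | 2 => 2 * p.1 + 10 * q p.2 * p.1 ^ 2 - 21 * r p.2 * p.1 ^ 3
      + (48 * q p.2 * r p.2 - 72 * deriv r p.2) * p.1 ^ 4

/-- The quadratic and cubic terms in X contain enough powers of Y for all but one factor X to be
absorbed into Y² X, so the equation becomes linear in X once Y² X is known to converge. -/
theorem chartRhs_three_fst (X Y t : ℂ) :
    (chartRhs q r 3 X Y t).1 = chartThreeCoeff q r 0 (Y, t) + (chartThreeCoeff q r 1 (Y, t)
      + chartThreeCoeff q r 2 (Y, t) * (Y ^ 2 * X) + 2 * (Y ^ 3 * (Y ^ 2 * X) ^ 2)) * X := by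
  simp only [chartRhs, chartThreeCoeff]
  ring

theorem continuousAt_chartThreeCoeff (hB : IsOpen B) (hq : DifferentiableOn ℂ q B)
    (hr : DifferentiableOn ℂ r B) (ht₀ : t₀ ∈ B) (i : Fin 3) :
    ContinuousAt (chartThreeCoeff q r i) (0, t₀) := by
  obtain ⟨h1, h2, h3, h4, h5⟩ := contDiffAt_coefficients hB hq hr ht₀
  have c1 : ContinuousAt q ((0 : ℂ), t₀).2 := h1.continuousAt
  have c2 : ContinuousAt r ((0 : ℂ), t₀).2 := h2.continuousAt
  have c3 : ContinuousAt (deriv q) ((0 : ℂ), t₀).2 := h3.continuousAt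
  have c4 : ContinuousAt (deriv r) ((0 : ℂ), t₀).2 := h4.continuousAt
  fin_cases i
  · change ContinuousAt (fun p => chartThreeCoeff q r 0 p) _
    simp only [chartThreeCoeff, chartRhs]
    fun_prop
  · change ContinuousAt (fun p => chartThreeCoeff q r 1 p) _
    simp only [chartThreeCoeff]
    fun_prop
  · change ContinuousAt (fun p => chartThreeCoeff q r 2 p) _
    simp only [chartThreeCoeff]
    fun_prop

/-- The product Y² X equals -x y up to terms with limits. It has at most a simple pole, and its
residue vanishes since x tends to 0 while (t - t₀) y tends to 3. So it has a limit, as needed in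
`chartRhs_three_fst`. -/
theorem exists_tendsto_chart_three (h : Constraint q r B) (hB : IsOpen B)
    (hq : DifferentiableOn ℂ q B) (hr : DifferentiableOn ℂ r B) (ht₀ : t₀ ∈ B)
    (hsol : IsMeromorphicSolutionAt q r x y t₀)
    (hx₀ : Tendsto x (𝓝[≠] t₀) (𝓝 0))
    (hY : Tendsto (fun t => (y t)⁻¹) (𝓝[≠] t₀) (𝓝 0)) (hy0 : ∀ᶠ t in 𝓝[≠] t₀, y t ≠ 0)
    (hsy : Tendsto (fun t => (t - t₀) * y t) (𝓝[≠] t₀) (𝓝 3)) :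
    ∃ b, Tendsto (fun t => (coord q r t 3 (x t, y t)).1) (𝓝[≠] t₀) (𝓝 b) := by
  obtain ⟨hx, hy, hd⟩ := hsol
  obtain ⟨hQ, hR, hQ', hR', hQ''⟩ := tendsto_coefficients hB hq hr ht₀
  have hBt : ∀ᶠ t in 𝓝[≠] t₀, t ∈ B := nhdsWithin_le_nhds (hB.mem_nhds ht₀)
  have hXm := (meromorphicAt_coord hB hq hr ht₀ hx hy 3).1
  obtain ⟨w, hw⟩ : ∃ w, Tendsto (fun t => (y t)⁻¹ ^ 2 * (coord q r t 3 (x t, y t)).1)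
      (𝓝[≠] t₀) (𝓝 w) := by
    refine exists_tendsto_of_sub_mul (by fun_prop) ?_
    have h1 := hsy.mul ((hx₀.sub ((hR.const_mul (9 / 2)).mul hY)).add
      ((((hQ.mul hR).const_mul 9).sub (hR'.const_mul (27 / 2))).mul (hY.pow 2))).neg
    refine (h1.congr' ?_).trans_eq ?_
    · filter_upwards [hy0] with t hyt
      simp only [coord]
      field_simp
      ring
    · norm_num
  have hc : ∀ i, Tendsto (fun t => chartThreeCoeff q r i ((y t)⁻¹, t)) (𝓝[≠] t₀)
      (𝓝 (chartThreeCoeff q r i (0, t₀))) := fun i =>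
    (continuousAt_chartThreeCoeff hB hq hr ht₀ i).tendsto.comp
      (hY.prodMk_nhds (tendsto_id.mono_left nhdsWithin_le_nhds))
  refine exists_tendsto_of_linear hXm (hc 0)
    (((hc 1).add ((hc 2).mul hw)).add (((hY.pow 3).mul (hw.pow 2)).const_mul 2)) ?_
  filter_upwards [hy0, hBt, hd] with t hyt ht hdt
  refine (h.hasDerivAt_coord hB hq hr 3 hdt.1 hdt.2 ht hyt).1.congr_deriv ?_
  have h1 : (coord q r t 3 (x t, y t)).2 = (y t)⁻¹ := one_div _
  rw [h1]
  exact chartRhs_three_fst _ _ _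

/-- In one of the four charts the coordinates of a meromorphic solution have limits. -/
theorem exists_tendsto_coord (h : Constraint q r B) (hB : IsOpen B)
    (hq : DifferentiableOn ℂ q B) (hr : DifferentiableOn ℂ r B) (ht₀ : t₀ ∈ B)
    (hsol : IsMeromorphicSolutionAt q r x y t₀) :
    ∃ (j : Fin 4) (w : ℂ × ℂ), (∀ᶠ t in 𝓝[≠] t₀, (x t, y t) ∈ coordDom j) ∧
      Tendsto (fun t => coord q r t j (x t, y t)) (𝓝[≠] t₀) (𝓝 w) := by
  by_cases hxp : ∃ a, Tendsto x (𝓝[≠] t₀) (𝓝 a)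
  · obtain ⟨x₀, hx₀⟩ := hxp
    by_cases hyp : ∃ a, Tendsto y (𝓝[≠] t₀) (𝓝 a)
    · obtain ⟨y₀, hy₀⟩ := hyp
      exact ⟨0, _, Eventually.of_forall fun _ => trivial, hx₀.prodMk_nhds hy₀⟩
    · obtain ⟨hY, hy0, hsy, rfl⟩ := tendsto_of_pole_snd hB hq hr ht₀ hsol hx₀ hyp
      obtain ⟨b, hb⟩ := exists_tendsto_chart_three h hB hq hr ht₀ hsol hx₀ hY hy0 hsy
      refine ⟨3, (b, 0), hy0, hb.prodMk_nhds (hY.congr fun t => ?_)⟩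
      exact (one_div _).symm
  · obtain ⟨hX, hx0, hsy, a, rfl | rfl, hsx⟩ := tendsto_of_pole hB hq hr ht₀ hsol hxp
    · obtain ⟨b, hb⟩ := exists_tendsto_chart_one h hB hq hr ht₀ hsol hX hx0 hsy hsx
      refine ⟨1, (0, b), hx0, (hX.congr fun t => ?_).prodMk_nhds hb⟩
      exact (one_div _).symm
    · obtain ⟨b, hb⟩ := exists_tendsto_chart_two h hB hq hr ht₀ hsol hX hx0 hsy hsx
      refine ⟨2, (0, b), hx0, (hX.congr fun t => ?_).prodMk_nhds hb⟩
      exact (one_div _).symm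

theorem exists_limit (h : Constraint q r B) (hB : IsOpen B)
    (hq : DifferentiableOn ℂ q B) (hr : DifferentiableOn ℂ r B) (ht₀ : t₀ ∈ B)
    {P : Threefold} {φ : Fin 4 → OpenPartialHomeomorph P ((ℂ × ℂ) × ℂ)}
    (hφ : ∀ j, (φ j).target = univ ×ˢ B)
    (hglued : IsGluedBy univ φ (coordTDom B) (coordT q r))
    (hsol : IsMeromorphicSolutionAt q r x y t₀) :
    ∃ (p : P) (j : Fin 4), p ∈ (φ j).source ∧ (φ j p).2 = t₀ ∧
      Tendsto (fun t => (φ 0).symm ((x t, y t), t)) (𝓝[≠] t₀) (𝓝 p) := by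
  obtain ⟨j, w, hj, hw⟩ := exists_tendsto_coord h hB hq hr ht₀ hsol
  have hwt : (w, t₀) ∈ (φ j).target := by
    rw [hφ]
    exact ⟨trivial, ht₀⟩
  refine ⟨(φ j).symm (w, t₀), j, (φ j).map_target hwt, by rw [(φ j).right_inv hwt], ?_⟩
  have h1 : Tendsto (fun t => (coord q r t j (x t, y t), t)) (𝓝[≠] t₀) (𝓝 (w, t₀)) :=
    hw.prodMk_nhds (tendsto_id.mono_left nhdsWithin_le_nhds)
  refine (((φ j).continuousAt_symm hwt).tendsto.comp h1).congr' ?_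
  have hBt : ∀ᶠ t in 𝓝[≠] t₀, t ∈ B := nhdsWithin_le_nhds (hB.mem_nhds ht₀)
  filter_upwards [hj, hBt] with t hjt ht
  have h0 : ((x t, y t), t) ∈ (φ 0).target := by
    rw [hφ]
    exact ⟨trivial, ht⟩
  have h2 := (φ 0).map_target h0
  have h3 := (hglued.overlap j _ h2).2 (by rw [(φ 0).right_inv h0]; exact ⟨hjt, ht⟩)
  have h4 := hglued.transition j _ ⟨h2, h3⟩
  rw [(φ 0).right_inv h0] at h4
  change (φ j).symm (coordT q r j ((x t, y t), t)) = _
  rw [← h4, (φ j).left_inv h3]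

end

end Ince

end

theorem mainTheorem11 (B : Set ℂ) (hB : IsOpen B) (hBc : IsConnected B)
    (q r : ℂ → ℂ) (hq : DifferentiableOn ℂ q B) (hr : DifferentiableOn ℂ r B) :
    ∃ (X : ∀ t : B, Ince.BlowUpTower (Ince.arc q r t))
      (D : ∀ t : B, Fin 8 → Set (X t).top)
      (ψ : ∀ t : B, Fin 4 → OpenPartialHomeomorph (X t).top (ℂ × ℂ))
      (P : Ince.Threefold)
      (φ : Fin 4 → OpenPartialHomeomorph P ((ℂ × ℂ) × ℂ)),
      -- each compact rational surface is of type `E₇⁽¹⁾`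
      (∀ t, Ince.IsTypeAffineE7 (X t).top (D t)) ∧
      -- the complement of the eight curves is glued from four copies of `ℂ²`
      (∀ t j, Ince.IsHolChart (X t).top (ψ t j) ∧ (ψ t j).target = univ) ∧
      (∀ t z, (ψ t 0).symm z = (X t).affine (Fin.last 10) z) ∧
      (∀ t : B, Ince.IsGluedBy (⋃ i, D t i)ᶜ (ψ t) Ince.coordDom (Ince.coord q r t)) ∧
      -- the phase space is glued from four copies of `ℂ² × B`
      (∀ j, Ince.IsHolChart P (φ j) ∧ (φ j).target = univ ×ˢ B) ∧
      Ince.IsGluedBy univ φ (Ince.coordTDom B) (Ince.coordT q r) ∧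
      -- its fibre over `t` is the complement of the eight curves
      (∀ t : B, ∃ e : P → (X t).top, ∀ j, ∀ p ∈ (φ j).source, (φ j p).2 = t →
        e p ∈ (ψ t j).source ∧ ψ t j (e p) = (φ j p).1) ∧
      -- it is the phase space of the system exactly under the condition on `q` and `r`
      ((∀ j, Ince.HolomorphicInChart q r B j) → Ince.Constraint q r B) ∧
      (Ince.Constraint q r B → ∀ j, Ince.PolynomialInChart q r B j) ∧
      (Ince.Constraint q r B → ∀ t₀ ∈ B, ∀ x y : ℂ → ℂ,
        Ince.IsMeromorphicSolutionAt q r x y t₀ →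
          ∃ (p : P) (j : Fin 4), p ∈ (φ j).source ∧ (φ j p).2 = t₀ ∧
            Tendsto (fun t => (φ 0).symm ((x t, y t), t)) (𝓝[≠] t₀) (𝓝 p)) := by
  have : Nonempty B := hBc.nonempty.to_subtype
  choose X D ψ hE7 hψ hψ₀ hglued using fun t : B => Ince.exists_tower q r t
  let F : Ince.Family q r B := ⟨fun t => (X t).top, fun t => (⋃ i, D t i)ᶜ, ψ,
    fun t j => (hψ t j).2, hglued⟩
  obtain ⟨P, φ, hφ, hφglued, hfibre⟩ := Ince.exists_threefold F hB hq hr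
  exact ⟨X, D, ψ, P, φ, hE7, hψ, hψ₀, hglued, hφ, hφglued, hfibre,
    Ince.constraint_of_holomorphicInChart hB hBc hq hr,
    fun h => h.polynomialInChart hB hq hr,
    fun h t₀ ht₀ x y hsol => Ince.exists_limit h hB hq hr ht₀ (fun j => (hφ j).2) hφglued hsol⟩
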